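/- **Definitions.** Let $\kappa$ be an infinite cardinal. A *weak $\kappa$-model* is a (not necessarily transitive) set $M$ of size $\kappa$ with $\kappa+1\subseteq M$ and $\langle M,\in\rangle\models\mathrm{ZFC}^-$ (ZFC without power set, with collection); it is a *$\kappa$-model* if also $M^{<\kappa}\subseteq M$. An elementary embedding $j\colon M\to N$ into a transitive set $N$ is *$\kappa$-powerset preserving* if it has critical point $\kappa$ and $M$, $N$ have the same subsets of $\kappa$. For regular cardinals $\alpha\le\kappa$, $\kappa$ is *$\alpha$-Ramsey* if for arbitrarily large regular cardinals $\theta$, every $A\subseteq\kappa$ is an element of some weak $\kappa$-model $M\prec H(\theta)$ that is closed under ${<}\alpha$-sequences and has a $\kappa$-powerset preserving elementary embedding $j\colon M\to N$. A *filter* on $\kappa$ is a set $F\subseteq\mathcal P(\kappa)$ all of whose finite intersections of members have size $\kappa$; it *measures* $X\subseteq\mathcal P(\kappa)$ if it contains $A$ or $\kappa\setminus A$ for all $A\in X$; it is *$M$-normal* if it measures $\mathcal P(\kappa)\cap M$ and contains the diagonal intersection of every sequence $\langle X_\xi\mid\xi<\kappa\rangle\in M$ of its members. For an uncountable regular $\kappa=\kappa^{<\kappa}$,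 regular $\theta>\kappa$ and $\gamma\le\kappa$, in the game $G^\theta_\gamma(\kappa)$ the challenger and the judge play, at stages $\xi<\gamma$, $\subseteq$-increasing $\kappa$-models $M_\xi\prec H(\theta)$ with $\langle M_\eta\mid\eta<\xi\rangle,\langle F_\eta\cap M_\eta\mid\eta<\xi\rangle\in M_\xi$, and $\subseteq$-increasing filters $F_\xi$ on $\kappa$ measuring $\mathcal P(\kappa)\cap M_\xi$, respectively; the judge wins if $\bigcup_{\xi<\gamma}F_\xi$ is $\bigcup_{\xi<\gamma}M_\xi$-normal. In the *well-founded* game the ultrapower of $\bigcup_{\xi<\gamma}M_\xi$ by $\bigcup_{\xi<\gamma}F_\xi$ must also be well-founded for the judge to win. $\kappa$ has the *(well-founded) $\gamma$-filter property* if for every regular $\theta>\kappa$ the challenger has no winning strategy in the (well-founded) game. For a singular cardinal $\alpha\le\kappa$, $\kappa$ is *$\alpha$-Ramsey* if it has the $\alpha$-filter property. There is an alternative convention, under which the well-founded $\alpha$-filter property is used for singular $\alpha$ of cofinality $\omega$; the theorem below holds under either convention. **Theorem.** Let $\omega\le\alpha_0<\alpha_1\le\kappa$ be cardinals, and let $\kappa$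 be $\alpha_1$-Ramsey. Then: 1. $V_\kappa$ satisfies that there is a proper class of $\alpha_0$-Ramsey cardinals, that is, for unboundedly many cardinals $\mu<\kappa$, $V_\kappa\models$ "$\mu$ is $\alpha_0$-Ramsey". 2. If $\alpha_0$ is regular, then $\kappa$ is a limit of $\alpha_0$-Ramsey cardinals. 3. The $\alpha$-Ramsey cardinals form a hierarchy: $\kappa$ is itself $\alpha_0$-Ramsey. It is strict: if $\alpha_0$ is regular and $\alpha_1<\kappa$, then there is a cardinal $\mu$ with $\alpha_1<\mu<\kappa$ that is $\alpha_0$-Ramsey but not $\alpha_1$-Ramsey. -/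

import Mathlib

open FirstOrder

universe u

namespace RamseyHierarchy

/-! ### First-order structures `⟨S, ∈⟩`

The universe of sets is Mathlib's `ZFSet`.  Cardinals and ordinals are Mathlib's; the ordinal `o`, as
a set, is the von Neumann ordinal `o.toZFSet`. -/

/-- The only relation symbol of the language of set theory. -/
inductive SetRel : ℕ → Type
  | mem : SetRel 2

/-- The first-order language of set theory, with one binary relation symbol. -/
def setLang : Language := ⟨fun _ => Empty, SetRel⟩

/-- Every class `S` of sets is a structure `⟨S, ∈⟩`. -/
instance setStructure (S : Set ZFSet.{u}) : setLang.Structure S where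
  funMap := fun f => Empty.elim f
  RelMap | .mem => fun v => (v 0).1 ∈ (v 1).1

/-- `⟨S, ∈⟩ ≺ ⟨T, ∈⟩`: the inclusion of `S` into `T` is an elementary embedding. -/
def ElemSub (S T : Set ZFSet.{u}) : Prop :=
  ∃ e : S ↪ₑ[setLang] T, ∀ x : S, (e x).1 = x.1

/-- In the structure `⟨S, ∈⟩`, `p` is the Kuratowski pair of `x` and `y`. -/
def PairIn {S : Set ZFSet.{u}} (p x y : S) : Prop :=
  ∃ s t : S, (∀ w : S, w.1 ∈ s.1 ↔ w = x) ∧ (∀ w : S, w.1 ∈ t.1 ↔ w = x ∨ w = y) ∧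
    ∀ w : S, w.1 ∈ p.1 ↔ w = s ∨ w = t

/-- In the structure `⟨S, ∈⟩`, the pair `(x, y)` belongs to the set `r`. -/
def RelIn {S : Set ZFSet.{u}} (r x y : S) : Prop :=
  ∃ p : S, p.1 ∈ r.1 ∧ PairIn p x y

/-- `⟨S, ∈⟩ ⊨ ZFC⁻`, that is, `ZFC` without the power set axiom, with the collection scheme,
and with the axiom of choice in the form of the well-ordering principle. -/
structure ModelsZFCMinus (S : Set ZFSet.{u}) : Prop where
  extensionality : ∀ x y : S, (∀ z : S, z.1 ∈ x.1 ↔ z.1 ∈ y.1) → x = y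
  foundation : ∀ x : S, (∃ y : S, y.1 ∈ x.1) →
    ∃ y : S, y.1 ∈ x.1 ∧ ∀ z : S, z.1 ∈ x.1 → z.1 ∉ y.1
  pairing : ∀ x y : S, ∃ z : S, ∀ w : S, w.1 ∈ z.1 ↔ w = x ∨ w = y
  union : ∀ x : S, ∃ z : S, ∀ w : S, w.1 ∈ z.1 ↔ ∃ y : S, y.1 ∈ x.1 ∧ w.1 ∈ y.1
  infinity : ∃ x : S, (∃ e : S, e.1 ∈ x.1 ∧ ∀ z : S, z.1 ∉ e.1) ∧
    ∀ y : S, y.1 ∈ x.1 → ∃ s : S, s.1 ∈ x.1 ∧ ∀ w : S, w.1 ∈ s.1 ↔ w.1 ∈ y.1 ∨ w = y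
  separation : ∀ (n : ℕ) (φ : setLang.Formula (Fin (n + 1))) (p : Fin n → S) (a : S),
    ∃ b : S, ∀ x : S, x.1 ∈ b.1 ↔ x.1 ∈ a.1 ∧ φ.Realize (Fin.cons x p : Fin (n + 1) → S)
  collection : ∀ (n : ℕ) (φ : setLang.Formula (Fin (n + 2))) (p : Fin n → S) (a : S),
    (∀ x : S, x.1 ∈ a.1 →
      ∃ y : S, φ.Realize (Fin.cons x (Fin.cons y p : Fin (n + 1) → S) : Fin (n + 2) → S)) →
    ∃ b : S, ∀ x : S, x.1 ∈ a.1 → ∃ y : S, y.1 ∈ b.1 ∧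
      φ.Realize (Fin.cons x (Fin.cons y p : Fin (n + 1) → S) : Fin (n + 2) → S)
  wellOrdering : ∀ a : S, ∃ r : S,
    (∀ x : S, x.1 ∈ a.1 → ¬ RelIn r x x) ∧
    (∀ x y z : S, x.1 ∈ a.1 → y.1 ∈ a.1 → z.1 ∈ a.1 → RelIn r x y → RelIn r y z → RelIn r x z) ∧
    (∀ x y : S, x.1 ∈ a.1 → y.1 ∈ a.1 → x = y ∨ RelIn r x y ∨ RelIn r y x) ∧
    ∀ b : S, (∃ x : S, x.1 ∈ b.1) → (∀ x : S, x.1 ∈ b.1 → x.1 ∈ a.1) →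
      ∃ x : S, x.1 ∈ b.1 ∧ ∀ y : S, y.1 ∈ b.1 → y = x ∨ RelIn r x y

/-! ### Weak `κ`-models, embeddings, and filters -/

/-- `H(θ)`, the collection of all sets whose transitive closure has size less than `θ`.  (The
transitive closure of `x` is the least transitive set that includes `x`.) -/
def HSet (θ : Cardinal.{u}) : Set ZFSet.{u} :=
  {x | ∃ t : ZFSet.{u}, t.IsTransitive ∧ x ⊆ t ∧ t.card < θ}

/-- The cardinal `κ` as a set (an initial von Neumann ordinal). -/
noncomputable def cardSet (κ : Cardinal.{u}) : ZFSet.{u} := κ.ord.toZFSet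

/-- The sequence `⟨f β | β < δ⟩` as a set. -/
noncomputable def seqSet (δ : Ordinal.{u}) (f : Ordinal.{u} → ZFSet.{u}) : ZFSet.{u} :=
  ZFSet.range fun β : Set.Iio δ => ZFSet.pair β.1.toZFSet (f β.1)

/-- `f` is a function (a set of pairs) with domain `d`. -/
def IsFunOn (d f : ZFSet.{u}) : Prop := ∃ y : ZFSet.{u}, ZFSet.IsFunc d y f

/-- `M` is closed under `<α`-sequences. -/
def ClosedUnderLT (α : Cardinal.{u}) (M : ZFSet.{u}) : Prop :=
  ∀ δ : Ordinal.{u}, δ < α.ord → ∀ f : Ordinal.{u} → ZFSet.{u},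
    (∀ β < δ, f β ∈ M) → seqSet δ f ∈ M

/-- Weak `κ`-models; they need not be transitive. -/
structure IsWeakModel (κ : Cardinal.{u}) (M : ZFSet.{u}) : Prop where
  card_eq : M.card = κ
  subset : cardSet κ ⊆ M
  mem : cardSet κ ∈ M
  models : ModelsZFCMinus (M : Set ZFSet.{u})

/-- `κ`-models: weak `κ`-models `M` with `M^{<κ} ⊆ M`. -/
structure IsKModel (κ : Cardinal.{u}) (M : ZFSet.{u}) : Prop extends IsWeakModel κ M where
  closed : ClosedUnderLT κ M

/-- `j : M → N` is `κ`-powerset preserving: it has critical point `κ`, and `M` and `N` have the same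
subsets of `κ`. -/
structure PowersetPreserving (κ : Cardinal.{u}) (M N : Set ZFSet.{u}) (j : M → N) : Prop where
  fix : ∀ x : M, x.1 ∈ cardSet κ → (j x).1 = x.1
  moves : ∀ x : M, x.1 = cardSet κ → (j x).1 ≠ cardSet κ
  subsets : ∀ x : ZFSet.{u}, x ⊆ cardSet κ → (x ∈ M ↔ x ∈ N)

/-- (Partial) filters on `κ`: finite intersections of members have size `κ`. -/
structure IsFilterOn (κ : Cardinal.{u}) (F : ZFSet.{u}) : Prop where
  subset : ∀ A ∈ F, A ⊆ cardSet κ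
  card_inter : ∀ (n : ℕ) (A : Fin n → ZFSet.{u}), (∀ i, A i ∈ F) →
    (ZFSet.sep (fun z => ∀ i, z ∈ A i) (cardSet κ)).card = κ

/-- `F` measures all elements of `𝒫(κ) ∩ M`. -/
def Measures (κ : Cardinal.{u}) (F M : ZFSet.{u}) : Prop :=
  ∀ A ∈ M, A ⊆ cardSet κ → A ∈ F ∨ cardSet κ \ A ∈ F

/-- The diagonal intersection `{β < κ | ∀ α < β, β ∈ X α}` of a sequence `X = ⟨X α | α < κ⟩`. -/
noncomputable def diagInter (κ : Cardinal.{u}) (X : ZFSet.{u}) : ZFSet.{u} :=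
  ZFSet.sep (fun β => ∀ α ∈ β, ∀ A, ZFSet.pair α A ∈ X → β ∈ A) (cardSet κ)

/-- `F` is an `M`-normal filter on `κ`. -/
structure IsNormalFor (κ : Cardinal.{u}) (M F : ZFSet.{u}) : Prop where
  filter : IsFilterOn κ F
  measures : Measures κ F M
  normal : ∀ X ∈ M, IsFunOn (cardSet κ) X →
    (∀ α A, ZFSet.pair α A ∈ X → A ∈ F) → diagInter κ X ∈ F

/-- The membership relation of the ultrapower of `M` by `F`, on representatives:
`{α < κ | f α ∈ g α} ∈ F`. -/
def UltMem (κ : Cardinal.{u}) (F f g : ZFSet.{u}) : Prop :=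
  ZFSet.sep (fun α => ∃ x y, ZFSet.pair α x ∈ f ∧ ZFSet.pair α y ∈ g ∧ x ∈ y) (cardSet κ) ∈ F

/-- The ultrapower of `M` by `F`, formed with the functions on `κ` that belong to `M`, is
well-founded. -/
def WfUltrapower (κ : Cardinal.{u}) (M F : ZFSet.{u}) : Prop :=
  WellFounded fun f g : {f : ZFSet.{u} // f ∈ M ∧ IsFunOn (cardSet κ) f} => UltMem κ F f.1 g.1

/-! ### Filter games

In the game of length `γ`, at stage `α < γ` the challenger plays `M α`, and then the judge plays
`F α`. -/

/-- The rules for the move of the challenger at stage `α`. -/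
structure ChallengerLegal (κ θ : Cardinal.{u}) (M F : Ordinal.{u} → ZFSet.{u}) (α : Ordinal.{u}) :
    Prop where
  model : IsKModel κ (M α)
  elem : ElemSub (M α : Set ZFSet.{u}) (HSet θ)
  mono : ∀ β < α, M β ⊆ M α
  models_mem : seqSet α M ∈ M α
  filters_mem : seqSet α (fun β => F β ∩ M β) ∈ M α

/-- The rules for the move of the judge at stage `α`. -/
structure JudgeLegal (κ : Cardinal.{u}) (M F : Ordinal.{u} → ZFSet.{u}) (α : Ordinal.{u}) :
    Prop where
  filter : IsFilterOn κ (F α)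
  measures : Measures κ (F α) (M α)
  mono : ∀ β < α, F β ⊆ F α

/-- The union of the first `γ` sets of a sequence. -/
noncomputable def unionSeq (γ : Ordinal.{u}) (f : Ordinal.{u} → ZFSet.{u}) : ZFSet.{u} :=
  ZFSet.iUnion fun β : Set.Iio γ => f β.1

/-- The winning condition for the judge in a run of length `γ` that follows the rules.  If `wf`
holds, then the ultrapower is required to be well-founded in addition. -/
def JudgeWins (wf : Prop) (κ : Cardinal.{u}) (γ : Ordinal.{u}) (M F : Ordinal.{u} → ZFSet.{u}) :
    Prop :=
  IsNormalFor κ (unionSeq γ M) (unionSeq γ F) ∧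
    (wf → WfUltrapower κ (unionSeq γ M) (unionSeq γ F))

/-- A strategy for the challenger: it yields the move at stage `α` from the moves of the judge at
the earlier stages. -/
def Strategy : Type (u + 1) := ∀ α : Ordinal.{u}, (Set.Iio α → ZFSet.{u}) → ZFSet.{u}

/-- The moves of the challenger when following `σ` while the judge plays `F`. -/
def Strategy.play (σ : Strategy.{u}) (F : Ordinal.{u} → ZFSet.{u}) (α : Ordinal.{u}) : ZFSet.{u} :=
  σ α fun β => F β.1

/-- `σ` is a winning strategy for the challenger in the game of length `γ`: as long as the judge
follows the rules, so does the challenger, and the judge wins no run. -/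
def Strategy.IsWinning (σ : Strategy.{u}) (wf : Prop) (κ θ : Cardinal.{u}) (γ : Ordinal.{u}) :
    Prop :=
  ∀ F : Ordinal.{u} → ZFSet.{u},
    (∀ α < γ, (∀ β < α, JudgeLegal κ (σ.play F) F β) → ChallengerLegal κ θ (σ.play F) F α) ∧
    ((∀ α < γ, JudgeLegal κ (σ.play F) F α) → ¬ JudgeWins wf κ γ (σ.play F) F)

/-! ### `α`-Ramsey cardinals

The notions below are relativized to a class `U`: `U = Set.univ` yields the notion itself, and
`U = V_κ`, for `κ` an uncountable cardinal, yields the notion as it is evaluated in the structure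
`⟨V_κ, ∈⟩`.  The sets that are quantified over are taken from `U`.  The remaining ingredients
(cardinality and regularity of members of `U`, `H(θ)`, satisfaction in set structures, short
sequences of members of `M`, maps between `M` and `N`, positions and strategies in the games) only
involve subsets of sets in `U`, which belong to `V_κ` again when `U = V_κ`, so these are the same in
`V_κ` and in the universe. -/

/-- `α`-Ramseyness of `κ` for regular `α`, in `U`: there are arbitrarily large regular cardinals `θ`
such that every `A ⊆ κ` belongs to a weak `κ`-model `M ≺ H(θ)` that is closed under `<α`-sequences
and has a `κ`-powerset preserving elementary embedding into some transitive `N`. -/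
def IsRegRamseyIn (U : Set ZFSet.{u}) (α κ : Cardinal.{u}) : Prop :=
  α.IsRegular ∧ κ.IsRegular ∧ α ≤ κ ∧
  ∀ β : Ordinal.{u}, β.toZFSet ∈ U →
    ∃ θ : Cardinal.{u}, θ.IsRegular ∧ β < θ.ord ∧ cardSet θ ∈ U ∧
      ∀ A ∈ U, A ⊆ cardSet κ →
        ∃ M ∈ U, IsWeakModel κ M ∧ A ∈ M ∧ ElemSub (M : Set ZFSet.{u}) (HSet θ) ∧
          ClosedUnderLT α M ∧
          ∃ N ∈ U, N.IsTransitive ∧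
            ∃ j : (M : Set ZFSet.{u}) ↪ₑ[setLang] (N : Set ZFSet.{u}),
              PowersetPreserving κ (M : Set ZFSet.{u}) (N : Set ZFSet.{u}) j

/-- The `γ`-filter property of `κ = κ^{<κ}` (the well-founded `γ`-filter property, if `wf` holds),
in `U`: the challenger has no winning strategy in the game of length `γ`, for every regular
`θ > κ`. -/
def FilterPropertyIn (U : Set ZFSet.{u}) (wf : Prop) (γ : Ordinal.{u}) (κ : Cardinal.{u}) : Prop :=
  Cardinal.aleph0 < κ ∧ κ.IsRegular ∧ Cardinal.powerlt κ κ = κ ∧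
  ∀ θ : Cardinal.{u}, θ.IsRegular → κ < θ → cardSet θ ∈ U →
    ¬ ∃ σ : Strategy.{u}, σ.IsWinning wf κ θ γ

/-- `κ` is `α`-Ramsey in `U`, for infinite cardinals `α ≤ κ`.  For singular `α` this is defined by
the `α`-filter property.  If `wf` holds, then the well-founded `α`-filter property is used
instead for singular `α` of countable cofinality. -/
def IsRamseyIn (U : Set ZFSet.{u}) (wf : Prop) (α κ : Cardinal.{u}) : Prop :=
  Cardinal.aleph0 ≤ α ∧ α ≤ κ ∧
  (α.IsRegular → IsRegRamseyIn U α κ) ∧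
  (¬ α.IsRegular → FilterPropertyIn U (wf ∧ α.ord.cof = Cardinal.aleph0) α.ord κ)

/-- `κ` is `α`-Ramsey. -/
def IsRamsey (wf : Prop) (α κ : Cardinal.{u}) : Prop := IsRamseyIn Set.univ wf α κ

end RamseyHierarchy

/-! Ramseyness is traded for a combinatorial statement, `DecisionProperty γ κ`, that mentions
neither models nor strategies nor `H(θ)`. Families of subsets of `κ` are handed out at `γ` stages,
each family depending on the earlier decisions; the property provides decisions for or against all
these sets such that all diagonal intersections of the resulting sets are unbounded in `κ`.

Let `γ < α`, and let `j : M → N` be `κ`-powerset preserving, with `M` closed under `<α`-sequences.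
Decide for `A` if and only if `κ ∈ j(A)`. The decisions of one stage form a subset of `κ` in `N`,
hence in `M`, and closure of `M` collects the decisions of `γ` stages. If `R ∈ M` lists the sets
chosen along a diagonal, then `κ` lies in every section of `j(R)` with index below `κ`, so by
elementarity unboundedly many `β < κ` lie in all sections of `R` with index below `β`
(`RamseyEmbedding.exists_decision`). This works for challenges in `M` as well as for challenges in
`N`. Hence `H(θ)` satisfies the decision property at `κ`, and so does `N`; as `κ < j(κ)`, it
reflects to unboundedly many `μ < κ` (`exists_internalDecision_lt`). For large `θ`, `H(θ)` is
correct about it.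

Conversely, the decision property makes `κ` inaccessible, and it lets the judge beat every strategy
for every `θ`, with a well-founded ultrapower (`DecisionProperty.exists_run`). This is the filter
property, under either convention. For regular `α`, let the challenger play models that contain a
given `A`. The union of the models is closed under `<α`-sequences, and its ultrapower is
`κ`-powerset preserving, because each model knows the earlier filters
(`MeasuredModel.powersetPreserving`). The witnesses have rank at most `θ`, so they are found in
`V_κ` as well.

If `α₁` is singular, winning runs are truncated to the regular length `α₀⁺` (`judgeWins_of_lt`), so
in all cases some regular `α > α₀` is available. For strictness, take the least `α₀`-Ramsey cardinal
above `α₁`. -/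

namespace RamseyHierarchy

/-! ### First-order definability over transitive classes -/

/-- Transitive classes. -/
def TransClass (S : Set ZFSet.{u}) : Prop := ∀ x ∈ S, ∀ y ∈ x, y ∈ S

/-- `P` is uniformly first-order definable over all transitive classes. -/
def Dfn {n : ℕ} (P : Set ZFSet.{u} → (Fin n → ZFSet.{u}) → Prop) : Prop :=
  ∃ φ : setLang.Formula (Fin n), ∀ S, TransClass S → ∀ v : Fin n → S,
    φ.Realize v ↔ P S fun i => (v i).1

/-- Existential quantification over the first variable. -/
noncomputable def exFormula {n : ℕ} (φ : setLang.Formula (Fin (n + 1))) :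
    setLang.Formula (Fin n) :=
  (Language.BoundedFormula.relabel (n := 1)
    (Fin.cases (Sum.inr 0) Sum.inl : Fin (n + 1) → Fin n ⊕ Fin 1) φ).ex

theorem realize_exFormula {n : ℕ} (φ : setLang.Formula (Fin (n + 1))) {S : Set ZFSet.{u}}
    (v : Fin n → S) :
    (exFormula φ).Realize v ↔ ∃ x : S, φ.Realize (Fin.cons x v : Fin (n + 1) → S) := by
  rw [exFormula, Language.Formula.Realize, Language.BoundedFormula.realize_ex]
  refine exists_congr fun x => ?_
  rw [Language.BoundedFormula.realize_relabel, Language.Formula.Realize]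
  refine iff_of_eq ?_
  congr 1
  · funext i
    refine Fin.cases ?_ (fun i => ?_) i
    · simp [Fin.snoc]
    · simp
  · exact Subsingleton.elim _ _

namespace Dfn

variable {n : ℕ} {P Q : Set ZFSet.{u} → (Fin n → ZFSet.{u}) → Prop}

/-- The equivalence is needed only for parameters inside the transitive class, so a definition may
be replaced by an absolute bounded one. -/
theorem of_iff (hP : Dfn P)
    (h : ∀ S, TransClass S → ∀ v : Fin n → ZFSet.{u}, (∀ i, v i ∈ S) → (Q S v ↔ P S v)) : Dfn Q := by
  obtain ⟨φ, hφ⟩ := hP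
  exact ⟨φ, fun S hS v => (hφ S hS v).trans (h S hS _ fun i => (v i).2).symm⟩

theorem mem (i j : Fin n) : Dfn fun (_ : Set ZFSet.{u}) v => v i ∈ v j := by
  refine ⟨Language.Relations.formula₂ (L := setLang) (show setLang.Relations 2 from SetRel.mem)
    (Language.Term.var i) (Language.Term.var j), fun S _ v => ?_⟩
  exact Language.Formula.realize_rel₂

theorem eq (i j : Fin n) : Dfn fun (_ : Set ZFSet.{u}) v => v i = v j :=
  ⟨(Language.Term.var i).equal (Language.Term.var j), fun S _ v => by
    simp [Language.Formula.realize_equal, Subtype.ext_iff]⟩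

theorem not (hP : Dfn P) : Dfn fun S v => ¬ P S v := by
  obtain ⟨φ, hφ⟩ := hP
  exact ⟨φ.not, fun S hS v => by rw [Language.Formula.realize_not, hφ S hS]⟩

theorem and (hP : Dfn P) (hQ : Dfn Q) : Dfn fun S v => P S v ∧ Q S v := by
  obtain ⟨φ, hφ⟩ := hP
  obtain ⟨ψ, hψ⟩ := hQ
  refine ⟨φ ⊓ ψ, fun S hS v => ?_⟩
  rw [Language.Formula.realize_inf, hφ S hS, hψ S hS]

theorem or (hP : Dfn P) (hQ : Dfn Q) : Dfn fun S v => P S v ∨ Q S v :=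
  (hP.not.and hQ.not).not.of_iff fun _ _ _ _ => by tauto

theorem imp (hP : Dfn P) (hQ : Dfn Q) : Dfn fun S v => P S v → Q S v :=
  (hP.and hQ.not).not.of_iff fun _ _ _ _ => by tauto

theorem iff (hP : Dfn P) (hQ : Dfn Q) : Dfn fun S v => P S v ↔ Q S v :=
  ((hP.imp hQ).and (hQ.imp hP)).of_iff fun _ _ _ _ => by tauto

theorem comp {m : ℕ} (hP : Dfn P) (f : Fin n → Fin m) : Dfn fun S v => P S fun i => v (f i) := by
  obtain ⟨φ, hφ⟩ := hP
  refine ⟨φ.relabel f, fun S hS v => ?_⟩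
  rw [Language.Formula.realize_relabel, hφ S hS]
  rfl

/-- Convention for all definability proofs: the quantified variable has index 0, and the parameters
are the tail. -/
theorem ex {R : Set ZFSet.{u} → (Fin n → ZFSet.{u}) → ZFSet.{u} → Prop}
    (h : Dfn fun (S : Set ZFSet.{u}) (w : Fin (n + 1) → ZFSet.{u}) => R S (Fin.tail w) (w 0)) :
    Dfn fun S v => ∃ x ∈ S, R S v x := by
  obtain ⟨φ, hφ⟩ := h
  refine ⟨exFormula φ, fun S hS v => ?_⟩
  rw [realize_exFormula]
  constructor
  · rintro ⟨x, hx⟩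
    exact ⟨x.1, x.2, (hφ S hS (Fin.cons x v)).1 hx⟩
  · rintro ⟨x, hxS, hx⟩
    exact ⟨⟨x, hxS⟩, (hφ S hS (Fin.cons ⟨x, hxS⟩ v)).2 hx⟩

theorem all {R : Set ZFSet.{u} → (Fin n → ZFSet.{u}) → ZFSet.{u} → Prop}
    (h : Dfn fun (S : Set ZFSet.{u}) (w : Fin (n + 1) → ZFSet.{u}) => R S (Fin.tail w) (w 0)) :
    Dfn fun S v => ∀ x ∈ S, R S v x :=
  (ex (R := fun S v x => ¬ R S v x) h.not).not.of_iff fun _ _ _ _ => by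
    push Not; rfl

theorem bex (i : Fin n) {R : Set ZFSet.{u} → (Fin n → ZFSet.{u}) → ZFSet.{u} → Prop}
    (h : Dfn fun (S : Set ZFSet.{u}) (w : Fin (n + 1) → ZFSet.{u}) => R S (Fin.tail w) (w 0)) :
    Dfn fun S v => ∃ x ∈ v i, R S v x :=
  (ex (R := fun S v x => x ∈ v i ∧ R S v x) ((mem 0 i.succ).and h)).of_iff fun _ hS _ hv =>
    ⟨fun ⟨x, hx, h⟩ => ⟨x, hS _ (hv i) _ hx, hx, h⟩, fun ⟨x, _, hx, h⟩ => ⟨x, hx, h⟩⟩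

theorem ball (i : Fin n) {R : Set ZFSet.{u} → (Fin n → ZFSet.{u}) → ZFSet.{u} → Prop}
    (h : Dfn fun (S : Set ZFSet.{u}) (w : Fin (n + 1) → ZFSet.{u}) => R S (Fin.tail w) (w 0)) :
    Dfn fun S v => ∀ x ∈ v i, R S v x :=
  (bex i (R := fun S v x => ¬ R S v x) h.not).not.of_iff fun _ _ _ _ => by
    push Not; rfl

/-- The way back from arbitrary formulas to definable relations, needed for the axiom schemes and
for Łoś's theorem. -/
theorem realize (φ : setLang.Formula (Fin n)) :
    Dfn fun (S : Set ZFSet.{u}) v => ∃ h : ∀ i, v i ∈ S, φ.Realize fun i => (⟨v i, h i⟩ : S) :=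
  ⟨φ, fun _ _ v => ⟨fun h => ⟨fun i => (v i).2, h⟩, fun h => h.2⟩⟩

theorem subset (i j : Fin n) : Dfn fun (_ : Set ZFSet.{u}) v => v i ⊆ v j :=
  (ball i (R := fun _ v x => x ∈ v j) (mem 0 j.succ)).of_iff fun _ _ _ _ => Iff.rfl

theorem eq_singleton (i j : Fin n) : Dfn fun (_ : Set ZFSet.{u}) v => v i = {v j} :=
  ((mem j i).and (ball i (R := fun _ v x => x = v j) (eq 0 j.succ))).of_iff fun _ _ v _ => by
    constructor
    · intro h; simp [h]
    · rintro ⟨h, h'⟩; ext z; simp only [ZFSet.mem_singleton]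
      exact ⟨h' z, fun hz => hz ▸ h⟩

theorem eq_upair (i j k : Fin n) : Dfn fun (_ : Set ZFSet.{u}) v => v i = {v j, v k} :=
  ((mem j i).and ((mem k i).and (ball i (R := fun _ v x => x = v j ∨ x = v k)
    ((eq 0 j.succ).or (eq 0 k.succ))))).of_iff fun _ _ v _ => by
    constructor
    · intro h; simp [h]
    · rintro ⟨h, h', h''⟩; ext z; simp only [ZFSet.mem_pair]
      exact ⟨h'' z, fun hz => hz.elim (· ▸ h) (· ▸ h')⟩

theorem eq_pair (i j k : Fin n) : Dfn fun (_ : Set ZFSet.{u}) v => v i = ZFSet.pair (v j) (v k) :=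
  (bex i (R := fun _ v s => s = {v j} ∧ ∃ t ∈ v i, t = {v j, v k} ∧ v i = {s, t})
    ((eq_singleton _ _).and (bex _ (R := fun _ w t =>
      t = {Fin.tail w j, Fin.tail w k} ∧ Fin.tail w i = {w 0, t})
      ((eq_upair 0 j.succ.succ k.succ.succ).and (eq_upair i.succ.succ 1 0))))).of_iff
    fun _ _ v _ => by
      constructor
      · intro h
        refine ⟨{v j}, ?_, rfl, {v j, v k}, ?_, rfl, h⟩ <;> simp [h, ZFSet.pair]
      · rintro ⟨_, _, rfl, _, _, rfl, h⟩
        exact h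

theorem pair_mem (i j k : Fin n) : Dfn fun (_ : Set ZFSet.{u}) v => ZFSet.pair (v i) (v j) ∈ v k :=
  (bex k (R := fun _ v p => p = ZFSet.pair (v i) (v j)) (eq_pair 0 i.succ j.succ)).of_iff
    fun _ _ v _ => by simp

end Dfn

theorem TransClass.of_pair {S : Set ZFSet.{u}} (hS : TransClass S) {x y : ZFSet.{u}}
    (h : ZFSet.pair x y ∈ S) : x ∈ S ∧ y ∈ S := by
  have h2 : ({x, y} : ZFSet.{u}) ∈ S := hS _ h _ (by simp [ZFSet.pair])
  exact ⟨hS _ h2 _ (by simp), hS _ h2 _ (by simp)⟩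

theorem TransClass.of_pair_mem {S : Set ZFSet.{u}} (hS : TransClass S) {x y f : ZFSet.{u}} (hf : f ∈ S)
    (h : ZFSet.pair x y ∈ f) : x ∈ S ∧ y ∈ S :=
  hS.of_pair (hS _ hf _ h)

namespace Dfn
variable {n : ℕ}

/-- Definability of a bounded quantifier over the second coordinates of a set of pairs. -/
theorem ex_pair_mem (i j : Fin n) {R : Set ZFSet.{u} → (Fin n → ZFSet.{u}) → ZFSet.{u} → Prop}
    (h : Dfn fun (S : Set ZFSet.{u}) (w : Fin (n + 1) → ZFSet.{u}) => R S (Fin.tail w) (w 0)) :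
    Dfn fun S v => ∃ y, ZFSet.pair (v i) y ∈ v j ∧ R S v y :=
  (ex (R := fun S v y => ZFSet.pair (v i) y ∈ v j ∧ R S v y)
    ((pair_mem i.succ 0 j.succ).and h)).of_iff fun _ hS _ hv =>
    ⟨fun ⟨y, hy, h⟩ => ⟨y, (hS.of_pair_mem (hv j) hy).2, hy, h⟩, fun ⟨y, _, hy⟩ => ⟨y, hy⟩⟩

theorem all_pair_mem (i j : Fin n) {R : Set ZFSet.{u} → (Fin n → ZFSet.{u}) → ZFSet.{u} → Prop}
    (h : Dfn fun (S : Set ZFSet.{u}) (w : Fin (n + 1) → ZFSet.{u}) => R S (Fin.tail w) (w 0)) :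
    Dfn fun S v => ∀ y, ZFSet.pair (v i) y ∈ v j → R S v y :=
  (ex_pair_mem i j (R := fun S v x => ¬ R S v x) h.not).not.of_iff fun _ _ _ _ => by
    push Not; rfl

/-- The codomain can always be taken to be `⋃⋃f`, which removes the quantifier over codomains. -/
theorem isFunOn (i j : Fin n) : Dfn fun (_ : Set ZFSet.{u}) v => IsFunOn (v i) (v j) := by
  refine ((ball j (R := fun S v p => ∃ x ∈ v i, ∃ y ∈ S, p = ZFSet.pair x y)
    (bex i.succ (R := fun S w x => ∃ y ∈ S, w 0 = ZFSet.pair x y)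
      (ex (R := fun S w y => w 1 = ZFSet.pair (w 0) y) (eq_pair 2 1 0)))).and
    (ball i (R := fun S v x => ∃ y, ZFSet.pair x y ∈ v j ∧ ∀ y', ZFSet.pair x y' ∈ v j → y' = y)
      (ex_pair_mem 0 j.succ (R := fun S w y => ∀ y', ZFSet.pair (w 0) y' ∈ w j.succ → y' = y)
        (all_pair_mem 1 j.succ.succ (R := fun _ w y' => y' = w 0) (eq 0 1))))).of_iff ?_
  intro S hS v hv
  constructor
  · rintro ⟨Y, h1, h2⟩
    refine ⟨fun p hp => ?_, fun x hx => ?_⟩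
    · obtain ⟨a, ha, b, hb, rfl⟩ := ZFSet.mem_prod.1 (h1 hp)
      exact ⟨a, ha, b, (hS.of_pair_mem (hv j) hp).2, rfl⟩
    · obtain ⟨y, hy, hy'⟩ := h2 x hx
      exact ⟨y, hy, hy'⟩
  · rintro ⟨h1, h2⟩
    refine ⟨ZFSet.sUnion (ZFSet.sUnion (v j)), fun p hp => ?_, fun x hx => ?_⟩
    · obtain ⟨x, hx, y, hy, rfl⟩ := h1 p hp
      rw [ZFSet.pair_mem_prod]
      refine ⟨hx, ?_⟩
      simp only [ZFSet.mem_sUnion]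
      exact ⟨{x, y}, ⟨_, hp, by simp [ZFSet.pair]⟩, by simp⟩
    · obtain ⟨y, hy, hy'⟩ := h2 x hx
      exact ⟨y, hy, hy'⟩

/-- Quantifying the parameters away one by one leaves a sentence, which elementary equivalence
transfers. In this way `N` inherits statements from `H(θ)` also for parameters outside the range of
`j`. -/
theorem forall_imp_forall {n : ℕ} {P : Set ZFSet.{u} → (Fin n → ZFSet.{u}) → Prop} (hP : Dfn P)
    {H N : Set ZFSet.{u}} (hH : TransClass H) (hN : TransClass N) (hHN : setLang.ElementarilyEquivalent H N)
    (h : ∀ v, (∀ i, v i ∈ H) → P H v) : ∀ v, (∀ i, v i ∈ N) → P N v := by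
  induction n with
  | zero =>
    intro v _
    obtain ⟨φ, hφ⟩ := hP
    have h1 := (hφ H hH Fin.elim0).2 (h _ (fun i => i.elim0))
    let ψ : setLang.Sentence := φ.relabel Fin.elim0
    have h2 : H ⊨ ψ := by
      rw [Language.Sentence.Realize, Language.Formula.realize_relabel]
      convert h1
    rw [hHN.realize_sentence] at h2
    rw [Language.Sentence.Realize, Language.Formula.realize_relabel] at h2
    have h3 := (hφ N hN _).1 h2
    convert h3
  | succ n ih =>
    have := ih (P := fun S v => ∀ x ∈ S, P S (Fin.cons x v))
      (all (R := fun S v x => P S (Fin.cons x v)) (by simpa using hP))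
      (fun v hv x hx => h _ (fun i => by refine Fin.cases ?_ (fun i => ?_) i <;> simp [hx, hv]))
    intro v hv
    have := this (Fin.tail v) (fun i => hv _) (v 0) (hv 0)
    simpa using this

end Dfn

/-! ### Elementary substructures and transfer of definable properties -/

theorem ElemSub.subset {M H : Set ZFSet.{u}} (h : ElemSub M H) : M ⊆ H := by
  obtain ⟨e, he⟩ := h
  intro x hx
  have h2 : (e ⟨x, hx⟩).1 = x := he ⟨x, hx⟩
  exact h2 ▸ (e ⟨x, hx⟩).2

theorem ElemSub.realize_iff {M H : Set ZFSet.{u}} (h : ElemSub M H) {α : Type*}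
    (φ : setLang.Formula α) (v : α → M) :
    φ.Realize (fun i => (⟨(v i).1, h.subset (v i).2⟩ : H)) ↔ φ.Realize v := by
  obtain ⟨e, he⟩ := id h
  rw [← e.map_formula φ v]
  have : (fun i => (⟨(v i).1, h.subset (v i).2⟩ : H)) = e ∘ v := by
    funext i
    exact Subtype.ext (he (v i)).symm
  rw [this]

theorem ElemSub.elementarilyEquivalent {M H : Set ZFSet.{u}} (h : ElemSub M H) :
    setLang.ElementarilyEquivalent M H := by
  obtain ⟨e, he⟩ := id h
  exact e.elementarilyEquivalent

/-- Transfer along an elementary embedding of an elementary substructure. -/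
theorem ElemSub.transfer {M H N : Set ZFSet.{u}} (h : ElemSub M H) (hH : TransClass H) (hN : TransClass N)
    (j : M ↪ₑ[setLang] N) {n : ℕ} {P : Set ZFSet.{u} → (Fin n → ZFSet.{u}) → Prop} (hP : Dfn P)
    (v : Fin n → M) : P H (fun i => (v i).1) ↔ P N (fun i => (j (v i)).1) := by
  obtain ⟨φ, hφ⟩ := hP
  have h1 := h.realize_iff φ v
  rw [hφ H hH] at h1
  rw [h1, ← j.map_formula, hφ N hN]
  rfl

/-- The Tarski–Vaught property for definable relations. They are evaluated in `H` throughout, since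
`M` need not be transitive. -/
theorem ElemSub.exists_mem {M H : Set ZFSet.{u}} (h : ElemSub M H) (hH : TransClass H) {n : ℕ}
    {R : Set ZFSet.{u} → (Fin n → ZFSet.{u}) → ZFSet.{u} → Prop}
    (hR : Dfn fun (S : Set ZFSet.{u}) (w : Fin (n + 1) → ZFSet.{u}) => R S (Fin.tail w) (w 0))
    (v : Fin n → ZFSet.{u}) (hv : ∀ i, v i ∈ M) (hx : ∃ x ∈ H, R H v x) : ∃ x ∈ M, R H v x := by
  obtain ⟨φ, hφ⟩ := hR
  obtain ⟨x, hx, hxR⟩ := hx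
  have h3 := (realize_exFormula φ fun i => ⟨v i, h.subset (hv i)⟩).2
    ⟨⟨x, hx⟩, (hφ H hH _).2 hxR⟩
  have h4 := (h.realize_iff (exFormula φ) fun i => ⟨v i, hv i⟩).1 h3
  obtain ⟨y, hy⟩ := (realize_exFormula φ _).1 h4
  exact ⟨y.1, y.2, (hφ H hH _).1 ((h.realize_iff φ _).2 hy)⟩

/-! ### Cardinalities of sets -/

theorem card_le_iff {x : ZFSet.{u}} {c : Cardinal.{u}} :
    x.card ≤ c ↔ Cardinal.mk x ≤ Cardinal.lift.{u + 1} c := by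
  rw [ZFSet.cardinalMk_coe_sort, Cardinal.lift_le]

theorem card_range_Iio_le (δ : Ordinal.{u}) (f : Set.Iio δ → ZFSet.{u}) :
    (ZFSet.range f).card ≤ δ.card := by
  have := ZFSet.lift_card_range_le (f := f)
  rw [Cardinal.mk_Iio_ordinal, Cardinal.lift_lift] at this
  exact Cardinal.lift_le.1 this

theorem card_prod_le {x y : ZFSet.{u}} : (ZFSet.prod x y).card ≤ x.card * y.card := by
  rw [card_le_iff, Cardinal.lift_mul, ← ZFSet.cardinalMk_coe_sort, ← ZFSet.cardinalMk_coe_sort,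
    Cardinal.mul_def]
  refine Cardinal.mk_le_of_surjective (f := fun p : x × y => (⟨ZFSet.pair p.1 p.2,
    ZFSet.pair_mem_prod.2 ⟨p.1.2, p.2.2⟩⟩ : ZFSet.prod x y)) ?_
  rintro ⟨z, hz⟩
  obtain ⟨a, ha, b, hb, rfl⟩ := ZFSet.mem_prod.1 hz
  exact ⟨⟨⟨a, ha⟩, ⟨b, hb⟩⟩, rfl⟩

/-! ### The collection `H(θ)` -/

section HSet

variable {θ : Cardinal.{u}}

theorem hset_subset {x y : ZFSet.{u}} (hx : x ∈ HSet θ) (h : y ⊆ x) : y ∈ HSet θ := by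
  obtain ⟨t, ht, hxt, hc⟩ := hx
  exact ⟨t, ht, fun z hz => hxt (h hz), hc⟩

theorem hset_trans {x y : ZFSet.{u}} (hx : x ∈ HSet θ) (h : y ∈ x) : y ∈ HSet θ := by
  obtain ⟨t, ht, hxt, hc⟩ := hx
  exact ⟨t, ht, ht y (hxt h), hc⟩

theorem mem_hset_of_isTransitive {t : ZFSet.{u}} (ht : t.IsTransitive) (h : t.card < θ) :
    t ∈ HSet θ :=
  ⟨t, ht, fun _ h => h, h⟩

theorem toZFSet_mem_hset {o : Ordinal.{u}} (h : o < θ.ord) : o.toZFSet ∈ HSet θ :=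
  mem_hset_of_isTransitive (ZFSet.isOrdinal_toZFSet o).isTransitive (by
    rw [Ordinal.card_toZFSet]; exact Cardinal.lt_ord.1 h)

theorem card_lt_of_mem_hset {x : ZFSet.{u}} (hx : x ∈ HSet θ) : x.card < θ := by
  obtain ⟨t, ht, hxt, hc⟩ := hx
  exact (ZFSet.card_mono hxt).trans_lt hc

/-- Transitive covers of the elements are united; regularity keeps the union smaller than `θ`. -/
theorem mem_hset_of_card_lt (hθ : θ.IsRegular) {x : ZFSet.{u}} (hx : ∀ y ∈ x, y ∈ HSet θ)
    (hc : x.card < θ) : x ∈ HSet θ := by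
  have : ∀ y : Shrink.{u} x, ∃ t : ZFSet.{u}, t.IsTransitive ∧ ((equivShrink x).symm y).1 ⊆ t ∧
      t.card < θ := fun y => hx _ ((equivShrink x).symm y).2
  choose t h1 h2 h3 using this
  refine ⟨x ∪ ZFSet.iUnion t, ?_, fun z hz => by simp [hz], ?_⟩
  · intro y hy z hz
    simp only [ZFSet.mem_union, ZFSet.mem_iUnion] at hy ⊢
    right
    rcases hy with hy | ⟨i, hi⟩
    · refine ⟨equivShrink x ⟨y, hy⟩, h2 _ ?_⟩
      simpa using hz
    · exact ⟨i, h1 i y hi hz⟩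
  · refine ZFSet.card_union_le.trans_lt (Cardinal.add_lt_of_lt hθ.aleph0_le hc ?_)
    have := ZFSet.lift_card_iUnion_le_sum_card (f := t)
    rw [Cardinal.lift_id] at this
    refine this.trans_lt (Cardinal.sum_lt_of_isRegular hθ ?_ h3)
    exact hc

theorem transClass_hset : TransClass (HSet θ) := fun _ hx _ hy => hset_trans hx hy

theorem upair_mem_hset (hθ : θ.IsRegular) {x y : ZFSet.{u}} (hx : x ∈ HSet θ)
    (hy : y ∈ HSet θ) : ({x, y} : ZFSet.{u}) ∈ HSet θ := by
  refine mem_hset_of_card_lt hθ (fun z hz => ?_) ?_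
  · rcases ZFSet.mem_pair.1 hz with rfl | rfl <;> assumption
  · refine lt_of_le_of_lt (ZFSet.card_insert_le.trans ?_)
      ((Cardinal.natCast_lt_aleph0 (n := 2)).trans_le hθ.aleph0_le)
    rw [ZFSet.card_singleton]
    norm_num

theorem pair_mem_hset (hθ : θ.IsRegular) {x y : ZFSet.{u}} (hx : x ∈ HSet θ)
    (hy : y ∈ HSet θ) : ZFSet.pair x y ∈ HSet θ := by
  have := upair_mem_hset hθ hx hx
  rw [ZFSet.pair_eq_singleton] at this
  exact upair_mem_hset hθ this (upair_mem_hset hθ hx hy)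

theorem range_mem_hset (hθ : θ.IsRegular) {δ : Ordinal.{u}} (hδ : δ < θ.ord)
    {f : Set.Iio δ → ZFSet.{u}} (hf : ∀ i, f i ∈ HSet θ) : ZFSet.range f ∈ HSet θ := by
  refine mem_hset_of_card_lt hθ (fun y hy => ?_)
    ((card_range_Iio_le δ f).trans_lt (Cardinal.lt_ord.1 hδ))
  obtain ⟨i, rfl⟩ := ZFSet.mem_range.1 hy
  exact hf i

theorem seqSet_mem_hset (hθ : θ.IsRegular) {δ : Ordinal.{u}} (hδ : δ < θ.ord)
    {f : Ordinal.{u} → ZFSet.{u}} (hf : ∀ i < δ, f i ∈ HSet θ) : seqSet δ f ∈ HSet θ :=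
  range_mem_hset hθ hδ fun i => pair_mem_hset hθ
    (toZFSet_mem_hset (lt_trans i.2 hδ)) (hf _ i.2)

theorem prod_mem_hset (hθ : θ.IsRegular) {x y : ZFSet.{u}} (hx : x ∈ HSet θ)
    (hy : y ∈ HSet θ) : ZFSet.prod x y ∈ HSet θ := by
  refine mem_hset_of_card_lt hθ (fun z hz => ?_) (card_prod_le.trans_lt
    (Cardinal.mul_lt_of_lt hθ.aleph0_le (card_lt_of_mem_hset hx) (card_lt_of_mem_hset hy)))
  obtain ⟨a, ha, b, hb, rfl⟩ := ZFSet.mem_prod.1 hz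
  exact pair_mem_hset hθ (hset_trans hx ha) (hset_trans hy hb)

end HSet

/-! ### Sequences as sets of pairs -/

theorem pair_mem_seqSet {δ : Ordinal.{u}} {f : Ordinal.{u} → ZFSet.{u}} {x y : ZFSet.{u}} :
    ZFSet.pair x y ∈ seqSet δ f ↔ ∃ i < δ, x = i.toZFSet ∧ y = f i := by
  simp only [seqSet, ZFSet.mem_range, ZFSet.pair_inj, Subtype.exists, Set.mem_Iio, exists_prop]
  exact exists_congr fun i => and_congr_right fun _ => by
    constructor <;> rintro ⟨h1, h2⟩ <;> exact ⟨h1.symm, h2.symm⟩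

theorem mem_seqSet {δ : Ordinal.{u}} {f : Ordinal.{u} → ZFSet.{u}} {p : ZFSet.{u}} :
    p ∈ seqSet δ f ↔ ∃ i < δ, p = ZFSet.pair i.toZFSet (f i) := by
  simp only [seqSet, ZFSet.mem_range, Subtype.exists, Set.mem_Iio, exists_prop]
  exact exists_congr fun i => and_congr_right fun _ => eq_comm

theorem toZFSet_mem_cardSet {κ : Cardinal.{u}} {i : Ordinal.{u}} :
    i.toZFSet ∈ cardSet κ ↔ i < κ.ord := by
  simp [cardSet]

theorem mem_cardSet {κ : Cardinal.{u}} {x : ZFSet.{u}} :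
    x ∈ cardSet κ ↔ ∃ i < κ.ord, i.toZFSet = x :=
  Ordinal.mem_toZFSet_iff

theorem seqSet_isFunOn {κ : Cardinal.{u}} (f : Ordinal.{u} → ZFSet.{u}) :
    IsFunOn (cardSet κ) (seqSet κ.ord f) := by
  refine ⟨ZFSet.range fun i : Set.Iio κ.ord => f i.1, fun p hp => ?_, fun x hx => ?_⟩
  · obtain ⟨i, hi, rfl⟩ := mem_seqSet.1 hp
    exact ZFSet.pair_mem_prod.2 ⟨toZFSet_mem_cardSet.2 hi, ZFSet.mem_range.2 ⟨⟨i, hi⟩, rfl⟩⟩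
  · obtain ⟨i, hi, rfl⟩ := mem_cardSet.1 hx
    refine ⟨f i, pair_mem_seqSet.2 ⟨i, hi, rfl, rfl⟩, fun y hy => ?_⟩
    obtain ⟨i', _, h1, rfl⟩ := pair_mem_seqSet.1 hy
    rw [Ordinal.toZFSet_injective h1]

/-! ### Elementary substructures of `H(θ)` -/

section Elem

variable {θ : Cardinal.{u}} {M : Set ZFSet.{u}}

/-- `H(θ)` is closed under subsets, so it contains this set; being determined by its definition from
parameters in `M`, the set belongs to `M` by elementarity. -/
theorem ElemSub.sep_mem (h : ElemSub M (HSet θ)) {n : ℕ}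
    {R : Set ZFSet.{u} → (Fin n → ZFSet.{u}) → ZFSet.{u} → Prop}
    (hR : Dfn fun (S : Set ZFSet.{u}) (w : Fin (n + 1) → ZFSet.{u}) => R S (Fin.tail w) (w 0))
    (v : Fin n → ZFSet.{u}) (hv : ∀ i, v i ∈ M) {a : ZFSet.{u}} (ha : a ∈ M) :
    ZFSet.sep (R (HSet θ) v) a ∈ M := by
  obtain ⟨x, hx, h1, h2⟩ := h.exists_mem transClass_hset (n := n + 1)
    (R := fun S w x => x ⊆ w 0 ∧ ∀ z ∈ w 0, (z ∈ x ↔ R S (Fin.tail w) z))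
    (.and (.subset _ _) (.ball _
      -- Variables 1 and 2 are the new set and `a`; the parameters of `R` start at 3.
      (.iff (.mem _ _) (hR.comp (Fin.cases 0 fun i => i.succ.succ.succ)))))
    (Fin.cons a v : Fin (n + 1) → ZFSet.{u})
    (fun i => by refine Fin.cases ?_ (fun i => ?_) i <;> simp [ha, hv])
    ⟨ZFSet.sep (R (HSet θ) v) a, hset_subset (h.subset ha) ZFSet.sep_subset,
      ZFSet.sep_subset, fun z hz => by
        simp only [Fin.cons_zero] at hz
        simp [hz]⟩
  have : ZFSet.sep (R (HSet θ) v) a = x := by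
    ext z
    simp only [Fin.cons_zero, Fin.tail_cons] at h1 h2
    rw [ZFSet.mem_sep]
    exact ⟨fun ⟨hz, hR⟩ => (h2 z hz).2 hR, fun hz => ⟨h1 hz, (h2 z (h1 hz)).1 hz⟩⟩
  rwa [this]

/-- The closure of `M` under set operations that are definable in `H(θ)`. -/
theorem ElemSub.mem_of_unique (h : ElemSub M (HSet θ)) {n : ℕ}
    {R : Set ZFSet.{u} → (Fin n → ZFSet.{u}) → ZFSet.{u} → Prop}
    (hR : Dfn fun (S : Set ZFSet.{u}) (w : Fin (n + 1) → ZFSet.{u}) => R S (Fin.tail w) (w 0))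
    (v : Fin n → ZFSet.{u}) (hv : ∀ i, v i ∈ M) {a : ZFSet.{u}} (ha : a ∈ HSet θ)
    (hRa : R (HSet θ) v a) (huniq : ∀ b ∈ HSet θ, R (HSet θ) v b → b = a) : a ∈ M := by
  obtain ⟨b, hb, hbR⟩ := h.exists_mem transClass_hset hR v hv ⟨a, ha, hRa⟩
  exact huniq b (h.subset hb) hbR ▸ hb

theorem ElemSub.upair_mem (h : ElemSub M (HSet θ)) (hθ : θ.IsRegular) {x y : ZFSet.{u}}
    (hx : x ∈ M) (hy : y ∈ M) : ({x, y} : ZFSet.{u}) ∈ M :=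
  h.mem_of_unique (R := fun _ v z => z = {v 0, v 1}) (.eq_upair _ _ _) ![x, y]
    (by simp [Fin.forall_fin_succ, hx, hy])
    (upair_mem_hset hθ (h.subset hx) (h.subset hy)) rfl fun _ _ h => h

theorem ElemSub.pair_mem (h : ElemSub M (HSet θ)) (hθ : θ.IsRegular) {x y : ZFSet.{u}}
    (hx : x ∈ M) (hy : y ∈ M) : ZFSet.pair x y ∈ M :=
  h.mem_of_unique (R := fun _ v z => z = ZFSet.pair (v 0) (v 1)) (.eq_pair _ _ _) ![x, y]
    (by simp [Fin.forall_fin_succ, hx, hy])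
    (pair_mem_hset hθ (h.subset hx) (h.subset hy)) rfl fun _ _ h => h

theorem ElemSub.apply_mem (h : ElemSub M (HSet θ)) {f x y : ZFSet.{u}}
    (hf : f ∈ M) (hx : x ∈ M) (hp : ZFSet.pair x y ∈ f) (hu : ∀ z, ZFSet.pair x z ∈ f → z = y) :
    y ∈ M :=
  h.mem_of_unique (R := fun _ v z => ZFSet.pair (v 1) z ∈ v 0) (.pair_mem _ _ _) ![f, x]
    (by simp [Fin.forall_fin_succ, hf, hx]) (transClass_hset.of_pair_mem (h.subset hf) hp).2 hp
    fun b _ hb => hu b hb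

theorem ElemSub.seqSet_apply_mem (h : ElemSub M (HSet θ)) {δ i : Ordinal.{u}}
    {f : Ordinal.{u} → ZFSet.{u}} (hf : seqSet δ f ∈ M) (hi : i < δ) (hiM : i.toZFSet ∈ M) :
    f i ∈ M :=
  h.apply_mem hf hiM (pair_mem_seqSet.2 ⟨i, hi, rfl, rfl⟩) fun z hz => by
    obtain ⟨i', _, h1, rfl⟩ := pair_mem_seqSet.1 hz
    rw [Ordinal.toZFSet_injective h1]

theorem ElemSub.prod_mem (h : ElemSub M (HSet θ)) (hθ : θ.IsRegular) {x y : ZFSet.{u}}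
    (hx : x ∈ M) (hy : y ∈ M) : ZFSet.prod x y ∈ M := by
  refine h.mem_of_unique (R := fun _ v z => (∀ p ∈ z, ∃ a ∈ v 0, ∃ b ∈ v 1, p = ZFSet.pair a b)
      ∧ ∀ a ∈ v 0, ∀ b ∈ v 1, ZFSet.pair a b ∈ z)
    (.and (.ball _ (.bex _ (.bex _ (.eq_pair _ _ _)))) (.ball _ (.ball _ (.pair_mem _ _ _)))) ![x, y]
    (by simp [Fin.forall_fin_succ, hx, hy]) (prod_mem_hset hθ (h.subset hx) (h.subset hy))
    ⟨fun p hp => ZFSet.mem_prod.1 hp, fun a ha b hb => ZFSet.pair_mem_prod.2 ⟨ha, hb⟩⟩ ?_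
  rintro z _ ⟨h1, h2⟩
  ext p
  rw [ZFSet.mem_prod]
  refine ⟨h1 p, ?_⟩
  rintro ⟨a, ha, b, hb, rfl⟩
  exact h2 a ha b hb

theorem ElemSub.subset_of_forall (h : ElemSub M (HSet θ)) {x y : ZFSet.{u}}
    (hx : x ∈ M) (hy : y ∈ M) (hsub : ∀ z ∈ M, z ∈ x → z ∈ y) : x ⊆ y := by
  intro z hz
  by_contra hzy
  obtain ⟨w, hw, hw1, hw2⟩ := h.exists_mem transClass_hset (R := fun _ v z => z ∈ v 0 ∧ z ∉ v 1)
    (.and (.mem _ _) (.not (.mem _ _))) ![x, y] (by simp [Fin.forall_fin_succ, hx, hy])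
    ⟨z, hset_trans (h.subset hx) hz, hz, hzy⟩
  exact hw2 (hsub w hw hw1)

end Elem

/-! ### Recursion on the ordinals and enumerations -/

theorem exists_recursive {α : Type*} [Inhabited α] (G : Ordinal.{u} → (Ordinal.{u} → α) → α) :
    ∃ f : Ordinal.{u} → α, ∀ ξ, f ξ = G ξ fun η => open Classical in if η < ξ then f η else default := by
  classical
  refine ⟨WellFounded.fix (C := fun _ => α) Ordinal.lt_wf
    fun ξ F => G ξ fun η => if h : η < ξ then F η h else default, fun ξ => ?_⟩
  rw [WellFounded.fix_eq]
  rfl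

/-- Indices that are missed by the injection of `s` into `κ` receive a fixed member of `s`, so the
enumeration is total and stays in `s`. -/
theorem exists_enum {α : Type (u + 1)} {s : Set α} {κ : Cardinal.{u}} (hs : s.Nonempty)
    (hc : Cardinal.mk s ≤ Cardinal.lift.{u + 1} κ) :
    ∃ g : Ordinal.{u} → α, (∀ i, g i ∈ s) ∧ ∀ x ∈ s, ∃ i < κ.ord, g i = x := by
  classical
  have h1 : Cardinal.mk s ≤ Cardinal.mk (Set.Iio κ.ord) := by
    rwa [Cardinal.mk_Iio_ordinal, Cardinal.card_ord]
  obtain ⟨f⟩ := h1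
  obtain ⟨x₀, hx₀⟩ := hs
  refine ⟨fun i => if h : ∃ x : s, (f x).1 = i then h.choose.1 else x₀, fun i => ?_, fun x hx => ?_⟩
  · dsimp only
    split_ifs with h
    · exact h.choose.2
    · exact hx₀
  · refine ⟨(f ⟨x, hx⟩).1, (f ⟨x, hx⟩).2, ?_⟩
    have h : ∃ y : s, (f y).1 = (f ⟨x, hx⟩).1 := ⟨_, rfl⟩
    refine (dif_pos h).trans ?_
    have := f.injective (Subtype.ext h.choose_spec)
    rw [this]

theorem mk_prod_ordinal (κ : Cardinal.{u}) (hκ : Cardinal.aleph0 ≤ κ) :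
    Cardinal.mk (Set.Iio κ.ord ×ˢ Set.Iio κ.ord : Set (Ordinal.{u} × Ordinal.{u})) =
      Cardinal.lift.{u + 1} κ := by
  rw [Cardinal.mk_setProd, Cardinal.mk_Iio_ordinal, Cardinal.card_ord,
    Cardinal.mul_eq_self]
  simpa using hκ

theorem exists_enum_prod {κ : Cardinal.{u}} (hκ : Cardinal.aleph0 ≤ κ) :
    ∃ g : Ordinal.{u} → Ordinal.{u} × Ordinal.{u}, (∀ i, (g i).1 < κ.ord ∧ (g i).2 < κ.ord) ∧
      ∀ a < κ.ord, ∀ b < κ.ord, ∃ i < κ.ord, g i = (a, b) := by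
  have h0 : 0 < κ.ord := by
    rw [pos_iff_ne_zero, Ne, Cardinal.ord_eq_zero]
    exact (Cardinal.aleph0_pos.trans_le hκ).ne'
  obtain ⟨g, h1, h2⟩ := exists_enum (κ := κ)
    (s := (Set.Iio κ.ord ×ˢ Set.Iio κ.ord : Set (Ordinal.{u} × Ordinal.{u})))
    ⟨(0, 0), h0, h0⟩ (mk_prod_ordinal κ hκ).le
  exact ⟨g, h1, fun a ha b hb => h2 (a, b) ⟨ha, hb⟩⟩

/-! ### Powerset preserving embeddings -/

open Classical in
/-- The extension of a map between classes to all sets. -/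
noncomputable def extMap {M N : Set ZFSet.{u}} (j : M → N) (x : ZFSet.{u}) : ZFSet.{u} :=
  if h : x ∈ M then (j ⟨x, h⟩).1 else ∅

theorem extMap_of_mem {M N : Set ZFSet.{u}} (j : M → N) {x : ZFSet.{u}} (h : x ∈ M) :
    extMap j x = (j ⟨x, h⟩).1 := dif_pos h

/-- A `κ`-powerset preserving embedding of an elementary substructure of `H(θ)`. -/
structure RamseyEmbedding (α κ θ : Cardinal.{u}) (M N : ZFSet.{u})
    (j : (M : Set ZFSet.{u}) ↪ₑ[setLang] (N : Set ZFSet.{u})) : Prop where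
  reg : θ.IsRegular
  inf : Cardinal.aleph0 ≤ κ
  elem : ElemSub (M : Set ZFSet.{u}) (HSet θ)
  subset : cardSet κ ⊆ M
  mem : cardSet κ ∈ M
  closed : ClosedUnderLT α M
  trans : N.IsTransitive
  pres : PowersetPreserving κ (M : Set ZFSet.{u}) (N : Set ZFSet.{u}) j

/-- The relation `Z`, restricted to first coordinates in `η`. -/
def cut (K Z η : ZFSet.{u}) : ZFSet.{u} :=
  ZFSet.sep (fun p => ∃ a ∈ η, ∃ b ∈ K, p = ZFSet.pair a b) Z

namespace RamseyEmbedding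

variable {α κ θ : Cardinal.{u}} {M N : ZFSet.{u}}
  {j : (M : Set ZFSet.{u}) ↪ₑ[setLang] (N : Set ZFSet.{u})}

theorem transClass (E : RamseyEmbedding α κ θ M N j) : TransClass (N : Set ZFSet.{u}) :=
  fun x hx _ hy => E.trans x hx hy

theorem map_mem (_ : RamseyEmbedding α κ θ M N j) {x : ZFSet.{u}} (hx : x ∈ M) :
    extMap j x ∈ N := by
  rw [extMap_of_mem j hx]
  exact (j ⟨x, hx⟩).2

theorem iff (E : RamseyEmbedding α κ θ M N j) {n : ℕ}
    {P : Set ZFSet.{u} → (Fin n → ZFSet.{u}) → Prop} (hP : Dfn P) (v : Fin n → ZFSet.{u})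
    (hv : ∀ i, v i ∈ M) : P (HSet θ) v ↔ P N fun i => extMap j (v i) := by
  have := E.elem.transfer transClass_hset E.transClass j hP fun i => ⟨v i, hv i⟩
  rw [this]
  refine iff_of_eq (congrArg _ (funext fun i => ?_))
  rw [extMap_of_mem j (hv i)]

theorem map_fix (E : RamseyEmbedding α κ θ M N j) {i : ZFSet.{u}} (hi : i ∈ cardSet κ) :
    extMap j i = i := by
  rw [extMap_of_mem j (E.subset hi)]
  exact E.pres.fix ⟨i, _⟩ hi

theorem map_pair (E : RamseyEmbedding α κ θ M N j) {x y : ZFSet.{u}} (hx : x ∈ M)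
    (hy : y ∈ M) : extMap j (ZFSet.pair x y) = ZFSet.pair (extMap j x) (extMap j y) := by
  have hp : ZFSet.pair x y ∈ M := E.elem.pair_mem E.reg hx hy
  exact (E.iff (P := fun _ v => v 0 = ZFSet.pair (v 1) (v 2)) (.eq_pair _ _ _) ![ZFSet.pair x y, x, y]
    (by simp [Fin.forall_fin_succ, hx, hy, hp])).1 rfl

theorem mem_iff (E : RamseyEmbedding α κ θ M N j) {x y : ZFSet.{u}} (hx : x ∈ M)
    (hy : y ∈ M) : extMap j x ∈ extMap j y ↔ x ∈ y :=
  (E.iff (P := fun _ v => v 0 ∈ v 1) (.mem _ _) ![x, y]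
    (by simp [Fin.forall_fin_succ, hx, hy])).symm

theorem pair_mem_map_iff (E : RamseyEmbedding α κ θ M N j) {x y r : ZFSet.{u}} (hr : r ∈ M)
    (hx : x ∈ cardSet κ) (hy : y ∈ cardSet κ) :
    ZFSet.pair x y ∈ extMap j r ↔ ZFSet.pair x y ∈ r := by
  have hx' := E.subset hx
  have hy' := E.subset hy
  rw [← E.mem_iff (E.elem.pair_mem E.reg hx' hy') hr, E.map_pair hx' hy', E.map_fix hx,
    E.map_fix hy]

/-- By elementarity `j(κ)` is an ordinal; it includes `κ`, whose elements are fixed, and it differs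
from `κ`. -/
theorem cardSet_mem_map (E : RamseyEmbedding α κ θ M N j) :
    cardSet κ ∈ extMap j (cardSet κ) := by
  have h1 : (cardSet κ).IsOrdinal := ZFSet.isOrdinal_toZFSet _
  have h2 : (extMap j (cardSet κ)).IsOrdinal := by
    rw [ZFSet.isOrdinal_iff_forall_mem_isTransitive] at h1 ⊢
    exact (E.iff (P := fun _ v => (∀ y ∈ v 0, y ⊆ v 0) ∧ ∀ y ∈ v 0, ∀ z ∈ y, z ⊆ y)
      (.and (.ball _ (.subset _ _)) (.ball _ (.ball _ (.subset _ _)))) ![cardSet κ]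
      (by simp [E.mem])).1 h1
  have h3 : cardSet κ ⊆ extMap j (cardSet κ) := fun i hi => by
    have := (E.mem_iff (E.subset hi) E.mem).2 hi
    rwa [E.map_fix hi] at this
  rcases (h1.subset_iff_eq_or_mem h2).1 h3 with h | h
  · refine absurd h.symm ?_
    rw [extMap_of_mem j E.mem]
    exact E.pres.moves ⟨_, E.mem⟩ rfl
  · exact h

theorem cardSet_mem (E : RamseyEmbedding α κ θ M N j) : cardSet κ ∈ N :=
  E.trans _ (E.map_mem E.mem) E.cardSet_mem_map

/-- `N` is elementarily equivalent to `H(θ)`, so every instance of separation with arbitrary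
parameters carries over. -/
theorem sep_mem (E : RamseyEmbedding α κ θ M N j) {n : ℕ}
    {R : Set ZFSet.{u} → (Fin n → ZFSet.{u}) → ZFSet.{u} → Prop}
    (hR : Dfn fun (S : Set ZFSet.{u}) (w : Fin (n + 1) → ZFSet.{u}) => R S (Fin.tail w) (w 0))
    (v : Fin n → ZFSet.{u}) (hv : ∀ i, v i ∈ N) {a : ZFSet.{u}} (ha : a ∈ N) :
    ZFSet.sep (R N v) a ∈ N := by
  have hequiv : setLang.ElementarilyEquivalent (HSet θ) (N : Set ZFSet.{u}) :=
    E.elem.elementarilyEquivalent.symm.trans j.elementarilyEquivalent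
  have := Dfn.forall_imp_forall (n := n + 1)
    (P := fun S w => ∃ x ∈ S, x ⊆ w 0 ∧ ∀ z ∈ w 0, (z ∈ x ↔ R S (Fin.tail w) z))
    (.ex (.and (.subset _ _) (.ball _
      (.iff (.mem _ _) (hR.comp (Fin.cases 0 fun i => i.succ.succ.succ))))))
    transClass_hset E.transClass hequiv ?_ (Fin.cons a v : Fin (n + 1) → ZFSet.{u})
    (fun i => by refine Fin.cases ?_ (fun i => ?_) i <;> simp [ha, hv])
  · obtain ⟨x, hx, h1, h2⟩ := this
    simp only [Fin.cons_zero, Fin.tail_cons] at h1 h2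
    have : ZFSet.sep (R N v) a = x := by
      ext z
      rw [ZFSet.mem_sep]
      exact ⟨fun ⟨hz, hR⟩ => (h2 z hz).2 hR, fun hz => ⟨h1 hz, (h2 z (h1 hz)).1 hz⟩⟩
    rwa [this]
  · intro w hw
    refine ⟨ZFSet.sep (R (HSet θ) (Fin.tail w)) (w 0), hset_subset (hw 0) ZFSet.sep_subset,
      ZFSet.sep_subset, fun z hz => ?_⟩
    simp [hz]

theorem prod_mem (E : RamseyEmbedding α κ θ M N j) : ZFSet.prod (cardSet κ) (cardSet κ) ∈ M :=
  E.elem.prod_mem E.reg E.mem E.mem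

/-- Pairs of ordinals below `κ` are fixed by `j`, so `r` is the part of `j(r)` inside `κ × κ`. -/
theorem mem_target_of_mem (E : RamseyEmbedding α κ θ M N j) {r : ZFSet.{u}} (hr : r ∈ M)
    (hs : r ⊆ ZFSet.prod (cardSet κ) (cardSet κ)) : r ∈ N := by
  have h1 := E.sep_mem (R := fun _ v z => ∃ a ∈ v 0, ∃ b ∈ v 0, z = ZFSet.pair a b)
    (.bex _ (.bex _ (.eq_pair _ _ _))) ![cardSet κ] (by simp [E.cardSet_mem]) (E.map_mem hr)
  convert h1 using 1
  ext p
  rw [ZFSet.mem_sep]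
  constructor
  · intro hp
    obtain ⟨a, ha, b, hb, rfl⟩ := ZFSet.mem_prod.1 (hs hp)
    exact ⟨(E.pair_mem_map_iff hr ha hb).2 hp, a, ha, b, hb, rfl⟩
  · rintro ⟨hp, a, ha, b, hb, rfl⟩
    exact (E.pair_mem_map_iff hr ha hb).1 hp

/-- Powerset preservation speaks of subsets of `κ` only, so `r` is coded by one. Elementarity gives
an `f ∈ M` that enumerates `κ × κ` in type `κ`. The set `X` of indices that `j(f)` sends into `r`
belongs to `N`, hence to `M`, and `r` is the image of `X` under `f`. -/
theorem mem_of_mem_target (E : RamseyEmbedding α κ θ M N j) {r : ZFSet.{u}} (hr : r ∈ N)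
    (hs : r ⊆ ZFSet.prod (cardSet κ) (cardSet κ)) : r ∈ M := by
  obtain ⟨g, hg1, hg2⟩ := exists_enum_prod E.inf
  have hord : ∀ i < κ.ord, i.toZFSet ∈ HSet θ := fun i hi =>
    E.elem.subset (E.subset (toZFSet_mem_cardSet.2 hi))
  have hκθ : κ.ord < θ.ord := by
    have := card_lt_of_mem_hset (E.elem.subset E.mem)
    rw [cardSet, Ordinal.card_toZFSet, Cardinal.card_ord] at this
    exact Cardinal.ord_lt_ord.2 this
  obtain ⟨f, hf, hf1, hf2⟩ := E.elem.exists_mem transClass_hset (n := 1)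
    (R := fun S v f => (∀ i ∈ v 0, ∀ q ∈ S, ∀ q' ∈ S, ZFSet.pair i q ∈ f → ZFSet.pair i q' ∈ f →
        q = q') ∧ (∀ a ∈ v 0, ∀ b ∈ v 0, ∃ q ∈ S, q = ZFSet.pair a b ∧ ∃ i ∈ v 0, ZFSet.pair i q ∈ f)) 
    (.and (.ball _ (.all (.all (.imp (.pair_mem _ _ _) (.imp (.pair_mem _ _ _) (.eq _ _))))))
      (.ball _ (.ball _ (.ex (.and (.eq_pair _ _ _) (.bex _ (.pair_mem _ _ _))))))) ![cardSet κ]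
    (by simp [E.mem])
    ⟨seqSet κ.ord fun i => ZFSet.pair (g i).1.toZFSet (g i).2.toZFSet,
      seqSet_mem_hset E.reg hκθ fun i _ => pair_mem_hset E.reg (hord _ (hg1 i).1)
        (hord _ (hg1 i).2), by
      refine ⟨?_, ?_⟩
      · intro i _ q _ q' _ h h'
        obtain ⟨i, _, rfl, rfl⟩ := pair_mem_seqSet.1 h
        obtain ⟨i', _, h, rfl⟩ := pair_mem_seqSet.1 h'
        rw [Ordinal.toZFSet_injective h]
      · intro a ha b hb
        change a ∈ cardSet κ at ha
        change b ∈ cardSet κ at hb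
        obtain ⟨a, ha', rfl⟩ := mem_cardSet.1 ha
        obtain ⟨b, hb', rfl⟩ := mem_cardSet.1 hb
        obtain ⟨i, hi, h⟩ := hg2 a ha' b hb'
        refine ⟨_, pair_mem_hset E.reg (hord _ ha') (hord _ hb'), rfl, i.toZFSet,
          toZFSet_mem_cardSet.2 hi, pair_mem_seqSet.2 ⟨i, hi, rfl, ?_⟩⟩
        rw [h]⟩
  change ∀ i ∈ cardSet κ, ∀ q ∈ HSet θ, ∀ q' ∈ HSet θ, _ at hf1
  change ∀ a ∈ cardSet κ, ∀ b ∈ cardSet κ, _ at hf2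
  have hpM : ∀ {a b}, a ∈ cardSet κ → b ∈ cardSet κ → ZFSet.pair a b ∈ M := fun ha hb =>
    E.elem.pair_mem E.reg (E.subset ha) (E.subset hb)
  have hfq : ∀ {i a b}, i ∈ cardSet κ → a ∈ cardSet κ → b ∈ cardSet κ →
      (ZFSet.pair i (ZFSet.pair a b) ∈ extMap j f ↔ ZFSet.pair i (ZFSet.pair a b) ∈ f) := by
    intro i a b hi ha hb
    rw [← E.mem_iff (E.elem.pair_mem E.reg (E.subset hi) (hpM ha hb)) hf,
      E.map_pair (E.subset hi) (hpM ha hb), E.map_pair (E.subset ha) (E.subset hb),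
      E.map_fix hi, E.map_fix ha, E.map_fix hb]
  have hX := E.sep_mem (R := fun _ v i => ∃ q ∈ v 0, ZFSet.pair i q ∈ v 1)
    (.bex _ (.pair_mem _ _ _)) ![r, extMap j f] (by simp [Fin.forall_fin_succ, hr, E.map_mem hf])
    E.cardSet_mem
  rw [← SetLike.mem_coe, ← E.pres.subsets _ ZFSet.sep_subset] at hX
  set X := ZFSet.sep (fun i => ∃ q ∈ r, ZFSet.pair i q ∈ extMap j f) (cardSet κ) with hXdef
  have h2 := E.elem.sep_mem (R := fun _ v q => ∃ i ∈ v 0, ZFSet.pair i q ∈ v 1)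
    (.bex _ (.pair_mem _ _ _)) ![X, f] (by simp [Fin.forall_fin_succ]; exact ⟨hX, hf⟩) E.prod_mem
  refine Eq.subst (motive := fun z => z ∈ M) ?_ h2
  symm
  ext p
  rw [ZFSet.mem_sep]
  change _ ↔ _ ∧ ∃ i ∈ X, ZFSet.pair i p ∈ f
  constructor
  · intro hp
    refine ⟨hs hp, ?_⟩
    obtain ⟨a, ha, b, hb, rfl⟩ := ZFSet.mem_prod.1 (hs hp)
    obtain ⟨q, _, rfl, i, hi, hif⟩ := hf2 a ha b hb
    exact ⟨i, ZFSet.mem_sep.2 ⟨hi, _, hp, (hfq hi ha hb).2 hif⟩, hif⟩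
  · rintro ⟨_, i, hi, hif⟩
    obtain ⟨hi, q, hq, hiq⟩ := ZFSet.mem_sep.1 hi
    obtain ⟨a, ha, b, hb, rfl⟩ := ZFSet.mem_prod.1 (hs hq)
    have hH : ∀ {q}, ZFSet.pair i q ∈ f → q ∈ HSet θ := fun h =>
      (transClass_hset.of_pair_mem (E.elem.subset hf) h).2
    have h3 := (hfq hi ha hb).1 hiq
    rwa [hf1 i hi p (hH hif) _ (hH h3) hif h3]

end RamseyEmbedding

/-! ### Decisions by the derived ultrafilter -/

namespace RamseyEmbedding

variable {α κ θ : Cardinal.{u}} {M N : ZFSet.{u}}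
  {j : (M : Set ZFSet.{u}) ↪ₑ[setLang] (N : Set ZFSet.{u})}

/-- Against a challenger whose families of subsets of `κ` are computed by `e`, the ultrafilter derived
from the embedding yields decisions `Z` such that all diagonal intersections are unbounded. -/
theorem exists_decision (E : RamseyEmbedding α κ θ M N j) {γ : Ordinal.{u}} (hγα : γ < α.ord)
    (hγκ : γ < κ.ord) (e : Ordinal.{u} → ZFSet.{u} → ZFSet.{u})
    (he : ∀ η < γ, ∀ s ∈ M, s ⊆ ZFSet.prod (cardSet κ) (cardSet κ) →
      e η s ∈ M ∧ e η s ⊆ ZFSet.prod (cardSet κ) (cardSet κ)) :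
    ∃ Z ∈ M, Z ⊆ ZFSet.prod (cardSet κ) (cardSet κ) ∧
      ∀ h₁ ∈ M, ∀ h₂ ∈ M, (∀ i ∈ cardSet κ, ∃ η ∈ γ.toZFSet, ZFSet.pair i η ∈ h₁) →
        (∀ i ∈ cardSet κ, ∃ k ∈ cardSet κ, ZFSet.pair i k ∈ h₂) →
        ∀ δ ∈ cardSet κ, ∃ β ∈ cardSet κ, δ ∈ β ∧ ∀ i ∈ β, ∃ η < γ, ∃ k ∈ cardSet κ,
          ZFSet.pair i η.toZFSet ∈ h₁ ∧ ZFSet.pair i k ∈ h₂ ∧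
          (ZFSet.pair k β ∈ e η (cut (cardSet κ) Z η.toZFSet) ↔ ZFSet.pair η.toZFSet k ∈ Z) := by
  classical
  set K := cardSet κ with hK
  -- All decisions before stage `ξ`, gathered into one relation on `κ`.
  let C : Ordinal.{u} → (Ordinal.{u} → ZFSet.{u}) → ZFSet.{u} := fun ξ f =>
    ZFSet.sep (fun p => ∃ η < ξ, ∃ k ∈ f η, p = ZFSet.pair η.toZFSet k) (ZFSet.prod K K)
  -- Stage `ξ` accepts `k` when `κ` lies in the image under `j` of the `k`-th set of the family.
  obtain ⟨f, hf⟩ := exists_recursive (α := ZFSet.{u}) fun ξ f =>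
    ZFSet.sep (fun k => ZFSet.pair k K ∈ extMap j (e ξ (C ξ f))) K
  have hC : ∀ ξ, C ξ (fun η => if η < ξ then f η else default) = C ξ f := fun ξ => by
    ext p
    simp only [C, ZFSet.mem_sep]
    refine and_congr_right fun _ => exists_congr fun η => and_congr_right fun hη => ?_
    rw [if_pos hη]
  simp only [hC] at hf
  have hiM : ∀ i < κ.ord, i.toZFSet ∈ M := fun i hi => E.subset (toZFSet_mem_cardSet.2 hi)
  have hfK : ∀ ξ, f ξ ⊆ K := fun ξ => by rw [hf]; exact ZFSet.sep_subset
  have hCpair : ∀ {ξ η : Ordinal.{u}} {k : ZFSet.{u}}, η < κ.ord →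
      (ZFSet.pair η.toZFSet k ∈ C ξ f ↔ η < ξ ∧ k ∈ f η) := by
    intro ξ η k hη
    simp only [C, ZFSet.mem_sep, ZFSet.pair_mem_prod, ZFSet.pair_inj]
    constructor
    · rintro ⟨_, η', hη', k', hk', h1, rfl⟩
      rw [Ordinal.toZFSet_injective h1]
      exact ⟨hη', hk'⟩
    · rintro ⟨h1, h2⟩
      exact ⟨⟨toZFSet_mem_cardSet.2 hη, hfK _ h2⟩, η, h1, k, h2, rfl, rfl⟩
  -- Closure of `M` under short sequences carries the recursion through limit stages; `γ < α` is
  -- essential.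
  have hCM : ∀ ξ ≤ γ, (∀ η < ξ, f η ∈ M) → C ξ f ∈ M := by
    intro ξ hξ ih
    have hseq := E.closed ξ (hξ.trans_lt hγα) f ih
    have h2 := E.elem.sep_mem (R := fun _ v p => ∃ η ∈ v 0, ∃ k ∈ v 0, p = ZFSet.pair η k ∧
        ∃ A, ZFSet.pair η A ∈ v 1 ∧ k ∈ A)
      (.bex _ (.bex _ (.and (.eq_pair _ _ _) (.ex_pair_mem _ _ (.mem _ _))))) ![K, seqSet ξ f]
      (by simp [Fin.forall_fin_succ]; exact ⟨E.mem, hseq⟩) E.prod_mem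
    refine Eq.subst (motive := fun z => z ∈ M) ?_ h2
    ext p
    simp only [C, ZFSet.mem_sep]
    refine and_congr_right fun hp => ?_
    constructor
    · rintro ⟨η, _, k, _, rfl, A, hA, hkA⟩
      obtain ⟨i, hi, rfl, rfl⟩ := pair_mem_seqSet.1 hA
      exact ⟨i, hi, k, hkA, rfl⟩
    · rintro ⟨η, hη, k, hk, rfl⟩
      rw [ZFSet.pair_mem_prod] at hp
      exact ⟨_, hp.1, k, hp.2, rfl, f η, pair_mem_seqSet.2 ⟨η, hη, rfl, rfl⟩, hk⟩
  have hCs : ∀ ξ, C ξ f ⊆ ZFSet.prod K K := fun ξ => ZFSet.sep_subset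
  have hfM : ∀ ξ < γ, f ξ ∈ M := by
    intro ξ
    induction ξ using WellFoundedLT.induction with
    | _ ξ ih =>
      intro hξ
      have h1 := (he ξ hξ (C ξ f) (hCM ξ hξ.le fun η hη => ih η hη (hη.trans hξ)) (hCs ξ)).1
      -- The decisions of stage `ξ` are definable in `N` from `κ` and the image of the family. Being
      -- a subset of `κ`, they return to `M` by powerset preservation.
      have h2 := E.sep_mem (R := fun _ v k => ZFSet.pair k (v 0) ∈ v 1) (.pair_mem _ _ _)
        ![K, extMap j (e ξ (C ξ f))]
        (by simp [Fin.forall_fin_succ]; exact ⟨E.cardSet_mem, E.map_mem h1⟩) E.cardSet_mem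
      have h3 : f ξ ∈ N := by rw [hf ξ]; exact h2
      exact (E.pres.subsets _ (hfK ξ)).2 h3
  have hCM' : ∀ ξ ≤ γ, C ξ f ∈ M := fun ξ hξ => hCM ξ hξ fun η hη => hfM η (hη.trans_le hξ)
  have hcut : ∀ ξ ≤ γ, cut K (C γ f) ξ.toZFSet = C ξ f := by
    intro ξ hξ
    ext p
    simp only [cut, ZFSet.mem_sep]
    constructor
    · rintro ⟨hp, a, ha, b, hb, rfl⟩
      obtain ⟨a, ha', rfl⟩ := Ordinal.mem_toZFSet_iff.1 ha
      have hak := (ha'.trans_le hξ).trans hγκ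
      rw [hCpair hak] at hp ⊢
      exact ⟨ha', hp.2⟩
    · intro hp
      obtain ⟨a, ha, b, hb, rfl⟩ := ZFSet.mem_prod.1 (hCs _ hp)
      obtain ⟨a, ha', rfl⟩ := mem_cardSet.1 ha
      rw [hCpair ha'] at hp ⊢
      exact ⟨⟨hp.1.trans_le hξ, hp.2⟩, _, Ordinal.toZFSet_mem_toZFSet_iff.2 hp.1, b, hb, rfl⟩
  refine ⟨C γ f, hCM' γ le_rfl, hCs γ, fun h₁ hh₁ h₂ hh₂ H1 H2 => ?_⟩
  let F : Ordinal.{u} → ZFSet.{u} := fun η => e η (C η f)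
  have hFM : ∀ η < γ, F η ∈ M := fun η hη => (he η hη _ (hCM' η hη.le) (hCs η)).1
  have hF := E.closed γ hγα F hFM
  have hR := E.elem.sep_mem (R := fun _ v p => ∃ i ∈ v 0, ∃ β ∈ v 0, p = ZFSet.pair i β ∧
      ∃ η ∈ v 1, ∃ k ∈ v 0, ZFSet.pair i η ∈ v 2 ∧ ZFSet.pair i k ∈ v 3 ∧
        ∃ A, ZFSet.pair η A ∈ v 4 ∧ (ZFSet.pair k β ∈ A ↔ ZFSet.pair η k ∈ v 5))
    (.bex _ (.bex _ (.and (.eq_pair _ _ _) (.bex _ (.bex _ (.and (.pair_mem _ _ _)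
      (.and (.pair_mem _ _ _) (.ex_pair_mem _ _ (.iff (.pair_mem _ _ _) (.pair_mem _ _ _))))))))))
    ![K, γ.toZFSet, h₁, h₂, seqSet γ F, C γ f]
    (by simp [Fin.forall_fin_succ]; exact ⟨E.mem, hiM γ hγκ, hh₁, hh₂, hF, hCM' γ le_rfl⟩)
    E.prod_mem
  -- The section of `R` at `i` is the set chosen at `i`, or its complement if the decision went
  -- against it.
  let R : ZFSet.{u} := ZFSet.sep (fun p => ∃ i ∈ K, ∃ β ∈ K, p = ZFSet.pair i β ∧
      ∃ η ∈ γ.toZFSet, ∃ k ∈ K, ZFSet.pair i η ∈ h₁ ∧ ZFSet.pair i k ∈ h₂ ∧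
        ∃ A, ZFSet.pair η A ∈ seqSet γ F ∧ (ZFSet.pair k β ∈ A ↔ ZFSet.pair η k ∈ C γ f))
      (ZFSet.prod K K)
  replace hR : R ∈ M := hR
  have hRpair : ∀ {i β}, i ∈ K → β ∈ K → (ZFSet.pair i β ∈ R ↔ ∃ η < γ, ∃ k ∈ K,
      ZFSet.pair i η.toZFSet ∈ h₁ ∧ ZFSet.pair i k ∈ h₂ ∧
        (ZFSet.pair k β ∈ F η ↔ ZFSet.pair η.toZFSet k ∈ C γ f)) := by
    intro i β hi hβ
    simp only [R, ZFSet.mem_sep, ZFSet.pair_mem_prod, ZFSet.pair_inj]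
    constructor
    · rintro ⟨_, i', _, β', _, ⟨rfl, rfl⟩, η, -, k, hk, h1, h2, A, hA, h3⟩
      obtain ⟨η, hη, rfl, rfl⟩ := pair_mem_seqSet.1 hA
      exact ⟨η, hη, k, hk, h1, h2, h3⟩
    · rintro ⟨η, hη, k, hk, h1, h2, h3⟩
      exact ⟨⟨hi, hβ⟩, i, hi, β, hβ, ⟨rfl, rfl⟩, _, Ordinal.toZFSet_mem_toZFSet_iff.2 hη, k, hk, h1,
        h2, F η, pair_mem_seqSet.2 ⟨η, hη, rfl, rfl⟩, h3⟩
  -- `κ` lies in each of these sections of `j(R)`, since the decisions followed membership of `κ`.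
  have hRU : ∀ i ∈ K, ZFSet.pair i K ∈ extMap j R := by
    intro i hi
    obtain ⟨η, hη', h1⟩ := H1 i hi
    obtain ⟨k, hk, h2⟩ := H2 i hi
    obtain ⟨η, hη, rfl⟩ := Ordinal.mem_toZFSet_iff.1 hη'
    have hηK : η.toZFSet ∈ K := toZFSet_mem_cardSet.2 (hη.trans hγκ)
    have key := (E.iff (P := fun _ v => ∀ β ∈ v 0, (ZFSet.pair (v 1) β ∈ v 2 ↔
        ZFSet.pair (v 3) (v 1) ∈ v 4) → ZFSet.pair (v 5) β ∈ v 6)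
      (.ball _ (.imp (.iff (.pair_mem _ _ _) (.pair_mem _ _ _)) (.pair_mem _ _ _)))
      ![K, k, F η, η.toZFSet, C γ f, i, R]
      (by simp [Fin.forall_fin_succ]; exact ⟨E.mem, E.subset hk, hFM η hη, hiM η (hη.trans hγκ),
        hCM' γ le_rfl, E.subset hi, hR⟩)).1
      (fun β hβ h3 => (hRpair hi hβ).2 ⟨η, hη, k, hk, h1, h2, h3⟩)
    have h4 : ZFSet.pair (extMap j i) K ∈ extMap j R := by
      refine key K E.cardSet_mem_map ?_
      change ZFSet.pair (extMap j k) K ∈ extMap j (F η) ↔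
        ZFSet.pair (extMap j η.toZFSet) (extMap j k) ∈ extMap j (C γ f)
      rw [E.map_fix hk, E.map_fix hηK, E.pair_mem_map_iff (hCM' γ le_rfl) hηK hk,
        hCpair (hη.trans hγκ), hf η, ZFSet.mem_sep]
      exact ⟨fun h => ⟨hη, hk, h⟩, fun h => h.2.2⟩
    rwa [E.map_fix hi] at h4
  intro δ hδ
  -- In `N`, the point `κ < j(κ)` is above `δ` and in all sections of `j(R)` below itself;
  -- elementarity gives such a `β` below `κ`.
  have key := (E.iff (P := fun _ v => ∃ β ∈ v 0, v 1 ∈ β ∧ ∀ i ∈ β, ZFSet.pair i β ∈ v 2)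
    (.bex _ (.and (.mem _ _) (.ball _ (.pair_mem _ _ _)))) ![K, δ, R]
    (by simp [Fin.forall_fin_succ]; exact ⟨E.mem, E.subset hδ, hR⟩)).2
    ⟨K, E.cardSet_mem_map, by change extMap j δ ∈ K; rwa [E.map_fix hδ], hRU⟩
  obtain ⟨β, hβ, hδβ, h⟩ := key
  refine ⟨β, hβ, hδβ, fun i hi => ?_⟩
  obtain ⟨η, hη, k, hk, h1, h2, h3⟩ :=
    (hRpair ((ZFSet.isOrdinal_toZFSet κ.ord).mem_trans hi hβ) hβ).1 (h i hi)
  refine ⟨η, hη, k, hk, h1, h2, ?_⟩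
  rw [hcut η hη.le]
  exact h3

end RamseyEmbedding

/-! ### The decision property, its evaluation in transitive classes, and reflection -/

/-- A local form of the filter property: the challenger codes families of subsets of `κ` by `τ`,
depending on the earlier decisions, and the judge can decide them by some `Z` in such a way that all
diagonal intersections of the sets that have been chosen are unbounded in `κ`. -/
def DecisionProperty (γ κ : Ordinal.{u}) : Prop :=
  ∀ τ : Ordinal.{u} → Ordinal.{u} → Ordinal.{u} → Set (Ordinal.{u} × Ordinal.{u}) → Prop,
    ∃ Z : Set (Ordinal.{u} × Ordinal.{u}), ∀ h₁ h₂ : Ordinal.{u} → Ordinal.{u},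
      (∀ i < κ, h₁ i < γ) → (∀ i < κ, h₂ i < κ) → ∀ δ < κ, ∃ β < κ, δ < β ∧ ∀ i < β,
        (τ (h₁ i) (h₂ i) β {p ∈ Z | p.1 < h₁ i} ↔ (h₁ i, h₂ i) ∈ Z)

/-- The decisions `Z` against `τ` have unbounded diagonal intersection along `⟨h₁, h₂⟩`, as evaluated
in a transitive class. -/
def DecidesAlong (S : Set ZFSet.{u}) (g K τ Z h₁ h₂ : ZFSet.{u}) : Prop :=
  (∀ i ∈ K, ∃ η ∈ g, ZFSet.pair i η ∈ h₁) →
    (∀ i ∈ K, ∃ k ∈ K, ZFSet.pair i k ∈ h₂) → ∀ δ ∈ K, ∃ β ∈ K, δ ∈ β ∧ ∀ i ∈ β,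
      ∃ η ∈ g, ∃ k ∈ K, ZFSet.pair i η ∈ h₁ ∧ ZFSet.pair i k ∈ h₂ ∧
        ((∃ s ∈ S, s = cut K Z η ∧ ZFSet.pair (ZFSet.pair η k) (ZFSet.pair β s) ∈ τ) ↔
          ZFSet.pair η k ∈ Z)

/-- The decision property, as evaluated in a transitive class. -/
def InternalDecision (S : Set ZFSet.{u}) (g K : ZFSet.{u}) : Prop :=
  ∀ τ ∈ S, ∃ Z ∈ S, ∀ h₁ ∈ S, ∀ h₂ ∈ S, DecidesAlong S g K τ Z h₁ h₂

namespace Dfn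

variable {n : ℕ}

theorem eq_cut (i k z e : Fin n) :
    Dfn fun (_ : Set ZFSet.{u}) v => v i = cut (v k) (v z) (v e) := by
  refine Dfn.of_iff (P := fun _ v =>
    (∀ p ∈ v i, p ∈ v z ∧ ∃ a ∈ v e, ∃ b ∈ v k, p = ZFSet.pair a b) ∧
    ∀ p ∈ v z, (∃ a ∈ v e, ∃ b ∈ v k, p = ZFSet.pair a b) → p ∈ v i)
    (.and (.ball _ (.and (.mem _ _) (.bex _ (.bex _ (.eq_pair _ _ _)))))
      (.ball _ (.imp (.bex _ (.bex _ (.eq_pair _ _ _))) (.mem _ _)))) fun S _ v _ => ?_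
  constructor
  · intro h
    rw [h]
    exact ⟨fun p hp => ZFSet.mem_sep.1 hp, fun p hp h => ZFSet.mem_sep.2 ⟨hp, h⟩⟩
  · rintro ⟨h1, h2⟩
    ext p
    exact ⟨fun hp => ZFSet.mem_sep.2 (h1 p hp), fun hp => h2 p (ZFSet.mem_sep.1 hp).1
      (ZFSet.mem_sep.1 hp).2⟩

theorem pair_pair_mem (a b c d t : Fin n) : Dfn fun (_ : Set ZFSet.{u}) v =>
    ZFSet.pair (ZFSet.pair (v a) (v b)) (ZFSet.pair (v c) (v d)) ∈ v t := by
  refine Dfn.of_iff (P := fun S v => ∃ x ∈ S, ∃ y ∈ S, x = ZFSet.pair (v a) (v b) ∧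
    y = ZFSet.pair (v c) (v d) ∧ ZFSet.pair x y ∈ v t)
    (.ex (.ex (.and (.eq_pair _ _ _) (.and (.eq_pair _ _ _) (.pair_mem _ _ _)))))
    fun S hS v hv => ?_
  constructor
  · intro h
    obtain ⟨h1, h2⟩ := hS.of_pair_mem (hv t) h
    exact ⟨_, h1, _, h2, rfl, rfl, h⟩
  · rintro ⟨_, _, _, _, rfl, rfl, h⟩
    exact h

theorem decidesAlong (g k t z a b : Fin n) : Dfn fun (S : Set ZFSet.{u}) v =>
    DecidesAlong S (v g) (v k) (v t) (v z) (v a) (v b) :=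
  .imp (.ball _ (.bex _ (.pair_mem _ _ _))) (.imp (.ball _ (.bex _ (.pair_mem _ _ _)))
    (.ball _ (.bex _ (.and (.mem _ _) (.ball _ (.bex _ (.bex _ (.and (.pair_mem _ _ _)
      (.and (.pair_mem _ _ _) (.iff (.ex (.and (.eq_cut _ _ _ _) (.pair_pair_mem _ _ _ _ _)))
        (.pair_mem _ _ _)))))))))))

theorem internalDecision (i k : Fin n) :
    Dfn fun (S : Set ZFSet.{u}) v => InternalDecision S (v i) (v k) :=
  .all (.ex (.all (.all (.decidesAlong _ _ _ _ _ _))))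

end Dfn

theorem cut_subset {K Z η : ZFSet.{u}} : cut K Z η ⊆ Z := ZFSet.sep_subset

namespace RamseyEmbedding

variable {α κ θ : Cardinal.{u}} {M N : ZFSet.{u}}
  {j : (M : Set ZFSet.{u}) ↪ₑ[setLang] (N : Set ZFSet.{u})}

/-- By elementarity a counterexample `τ` may be taken in `M`, and so may functions `h₁`, `h₂` that
defeat the decisions found for it. Inside `M` the derived ultrafilter prevents this. -/
theorem internalDecision_hset (E : RamseyEmbedding α κ θ M N j) {γ : Ordinal.{u}}
    (hγα : γ < α.ord) (hγκ : γ < κ.ord) :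
    InternalDecision (HSet θ) γ.toZFSet (cardSet κ) := by
  set K := cardSet κ with hK
  have hgM : γ.toZFSet ∈ M := E.subset (toZFSet_mem_cardSet.2 hγκ)
  by_contra hcon
  unfold InternalDecision at hcon
  push Not at hcon
  obtain ⟨τ, hτ, hbad⟩ := E.elem.exists_mem transClass_hset (R := fun S v τ => ∀ Z ∈ S, ∃ h₁ ∈ S,
      ∃ h₂ ∈ S, ¬ DecidesAlong S (v 1) (v 0) τ Z h₁ h₂)
    (.all (.ex (.ex (.not (.decidesAlong _ _ _ _ _ _)))))
    ![K, γ.toZFSet] (by simp [Fin.forall_fin_succ]; exact ⟨E.mem, hgM⟩) hcon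
  -- The family that `τ` presents at stage `η` after the decisions coded by `s`.
  let e : Ordinal.{u} → ZFSet.{u} → ZFSet.{u} := fun η s => ZFSet.sep (fun p => ∃ k ∈ K, ∃ β ∈ K,
    p = ZFSet.pair k β ∧ ZFSet.pair (ZFSet.pair η.toZFSet k) (ZFSet.pair β s) ∈ τ) (ZFSet.prod K K)
  have hepair : ∀ {η s k β}, k ∈ K → β ∈ K → (ZFSet.pair k β ∈ e η s ↔
      ZFSet.pair (ZFSet.pair η.toZFSet k) (ZFSet.pair β s) ∈ τ) := by
    intro η s k β hk hβ
    simp only [e, ZFSet.mem_sep, ZFSet.pair_mem_prod, ZFSet.pair_inj]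
    constructor
    · rintro ⟨_, k', _, β', _, ⟨rfl, rfl⟩, h⟩
      exact h
    · exact fun h => ⟨⟨hk, hβ⟩, k, hk, β, hβ, ⟨rfl, rfl⟩, h⟩
  obtain ⟨Z, hZ, hZs, hgood⟩ := E.exists_decision hγα hγκ e (by
    intro η hη s hs _
    refine ⟨?_, ZFSet.sep_subset⟩
    have hηM : η.toZFSet ∈ M := E.subset (toZFSet_mem_cardSet.2 (hη.trans hγκ))
    exact E.elem.sep_mem (R := fun _ v p => ∃ k ∈ v 0, ∃ β ∈ v 0, p = ZFSet.pair k β ∧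
      ZFSet.pair (ZFSet.pair (v 1) k) (ZFSet.pair β (v 2)) ∈ v 3)
      (.bex _ (.bex _ (.and (.eq_pair _ _ _) (.pair_pair_mem _ _ _ _ _)))) ![K, η.toZFSet, s, τ]
      (by simp [Fin.forall_fin_succ]; exact ⟨E.mem, hηM, hs, hτ⟩) E.prod_mem)
  obtain ⟨h₁, hh₁, hrest⟩ := E.elem.exists_mem transClass_hset (R := fun S v h₁ =>
      ∃ h₂ ∈ S, ¬ DecidesAlong S (v 1) (v 0) (v 3) (v 2) h₁ h₂)
    (.ex (.not (.decidesAlong _ _ _ _ _ _)))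
    ![K, γ.toZFSet, Z, τ] (by simp [Fin.forall_fin_succ]; exact ⟨E.mem, hgM, hZ, hτ⟩)
    (hbad Z (E.elem.subset hZ))
  obtain ⟨h₂, hh₂, h⟩ := E.elem.exists_mem transClass_hset (R := fun S v h₂ =>
      ¬ DecidesAlong S (v 1) (v 0) (v 3) (v 2) (v 4) h₂)
    (.not (.decidesAlong _ _ _ _ _ _))
    ![K, γ.toZFSet, Z, τ, h₁] (by simp [Fin.forall_fin_succ]; exact ⟨E.mem, hgM, hZ, hτ, hh₁⟩)
    hrest
  refine h fun H1 H2 δ hδ => ?_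
  obtain ⟨β, hβ, hδβ, hβ'⟩ := hgood h₁ hh₁ h₂ hh₂ H1 H2 δ hδ
  refine ⟨β, hβ, hδβ, fun i hi => ?_⟩
  obtain ⟨η, hη, k, hk, a, b, c⟩ := hβ' i hi
  refine ⟨_, Ordinal.toZFSet_mem_toZFSet_iff.2 hη, k, hk, a, b, ?_⟩
  rw [hepair hk hβ] at c
  change (∃ s ∈ HSet θ, s = cut K Z _ ∧ _ ∈ τ) ↔ _ ∈ Z
  rw [← c]
  constructor
  · rintro ⟨s, _, rfl, h⟩
    exact h
  · exact fun h => ⟨_, hset_subset (E.elem.subset hZ) cut_subset, rfl, h⟩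

/-- Here `τ` need not belong to `M`, but each family that it presents is a subset of `κ × κ` in `N`
and therefore is in `M`. For this reason `exists_decision` asks only that the values of `e` be in
`M`. Likewise `h₁` and `h₂` enter `M` after restriction to `κ × κ`. -/
theorem internalDecision_target (E : RamseyEmbedding α κ θ M N j) {γ : Ordinal.{u}}
    (hγα : γ < α.ord) (hγκ : γ < κ.ord) :
    InternalDecision (N : Set ZFSet.{u}) γ.toZFSet (cardSet κ) := by
  set K := cardSet κ with hK
  intro τ hτ
  have hN : ∀ {i}, i ∈ K → i ∈ N := fun hi => E.trans _ E.cardSet_mem hi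
  have hprod : ZFSet.prod K K ∈ N := E.mem_target_of_mem E.prod_mem fun _ h => h
  let e : Ordinal.{u} → ZFSet.{u} → ZFSet.{u} := fun η s => ZFSet.sep (fun p => ∃ k ∈ K, ∃ β ∈ K,
    p = ZFSet.pair k β ∧ ZFSet.pair (ZFSet.pair η.toZFSet k) (ZFSet.pair β s) ∈ τ) (ZFSet.prod K K)
  have hepair : ∀ {η s k β}, k ∈ K → β ∈ K → (ZFSet.pair k β ∈ e η s ↔
      ZFSet.pair (ZFSet.pair η.toZFSet k) (ZFSet.pair β s) ∈ τ) := by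
    intro η s k β hk hβ
    simp only [e, ZFSet.mem_sep, ZFSet.pair_mem_prod, ZFSet.pair_inj]
    constructor
    · rintro ⟨_, k', _, β', _, ⟨rfl, rfl⟩, h⟩
      exact h
    · exact fun h => ⟨⟨hk, hβ⟩, k, hk, β, hβ, ⟨rfl, rfl⟩, h⟩
  obtain ⟨Z, hZ, hZs, hgood⟩ := E.exists_decision hγα hγκ e (by
    intro η hη s hs hs'
    refine ⟨E.mem_of_mem_target ?_ ZFSet.sep_subset, ZFSet.sep_subset⟩
    have hηN : η.toZFSet ∈ N := hN (toZFSet_mem_cardSet.2 (hη.trans hγκ))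
    have hsN := E.mem_target_of_mem hs hs'
    exact E.sep_mem (R := fun _ v p => ∃ k ∈ v 0, ∃ β ∈ v 0, p = ZFSet.pair k β ∧
      ZFSet.pair (ZFSet.pair (v 1) k) (ZFSet.pair β (v 2)) ∈ v 3)
      (.bex _ (.bex _ (.and (.eq_pair _ _ _) (.pair_pair_mem _ _ _ _ _)))) ![K, η.toZFSet, s, τ]
      (by simp [Fin.forall_fin_succ]; exact ⟨E.cardSet_mem, hηN, hsN, hτ⟩) hprod)
  have hZN := E.mem_target_of_mem hZ hZs
  have hinter : ∀ h ∈ (N : Set ZFSet.{u}), h ∩ ZFSet.prod K K ∈ M := fun h hh => by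
    refine E.mem_of_mem_target ?_ fun p hp => (ZFSet.mem_inter.1 hp).2
    exact E.sep_mem (R := fun _ v p => p ∈ v 0) (.mem _ _) ![ZFSet.prod K K] (by simp [hprod]) hh
  refine ⟨Z, hZN, fun h₁ hh₁ h₂ hh₂ H1 H2 δ hδ => ?_⟩
  have hgK : ∀ η ∈ γ.toZFSet, η ∈ K := fun η hη =>
    (ZFSet.isOrdinal_toZFSet κ.ord).mem_trans hη (toZFSet_mem_cardSet.2 hγκ)
  obtain ⟨β, hβ, hδβ, hβ'⟩ := hgood _ (hinter h₁ hh₁) _ (hinter h₂ hh₂)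
    (fun i hi => by
      obtain ⟨η, hη, h⟩ := H1 i hi
      exact ⟨η, hη, ZFSet.mem_inter.2 ⟨h, ZFSet.pair_mem_prod.2 ⟨hi, hgK η hη⟩⟩⟩)
    (fun i hi => by
      obtain ⟨k, hk, h⟩ := H2 i hi
      exact ⟨k, hk, ZFSet.mem_inter.2 ⟨h, ZFSet.pair_mem_prod.2 ⟨hi, hk⟩⟩⟩) δ hδ
  refine ⟨β, hβ, hδβ, fun i hi => ?_⟩
  obtain ⟨η, hη, k, hk, a, b, c⟩ := hβ' i hi
  refine ⟨_, Ordinal.toZFSet_mem_toZFSet_iff.2 hη, k, hk, (ZFSet.mem_inter.1 a).1,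
    (ZFSet.mem_inter.1 b).1, ?_⟩
  rw [hepair hk hβ] at c
  rw [← c]
  constructor
  · rintro ⟨s, _, rfl, h⟩
    exact h
  · refine fun h => ⟨_, ?_, rfl, h⟩
    exact E.sep_mem (R := fun _ v p => ∃ a ∈ v 0, ∃ b ∈ v 1, p = ZFSet.pair a b)
      (.bex _ (.bex _ (.eq_pair _ _ _))) ![η.toZFSet, K]
      (by simp [Fin.forall_fin_succ]; exact ⟨hN (hgK _ (Ordinal.toZFSet_mem_toZFSet_iff.2 hη)),
        E.cardSet_mem⟩) hZN

/-- In `N`, the ordinal `κ` is below `j(κ)`, above `δ = j(δ)`, and has the property for `γ = j(γ)`;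
this is pulled back along `j`. -/
theorem exists_internalDecision_lt (E : RamseyEmbedding α κ θ M N j) {γ : Ordinal.{u}}
    (hγα : γ < α.ord) (hγκ : γ < κ.ord) {δ : Ordinal.{u}} (hδ : δ < κ.ord) :
    ∃ μ < κ.ord, δ < μ ∧ InternalDecision (HSet θ) γ.toZFSet μ.toZFSet := by
  have hγ := toZFSet_mem_cardSet.2 hγκ
  have hδ' := toZFSet_mem_cardSet.2 hδ
  obtain ⟨μ, hμ, h1, h2⟩ := (E.iff (P := fun S v => ∃ μ ∈ v 0, v 1 ∈ μ ∧ InternalDecision S (v 2) μ)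
    (.bex _ (.and (.mem _ _) (.internalDecision _ _))) ![cardSet κ, δ.toZFSet, γ.toZFSet]
    (by simp [Fin.forall_fin_succ]; exact ⟨E.mem, E.subset hδ', E.subset hγ⟩)).2
    ⟨cardSet κ, E.cardSet_mem_map, by
      change extMap j δ.toZFSet ∈ cardSet κ
      rwa [E.map_fix hδ'], by
      change InternalDecision _ (extMap j γ.toZFSet) (cardSet κ)
      rw [E.map_fix hγ]
      exact E.internalDecision_target hγα hγκ⟩
  obtain ⟨μ, hμ', rfl⟩ := mem_cardSet.1 hμ
  exact ⟨μ, hμ', Ordinal.toZFSet_mem_toZFSet_iff.1 h1, h2⟩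

end RamseyEmbedding

/-! ### Correctness of `H(θ)` about the decision property -/

theorem rank_kuratowski_lt {l : Ordinal.{u}} (hl : Order.IsSuccLimit l) {x y : ZFSet.{u}}
    (hx : x.rank < l) (hy : y.rank < l) : (ZFSet.pair x y).rank < l := by
  simp only [ZFSet.pair, ZFSet.rank_pair, ZFSet.rank_singleton]
  refine max_lt (hl.succ_lt (hl.succ_lt hx)) (hl.succ_lt (max_lt (hl.succ_lt hx) (hl.succ_lt hy)))

theorem mem_hset_of_rank_lt {θ : Cardinal.{u}} {ρ : Ordinal.{u}}
    (h : (ZFSet.vonNeumann ρ).card < θ) {x : ZFSet.{u}} (hx : x.rank ≤ ρ) : x ∈ HSet θ :=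
  ⟨_, ZFSet.isTransitive_vonNeumann ρ, ZFSet.subset_vonNeumann.2 hx, h⟩

/-- A relation between ordinals, as a set. -/
noncomputable def encode (γ μ : Ordinal.{u}) (S : Set (Ordinal.{u} × Ordinal.{u})) : ZFSet.{u} :=
  ZFSet.sep (fun p => ∃ a b : Ordinal.{u}, (a, b) ∈ S ∧ p = ZFSet.pair a.toZFSet b.toZFSet)
    (ZFSet.prod γ.toZFSet μ.toZFSet)

theorem pair_mem_encode {γ μ a b : Ordinal.{u}} {S : Set (Ordinal.{u} × Ordinal.{u})} :
    ZFSet.pair a.toZFSet b.toZFSet ∈ encode γ μ S ↔ a < γ ∧ b < μ ∧ (a, b) ∈ S := by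
  simp only [encode, ZFSet.mem_sep, ZFSet.pair_mem_prod, Ordinal.toZFSet_mem_toZFSet_iff,
    ZFSet.pair_inj]
  constructor
  · rintro ⟨⟨h1, h2⟩, a', b', h, h3, h4⟩
    rw [Ordinal.toZFSet_injective h3, Ordinal.toZFSet_injective h4]
    exact ⟨Ordinal.toZFSet_injective h3 ▸ h1, Ordinal.toZFSet_injective h4 ▸ h2, h⟩
  · rintro ⟨h1, h2, h⟩
    exact ⟨⟨h1, h2⟩, a, b, h, rfl, rfl⟩

theorem rank_encode_le {γ μ l : Ordinal.{u}} (hl : Order.IsSuccLimit l) (hγ : γ ≤ l) (hμ : μ ≤ l)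
    (S : Set (Ordinal.{u} × Ordinal.{u})) : (encode γ μ S).rank ≤ l := by
  rw [ZFSet.rank_le_iff]
  intro p hp
  obtain ⟨hp, a, b, _, rfl⟩ := ZFSet.mem_sep.1 hp
  rw [ZFSet.pair_mem_prod, Ordinal.toZFSet_mem_toZFSet_iff, Ordinal.toZFSet_mem_toZFSet_iff] at hp
  refine rank_kuratowski_lt hl ?_ ?_ <;> rw [Ordinal.rank_toZFSet]
  exacts [hp.1.trans_le hγ, hp.2.trans_le hμ]

/-- Decisions are coded by sets of rank at most `l`, and an arbitrary predicate `τ` by a set of rank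
at most `l + ω`. So `V_{l+ω}` having size below `θ` is enough for `H(θ)` to see every challenge. -/
theorem decisionProperty_of_internal {θ : Cardinal.{u}} (hθ : θ.IsRegular) {γ μ l : Ordinal.{u}}
    (hl : Order.IsSuccLimit l) (hγ : γ ≤ l) (hμ : μ ≤ l)
    (hV : (ZFSet.vonNeumann (l + Ordinal.omega0)).card < θ)
    (h : InternalDecision (HSet θ) γ.toZFSet μ.toZFSet) : DecisionProperty γ μ := by
  intro τ
  set ρ := l + Ordinal.omega0 with hρdef
  have hρ : Order.IsSuccLimit ρ := Ordinal.isSuccLimit_add l Ordinal.isSuccLimit_omega0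
  have hlρ : l < ρ := lt_add_of_pos_right _ Ordinal.omega0_pos
  have hmem : ∀ {x : ZFSet.{u}}, x.rank ≤ ρ → x ∈ HSet θ := mem_hset_of_rank_lt hV
  have hrank : ∀ {i}, i < l → i.toZFSet.rank < ρ := fun h => by
    rw [Ordinal.rank_toZFSet]; exact h.trans hlρ
  -- `S` is confined to `γ × μ`, where `encode` is injective; pairs outside are forgotten by the
  -- coding.
  let T : ZFSet.{u} := ZFSet.sep (fun t => ∃ η < γ, ∃ k < μ, ∃ β < μ,
    ∃ S : Set (Ordinal.{u} × Ordinal.{u}), S ⊆ Set.Iio γ ×ˢ Set.Iio μ ∧ τ η k β S ∧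
      t = ZFSet.pair (ZFSet.pair η.toZFSet k.toZFSet) (ZFSet.pair β.toZFSet (encode γ μ S)))
    (ZFSet.vonNeumann ρ)
  have hT : T ∈ HSet θ := hmem ((ZFSet.rank_mono ZFSet.sep_subset).trans (ZFSet.rank_vonNeumann _).le)
  obtain ⟨Z, hZ, hgood⟩ := h T hT
  let Z' : Set (Ordinal.{u} × Ordinal.{u}) :=
    {p | p.1 < γ ∧ p.2 < μ ∧ ZFSet.pair p.1.toZFSet p.2.toZFSet ∈ Z}
  have hinj : ∀ {S S' : Set (Ordinal.{u} × Ordinal.{u})}, S ⊆ Set.Iio γ ×ˢ Set.Iio μ →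
      S' ⊆ Set.Iio γ ×ˢ Set.Iio μ → encode γ μ S = encode γ μ S' → S = S' := by
    have : ∀ {S S' : Set (Ordinal.{u} × Ordinal.{u})}, S ⊆ Set.Iio γ ×ˢ Set.Iio μ →
        encode γ μ S = encode γ μ S' → S ⊆ S' := by
      rintro S S' hS he ⟨a, b⟩ hab
      exact (pair_mem_encode.1 (he ▸ pair_mem_encode.2 ⟨(hS hab).1, (hS hab).2, hab⟩)).2.2
    exact fun {_ _} h1 h2 h => (this h1 h).antisymm (this h2 h.symm)
  refine ⟨Z', fun h₁ h₂ hh₁ hh₂ δ hδ => ?_⟩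
  have hμθ : μ < θ.ord := by
    rw [Cardinal.lt_ord]
    refine lt_of_le_of_lt ?_ hV
    exact (Ordinal.card_le_card (hμ.trans hlρ.le)).trans (Ordinal.card_le_card_vonNeumann ρ)
  have hseq : ∀ f : Ordinal.{u} → Ordinal.{u}, (∀ i < μ, f i < l) →
      seqSet μ (fun i => (f i).toZFSet) ∈ HSet θ := fun f hf =>
    seqSet_mem_hset hθ hμθ fun i hi => hmem (hrank (hf i hi)).le
  obtain ⟨β, hβ, hδβ, hβ'⟩ := hgood _ (hseq h₁ fun i hi => (hh₁ i hi).trans_le hγ)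
    _ (hseq h₂ fun i hi => (hh₂ i hi).trans_le hμ)
    (fun i hi => by
      obtain ⟨i, hi', rfl⟩ := Ordinal.mem_toZFSet_iff.1 hi
      exact ⟨_, Ordinal.toZFSet_mem_toZFSet_iff.2 (hh₁ i hi'), pair_mem_seqSet.2 ⟨i, hi', rfl, rfl⟩⟩)
    (fun i hi => by
      obtain ⟨i, hi', rfl⟩ := Ordinal.mem_toZFSet_iff.1 hi
      exact ⟨_, Ordinal.toZFSet_mem_toZFSet_iff.2 (hh₂ i hi'), pair_mem_seqSet.2 ⟨i, hi', rfl, rfl⟩⟩)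
    δ.toZFSet (Ordinal.toZFSet_mem_toZFSet_iff.2 hδ)
  obtain ⟨β, hβμ, rfl⟩ := Ordinal.mem_toZFSet_iff.1 hβ
  refine ⟨β, hβμ, Ordinal.toZFSet_mem_toZFSet_iff.1 hδβ, fun i hi => ?_⟩
  obtain ⟨η, hη, k, hk, h1, h2, h3⟩ := hβ' _ (Ordinal.toZFSet_mem_toZFSet_iff.2 hi)
  obtain ⟨i', _, hii, rfl⟩ := pair_mem_seqSet.1 h1
  cases Ordinal.toZFSet_injective hii
  obtain ⟨i', _, hii, rfl⟩ := pair_mem_seqSet.1 h2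
  cases Ordinal.toZFSet_injective hii
  have hiμ := hi.trans hβμ
  have hcut : cut μ.toZFSet Z (h₁ i).toZFSet = encode γ μ {p ∈ Z' | p.1 < h₁ i} := by
    ext p
    simp only [cut, encode, ZFSet.mem_sep, ZFSet.mem_prod, Set.mem_ofPred_eq, Z']
    constructor
    · rintro ⟨hp, a, ha, b, hb, rfl⟩
      obtain ⟨a, ha', rfl⟩ := Ordinal.mem_toZFSet_iff.1 ha
      obtain ⟨b, hb', rfl⟩ := Ordinal.mem_toZFSet_iff.1 hb
      have := ha'.trans (hh₁ i hiμ)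
      exact ⟨⟨_, Ordinal.toZFSet_mem_toZFSet_iff.2 this, _, hb, rfl⟩,
        a, b, ⟨⟨this, hb', hp⟩, ha'⟩, rfl⟩
    · rintro ⟨_, a, b, ⟨⟨ha, hb, hp⟩, ha'⟩, rfl⟩
      exact ⟨hp, _, Ordinal.toZFSet_mem_toZFSet_iff.2 ha', _,
        Ordinal.toZFSet_mem_toZFSet_iff.2 hb, rfl⟩
  have hS : {p ∈ Z' | p.1 < h₁ i} ⊆ Set.Iio γ ×ˢ Set.Iio μ := fun p hp => ⟨hp.1.1, hp.1.2.1⟩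
  rw [hcut] at h3
  have h4 : (h₁ i, h₂ i) ∈ Z' ↔ ZFSet.pair (h₁ i).toZFSet (h₂ i).toZFSet ∈ Z :=
    ⟨fun h => h.2.2, fun h => ⟨hh₁ i hiμ, hh₂ i hiμ, h⟩⟩
  rw [h4, ← h3]
  have henc : (encode γ μ {p ∈ Z' | p.1 < h₁ i}).rank ≤ l := rank_encode_le hl hγ hμ _
  constructor
  · intro h
    refine ⟨_, hmem (henc.trans hlρ.le), rfl, ZFSet.mem_sep.2 ⟨?_, h₁ i, hh₁ i hiμ, h₂ i, hh₂ i hiμ,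
      β, hβμ, _, hS, h, rfl⟩⟩
    rw [ZFSet.mem_vonNeumann]
    exact rank_kuratowski_lt hρ (rank_kuratowski_lt hρ (hrank ((hh₁ i hiμ).trans_le hγ))
      (hrank ((hh₂ i hiμ).trans_le hμ))) (rank_kuratowski_lt hρ (hrank (hβμ.trans_le hμ))
      (henc.trans_lt hlρ))
  · rintro ⟨s, _, rfl, h⟩
    obtain ⟨_, η, _, k, _, β', _, S, hS', hτ, h⟩ := ZFSet.mem_sep.1 h
    simp only [ZFSet.pair_inj] at h
    obtain ⟨⟨e1, e2⟩, e3, e4⟩ := h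
    cases Ordinal.toZFSet_injective e1
    cases Ordinal.toZFSet_injective e2
    cases Ordinal.toZFSet_injective e3
    rw [hinj hS hS' e4]
    exact hτ

/-! ### Inaccessibility from the decision property -/

namespace DecisionProperty

variable {γ κ : Ordinal.{u}}

/-- Only stage 0 is used, with a family that ignores the decisions. -/
theorem exists_choice (h : DecisionProperty γ κ) (hγ : 0 < γ)
    (e : Ordinal.{u} → Ordinal.{u} → Prop) : ∃ z : Ordinal.{u} → Prop,
      ∀ g : Ordinal.{u} → Ordinal.{u}, (∀ i < κ, g i < κ) → ∀ δ < κ, ∃ β < κ, δ < β ∧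
        ∀ i < β, (e (g i) β ↔ z (g i)) := by
  obtain ⟨Z, hZ⟩ := h fun _ k β _ => e k β
  exact ⟨fun k => (0, k) ∈ Z, fun g hg δ hδ => hZ (fun _ => 0) g (fun _ _ => hγ) hg δ hδ⟩

/-- Each final segment above `c k` must be accepted, because its complement is bounded, as a
constant choice of indices shows. Any `β > l` in the diagonal intersection of all these segments is
then a common bound. -/
theorem forall_lt_of_tails (h : DecisionProperty γ κ) (hγ : 0 < γ) {l : Ordinal.{u}} (hl : l < κ)
    (c : Ordinal.{u} → Ordinal.{u}) (hc : ∀ k < l, c k < κ) : ∃ β < κ, ∀ k < l, c k < β := by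
  obtain ⟨z, hz⟩ := h.exists_choice hγ fun k β => c k < β
  have hzk : ∀ k < l, z k := by
    intro k hk
    obtain ⟨β, _, h1, h2⟩ := hz (fun _ => k) (fun _ _ => hk.trans hl) (c k) (hc k hk)
    exact (h2 0 (pos_of_gt h1)).1 h1
  obtain ⟨β, hβ, h1, h2⟩ := hz (fun i => i) (fun _ h => h) l hl
  exact ⟨β, hβ, fun k hk => (h2 k (hk.trans h1)).2 (hzk k hk)⟩

end DecisionProperty

namespace DecisionProperty

variable {γ κ : Ordinal.{u}}

theorem ord_cof_eq (h : DecisionProperty γ κ) (hγ : 0 < γ) (hκ : 0 < κ) : κ.cof.ord = κ := by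
  by_contra hne
  have hlt := lt_of_le_of_ne (Ordinal.ord_cof_le κ) hne
  obtain ⟨s, hs, hc⟩ := Order.exists_cof_eq (Set.Iio κ)
  rw [Ordinal.cof_Iio, ← Ordinal.lift_cof] at hc
  have hne : s.Nonempty := by
    obtain ⟨y, hy, _⟩ := hs ⟨0, hκ⟩
    exact ⟨y, hy⟩
  obtain ⟨g, hg1, hg2⟩ := exists_enum hne hc.le
  obtain ⟨β, hβ, hβ'⟩ := h.forall_lt_of_tails hγ hlt (fun k => (g k).1) fun k _ => (g k).2
  obtain ⟨y, hy, hle⟩ := hs ⟨β, hβ⟩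
  obtain ⟨k, hk, rfl⟩ := hg2 y hy
  exact absurd (hβ' k hk) (not_lt.2 hle)

/-- If `2^l ≥ c` for some `l < c`, let `f` map `c` injectively to subsets of `l`, and decide for
each `k < l` the set of all `β` with `k ∈ f(β)`. Two different members of the diagonal intersection
above `l` would have the same image under `f`. -/
theorem isInaccessible {c : Cardinal.{u}} (h : DecisionProperty γ c.ord) (hγ : 0 < γ)
    (hc : Cardinal.aleph0 < c) : c.IsInaccessible := by
  have hcof : c.ord.cof = c := by
    have := h.ord_cof_eq hγ (by
      rw [pos_iff_ne_zero, Ne, Cardinal.ord_eq_zero]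
      exact (Cardinal.aleph0_pos.trans hc).ne')
    exact Cardinal.ord_injective this
  refine ⟨hc, hcof.ge, fun {l} hl => ?_⟩
  by_contra hcon
  rw [not_lt] at hcon
  have h1 : Cardinal.mk (Set.Iio c.ord) ≤ Cardinal.mk (Set (Set.Iio l.ord)) := by
    rw [Cardinal.mk_set, Cardinal.mk_Iio_ordinal, Cardinal.mk_Iio_ordinal, Cardinal.card_ord,
      Cardinal.card_ord]
    simpa using Cardinal.lift_le.{u + 1}.2 hcon
  obtain ⟨f⟩ := h1
  have hlc : l.ord < c.ord := Cardinal.ord_lt_ord.2 hl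
  obtain ⟨z, hz⟩ := h.exists_choice hγ fun k β => ∃ (hk : k < l.ord) (hβ : β < c.ord),
    (⟨k, hk⟩ : Set.Iio l.ord) ∈ f ⟨β, hβ⟩
  obtain ⟨β₁, hβ₁, h1, h1'⟩ := hz (fun i => i) (fun _ h => h) l.ord hlc
  obtain ⟨β₂, hβ₂, h2, h2'⟩ := hz (fun i => i) (fun _ h => h) β₁ hβ₁
  have : f ⟨β₁, hβ₁⟩ = f ⟨β₂, hβ₂⟩ := by
    ext ⟨k, hk⟩
    have a1 := h1' k (lt_trans hk h1)
    have a2 := h2' k (lt_trans hk (h1.trans h2))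
    have a3 := a1.trans a2.symm
    constructor
    · intro hm
      exact (a3.1 ⟨hk, hβ₁, hm⟩).2.2
    · intro hm
      exact (a3.2 ⟨hk, hβ₂, hm⟩).2.2
  exact h2.ne (congrArg Subtype.val (f.injective this))

/-- Reflection yields mere ordinals; being equal to their cofinality, they are initial ordinals. -/
theorem exists_cardinal (h : DecisionProperty γ κ) (hγ : 0 < γ) (hκ : Ordinal.omega0 < κ) :
    ∃ c : Cardinal.{u}, κ = c.ord ∧ c.IsInaccessible := by
  have h1 := h.ord_cof_eq hγ (Ordinal.omega0_pos.trans hκ)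
  refine ⟨κ.cof, h1.symm, isInaccessible (γ := γ) (by rwa [h1]) hγ ?_⟩
  rw [← h1, ← Cardinal.ord_aleph0, Cardinal.ord_lt_ord] at hκ
  exact hκ

end DecisionProperty

/-- By regularity, functions from `x < c` to `c` are bounded, so they split into `c` many classes,
one for each bound, and a class has size below `c` as `c` is a strong limit. -/
theorem powerlt_self_of_isInaccessible {c : Cardinal.{u}} (hc : c.IsInaccessible) :
    Cardinal.powerlt c c = c := by
  refine le_antisymm (Cardinal.powerlt_le.2 fun x hx => ?_) ?_
  · have hreg := hc.isRegular
    let r : c.ord.ToType → Ordinal.{u} := fun y => (Ordinal.ToType.mk.symm y).1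
    have hr : ∀ y, r y < c.ord := fun y => (Ordinal.ToType.mk.symm y).2
    have hrinj : Function.Injective r := fun y y' h =>
      Ordinal.ToType.mk.symm.injective (Subtype.ext h)
    have key : (Set.univ : Set (x.out → c.ord.ToType)) ⊆
        ⋃ b : c.ord.ToType, {f | ∀ i, r (f i) < r b} := by
      intro f _
      have h1 : ⨆ i, Order.succ (r (f i)) < c.ord :=
        Ordinal.iSup_lt_of_lt_cof (by rw [hreg.cof_ord]; simpa using hx) fun i =>
          (Cardinal.isSuccLimit_ord hreg.aleph0_le).succ_lt (hr _)
      refine Set.mem_iUnion.2 ⟨Ordinal.ToType.mk ⟨_, h1⟩, fun i => ?_⟩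
      have h2 : r (Ordinal.ToType.mk ⟨_, h1⟩) = ⨆ i, Order.succ (r (f i)) := by simp [r]
      rw [h2, ← Order.succ_le_iff]
      exact Ordinal.le_iSup (fun i => Order.succ (r (f i))) i
    have h1 : c ^ x = Cardinal.mk (Set.univ : Set (x.out → c.ord.ToType)) := by simp
    rw [h1]
    refine (Cardinal.mk_le_mk_of_subset key).trans ((Cardinal.mk_iUnion_le _).trans ?_)
    rw [Cardinal.mk_toType, Cardinal.card_ord]
    refine (mul_le_mul_right (ciSup_le' fun b => ?_) c).trans
      (Cardinal.mul_eq_self hc.aleph0_lt.le).le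
    have h2 : Cardinal.mk {y // r y < r b} ≤ (r b).card := by
      have : Cardinal.lift.{u + 1} (Cardinal.mk {y // r y < r b}) ≤
          Cardinal.lift.{u} (Cardinal.mk (Set.Iio (r b))) :=
        Cardinal.mk_le_of_injective (f := fun y => ULift.up (⟨r (ULift.down y).1, (ULift.down y).2⟩ : Set.Iio (r b)))
          fun y y' h => by
            have := congrArg (fun z => (ULift.down z).1) h
            exact ULift.ext _ _ (Subtype.ext (hrinj this))
      rw [Cardinal.mk_Iio_ordinal, Cardinal.lift_lift] at this
      exact Cardinal.lift_le.1 this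
    have h3 : Cardinal.mk {f : x.out → c.ord.ToType | ∀ i, r (f i) < r b} ≤ (r b).card ^ x := by
      refine le_trans (Cardinal.mk_le_of_injective
        (f := fun f : {f : x.out → c.ord.ToType | ∀ i, r (f i) < r b} => fun i =>
          (⟨f.1 i, f.2 i⟩ : {y // r y < r b})) fun f f' h => Subtype.ext (funext fun i =>
            congrArg Subtype.val (congrFun h i))) ?_
      rw [← Cardinal.power_def, Cardinal.mk_out]
      exact Cardinal.power_le_power_right h2
    have hb : (r b).card < c := Cardinal.lt_ord.1 (hr b)
    refine h3.trans ((Cardinal.power_le_power_right (Cardinal.cantor _).le).trans ?_)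
    rw [← Cardinal.power_mul]
    exact (hc.isStrongPrelimit (Cardinal.mul_lt_of_lt hc.aleph0_lt.le hb hx)).le
  · have := Cardinal.le_powerlt c (Cardinal.one_lt_aleph0.trans hc.aleph0_lt)
    simpa using this

/-! ### The judge's play from the decision property -/

theorem mem_unionSeq {γ : Ordinal.{u}} {f : Ordinal.{u} → ZFSet.{u}} {x : ZFSet.{u}} :
    x ∈ unionSeq γ f ↔ ∃ i < γ, x ∈ f i := by
  simp [unionSeq]

theorem card_cardSet (κ : Cardinal.{u}) : (cardSet κ).card = κ := by
  rw [cardSet, Ordinal.card_toZFSet, Cardinal.card_ord]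

theorem card_eq_of_unbounded {κ : Cardinal.{u}} (hκ : κ.IsRegular) {s : ZFSet.{u}}
    (hs : s ⊆ cardSet κ)
    (h : ∀ δ < κ.ord, ∃ β < κ.ord, δ < β ∧ β.toZFSet ∈ s) : s.card = κ := by
  refine le_antisymm ((ZFSet.card_mono hs).trans (card_cardSet κ).le) ?_
  let t : Set (Set.Iio κ.ord) := {b | b.1.toZFSet ∈ s}
  have ht : IsCofinal t := fun δ => by
    obtain ⟨β, hβ, h1, h2⟩ := h δ.1 δ.2
    exact ⟨⟨β, hβ⟩, h2, h1.le⟩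
  have h1 := Order.cof_le ht
  rw [Ordinal.cof_Iio, ← Ordinal.lift_cof, hκ.cof_ord] at h1
  rw [← Cardinal.lift_le.{u + 1}, ← ZFSet.cardinalMk_coe_sort]
  refine h1.trans (Cardinal.mk_le_of_injective (f := fun b : t => (⟨b.1.1.toZFSet, b.2⟩ : s))
    fun b b' hb => ?_)
  exact Subtype.ext (Subtype.ext (Ordinal.toZFSet_injective (congrArg Subtype.val hb)))

theorem IsFunOn.unique {d f x y y' : ZFSet.{u}} (hf : IsFunOn d f) (h : ZFSet.pair x y ∈ f)
    (h' : ZFSet.pair x y' ∈ f) : y = y' := by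
  obtain ⟨Y, h1, h2⟩ := hf
  exact (h2 x (ZFSet.pair_mem_prod.1 (h1 h)).1).unique h h'

theorem IsFunOn.exists_pair_mem {d f x : ZFSet.{u}} (hf : IsFunOn d f) (h : x ∈ d) :
    ∃ y, ZFSet.pair x y ∈ f := by
  obtain ⟨Y, h1, h2⟩ := hf
  exact (h2 x h).exists

theorem ElemSub.ultSet_mem {θ κ : Cardinal.{u}} {M : Set ZFSet.{u}} (h : ElemSub M (HSet θ))
    (hκ : cardSet κ ∈ M) {f g : ZFSet.{u}} (hf : f ∈ M) (hg : g ∈ M) :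
    ZFSet.sep (fun α => ∃ x y, ZFSet.pair α x ∈ f ∧ ZFSet.pair α y ∈ g ∧ x ∈ y) (cardSet κ) ∈ M := by
  have h1 := h.sep_mem (R := fun _ v α => ∃ x, ZFSet.pair α x ∈ v 0 ∧ ∃ y, ZFSet.pair α y ∈ v 1 ∧
    x ∈ y) (.ex_pair_mem _ _ (.ex_pair_mem _ _ (.mem _ _))) ![f, g]
    (by simp [Fin.forall_fin_succ, hf, hg]) hκ
  refine Eq.subst (motive := (· ∈ M)) ?_ h1
  ext z
  rw [ZFSet.mem_sep, ZFSet.mem_sep]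
  refine and_congr_right fun _ => ⟨?_, ?_⟩
  · rintro ⟨x, hx, y, hy, hxy⟩
    exact ⟨x, y, hx, hy, hxy⟩
  · rintro ⟨x, y, hx, hy, hxy⟩
    exact ⟨x, hx, y, hy, hxy⟩

/-- A descending sequence in the ultrapower yields countably many sets in `F`; at a common element,
the values of the functions would descend in `∈`. -/
theorem wfUltrapower_of_forall_seq {κ : Cardinal.{u}} {M F : ZFSet.{u}}
    (hM : ∀ f ∈ M, ∀ g ∈ M, ZFSet.sep (fun α => ∃ x y, ZFSet.pair α x ∈ f ∧ ZFSet.pair α y ∈ g ∧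
      x ∈ y) (cardSet κ) ∈ M)
    (h : ∀ S : ℕ → ZFSet.{u}, (∀ n, S n ∈ M) → (∀ n, S n ∈ F) → ∃ β, ∀ n, β ∈ S n) :
    WfUltrapower κ M F := by
  rw [WfUltrapower, wellFounded_iff_isEmpty_descending_chain]
  refine ⟨fun ⟨f, hf⟩ => ?_⟩
  obtain ⟨β, hβ⟩ := h _ (fun n => hM _ (f (n + 1)).2.1 _ (f n).2.1) hf
  have h1 := fun n => (ZFSet.mem_sep.1 (hβ n)).2
  choose x y hx hy hxy using h1
  have h2 : ∀ n, y (n + 1) = x n := fun n => (f (n + 1)).2.2.unique (hy (n + 1)) (hx n)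
  have h3 : IsEmpty {v : ℕ → ZFSet.{u} // ∀ n, v (n + 1) ∈ v n} :=
    wellFounded_iff_isEmpty_descending_chain.1 ZFSet.mem_wf
  exact h3.elim ⟨y, fun n => by rw [h2]; exact hxy n⟩

/-- A list of the subsets of `κ` that belong to `M`. -/
theorem exists_subset_enum (κ : Cardinal.{u}) (M : ZFSet.{u}) :
    ∃ g : Ordinal.{u} → ZFSet.{u}, (∀ i, g i ⊆ cardSet κ) ∧
      (M.card ≤ κ → ∀ A ∈ M, A ⊆ cardSet κ → ∃ i < κ.ord, g i = A) := by
  by_cases hne : ({A | A ∈ M ∧ A ⊆ cardSet κ} : Set ZFSet.{u}).Nonempty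
  · by_cases hM : M.card ≤ κ
    · obtain ⟨g, h1, h2⟩ := exists_enum (κ := κ) hne (by
        refine (Cardinal.mk_le_mk_of_subset fun A hA => hA.1).trans (card_le_iff.1 hM))
      exact ⟨g, fun i => (h1 i).2, fun _ A hA hA' => h2 A ⟨hA, hA'⟩⟩
    · exact ⟨fun _ => ∅, fun _ => ZFSet.empty_subset _, fun h => absurd h hM⟩
  · exact ⟨fun _ => ∅, fun _ => ZFSet.empty_subset _, fun _ A hA hA' => absurd ⟨A, hA, hA'⟩ hne⟩

/-- If all diagonal intersections of members of a family are unbounded, then finite intersections of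
members have full size. -/
theorem isFilterOn_of_diagonal {κ : Cardinal.{u}} (hκ : κ.IsRegular) {𝓕 : Set ZFSet.{u}}
    (hne : 𝓕.Nonempty)
    (hdiag : ∀ X : Ordinal.{u} → ZFSet.{u}, (∀ i, X i ∈ 𝓕) → ∀ δ < κ.ord,
      ∃ β < κ.ord, δ < β ∧ ∀ i < β, β.toZFSet ∈ X i) {F : ZFSet.{u}} (hF : ∀ A ∈ F, A ∈ 𝓕)
    (hsub : ∀ A ∈ F, A ⊆ cardSet κ) : IsFilterOn κ F := by
  classical
  refine ⟨hsub, fun n A hA => card_eq_of_unbounded hκ ZFSet.sep_subset fun δ hδ => ?_⟩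
  obtain ⟨A₀, hA₀⟩ := hne
  have hn : (n : Ordinal.{u}) < κ.ord := (Ordinal.natCast_lt_omega0 n).trans_le
    (Cardinal.ord_aleph0 ▸ Cardinal.ord_le_ord.2 hκ.aleph0_le)
  -- The given sets are put at the indices below `n`, with `A₀` as padding, and `β` is taken above
  -- `n`.
  obtain ⟨β, hβ, h1, h2⟩ := hdiag (fun i => if h : ∃ k : Fin n, (k.1 : Ordinal.{u}) = i then
    A h.choose else A₀) (fun i => by
      split_ifs with h
      · exact hF _ (hA _)
      · exact hA₀) (max δ n) (max_lt hδ hn)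
  refine ⟨β, hβ, (le_max_left _ _).trans_lt h1, ZFSet.mem_sep.2 ⟨toZFSet_mem_cardSet.2 hβ,
    fun k => ?_⟩⟩
  have h3 := h2 (k.1 : Ordinal.{u}) (lt_of_lt_of_le (Nat.cast_lt.2 k.2)
    ((le_max_right _ _).trans h1.le))
  have h4 : ∃ k' : Fin n, (k'.1 : Ordinal.{u}) = (k.1 : Ordinal.{u}) := ⟨k, rfl⟩
  rw [dif_pos h4] at h3
  have h5 : h4.choose = k := Fin.ext (Nat.cast_injective h4.choose_spec)
  rwa [h5] at h3

/-- A judge's play with unbounded diagonal intersections. -/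
theorem DecisionProperty.exists_run {κ θ : Cardinal.{u}} {γ : Ordinal.{u}}
    (h : DecisionProperty γ κ.ord) (hγ : 0 < γ) (hκ : κ.IsRegular) (hκ' : Cardinal.aleph0 < κ)
    (σ : Strategy.{u})
    (hσ : ∀ F : Ordinal.{u} → ZFSet.{u}, ∀ α < γ, (∀ β < α, JudgeLegal κ (σ.play F) F β) →
      ChallengerLegal κ θ (σ.play F) F α) :
    ∃ F : Ordinal.{u} → ZFSet.{u}, (∀ α < γ, JudgeLegal κ (σ.play F) F α) ∧
      JudgeWins True κ γ (σ.play F) F := by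
  classical
  choose en hen1 hen2 using exists_subset_enum κ
  -- `(ξ, k) ∈ Z` accepts the `k`-th subset of `κ` in the model of stage `ξ`; otherwise the
  -- complement is accepted.
  let dec : Set (Ordinal.{u} × Ordinal.{u}) → Ordinal.{u} → ZFSet.{u} → Ordinal.{u} → ZFSet.{u} :=
    fun Z ξ M k => if (ξ, k) ∈ Z then en M k else cardSet κ \ en M k
  -- Every set of decisions determines a complete run against `σ`.
  have hrec : ∀ Z : Set (Ordinal.{u} × Ordinal.{u}), ∃ F : Ordinal.{u} → ZFSet.{u}, ∀ ξ, F ξ =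
      unionSeq ξ F ∪ ZFSet.range fun k : Set.Iio κ.ord => dec Z ξ (σ.play F ξ) k.1 := by
    intro Z
    obtain ⟨F, hF⟩ := exists_recursive fun ξ F => unionSeq ξ F ∪
      ZFSet.range fun k : Set.Iio κ.ord => dec Z ξ (σ.play F ξ) k.1
    refine ⟨F, fun ξ => ?_⟩
    rw [hF ξ]
    have h1 : unionSeq ξ (fun η => if η < ξ then F η else default) = unionSeq ξ F := by
      ext x
      simp only [mem_unionSeq]
      exact exists_congr fun i => and_congr_right fun hi => by rw [if_pos hi]
    have h2 : σ.play (fun η => if η < ξ then F η else default) ξ = σ.play F ξ := by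
      unfold Strategy.play
      congr 1
      funext β
      exact if_pos β.2
    rw [h1, h2]
  choose F hF using hrec
  -- The run before `ξ` depends only on the decisions before `ξ`, so the model of stage `ξ` can be
  -- computed from those, as the decision property demands.
  have hlocal : ∀ Z Z' : Set (Ordinal.{u} × Ordinal.{u}), ∀ ξ, (∀ p : Ordinal.{u} × Ordinal.{u},
      p.1 < ξ → (p ∈ Z ↔ p ∈ Z')) → ∀ η < ξ, F Z η = F Z' η := by
    intro Z Z' ξ hZ η
    induction η using WellFoundedLT.induction with
    | _ η ih =>
      intro hη
      have h1 : unionSeq η (F Z) = unionSeq η (F Z') := by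
        ext x
        simp only [mem_unionSeq]
        exact exists_congr fun i => and_congr_right fun hi => by rw [ih i hi (hi.trans hη)]
      have h2 : σ.play (F Z) η = σ.play (F Z') η := by
        unfold Strategy.play
        congr 1
        funext β
        exact ih β.1 β.2 (lt_trans β.2 hη)
      have h3 : ∀ k, ((η, k) ∈ Z ↔ (η, k) ∈ Z') := fun k => hZ _ hη
      rw [hF Z, hF Z', h1, h2]
      simp only [dec, h3]
  obtain ⟨Z, hZ⟩ := h fun ξ k β S => β.toZFSet ∈ en (σ.play (F S) ξ) k
  have hplay : ∀ ξ, σ.play (F {p ∈ Z | p.1 < ξ}) ξ = σ.play (F Z) ξ := by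
    intro ξ
    unfold Strategy.play
    congr 1
    funext β
    exact hlocal {p ∈ Z | p.1 < ξ} Z ξ (fun p hp => ⟨fun h => h.1, fun h => ⟨h, hp⟩⟩) β.1 β.2
  set M := σ.play (F Z) with hM
  have hmemF : ∀ ξ A, A ∈ F Z ξ ↔ ∃ η ≤ ξ, ∃ k < κ.ord, A = dec Z η (M η) k := by
    intro ξ
    induction ξ using WellFoundedLT.induction with
    | _ ξ ih =>
      intro A
      rw [hF Z ξ, ZFSet.mem_union, mem_unionSeq, ZFSet.mem_range]
      constructor
      · rintro (⟨i, hi, hA⟩ | ⟨k, rfl⟩)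
        · obtain ⟨η, hη, k, hk, rfl⟩ := (ih i hi A).1 hA
          exact ⟨η, hη.trans hi.le, k, hk, rfl⟩
        · exact ⟨ξ, le_rfl, k.1, k.2, rfl⟩
      · rintro ⟨η, hη, k, hk, rfl⟩
        rcases hη.eq_or_lt with rfl | hη
        · exact Or.inr ⟨⟨k, hk⟩, rfl⟩
        · exact Or.inl ⟨η, hη, (ih η hη _).2 ⟨η, le_rfl, k, hk, rfl⟩⟩
  let 𝓕 : Set ZFSet.{u} := {A | ∃ η < γ, ∃ k < κ.ord, A = dec Z η (M η) k}
  have hF𝓕 : ∀ ξ < γ, ∀ A ∈ F Z ξ, A ∈ 𝓕 := fun ξ hξ A hA => by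
    obtain ⟨η, hη, k, hk, rfl⟩ := (hmemF ξ A).1 hA
    exact ⟨η, hη.trans_lt hξ, k, hk, rfl⟩
  have h𝓕 : ∀ A, A ∈ unionSeq γ (F Z) ↔ A ∈ 𝓕 := by
    intro A
    rw [mem_unionSeq]
    constructor
    · rintro ⟨i, hi, hA⟩
      exact hF𝓕 i hi A hA
    · rintro ⟨η, hη, k, hk, rfl⟩
      exact ⟨η, hη, (hmemF _ _).2 ⟨η, le_rfl, k, hk, rfl⟩⟩
  have hsub : ∀ A ∈ 𝓕, A ⊆ cardSet κ := by
    rintro A ⟨η, _, k, _, rfl⟩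
    dsimp only [dec]
    split_ifs
    · exact hen1 _ _
    · exact fun x hx => (ZFSet.mem_sdiff.1 hx).1
  have hdiag : ∀ X : Ordinal.{u} → ZFSet.{u}, (∀ i, X i ∈ 𝓕) → ∀ δ < κ.ord,
      ∃ β < κ.ord, δ < β ∧ ∀ i < β, β.toZFSet ∈ X i := by
    intro X hX δ hδ
    choose h₁ hh₁ h₂ hh₂ hX' using hX
    obtain ⟨β, hβ, hδβ, hβ'⟩ := hZ h₁ h₂ (fun i _ => hh₁ i) (fun i _ => hh₂ i) δ hδ
    refine ⟨β, hβ, hδβ, fun i hi => ?_⟩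
    have h1 := hβ' i hi
    rw [hplay] at h1
    rw [hX']
    dsimp only [dec]
    split_ifs with hz
    · exact h1.2 hz
    · exact ZFSet.mem_sdiff.2 ⟨toZFSet_mem_cardSet.2 hβ, fun h => hz (h1.1 h)⟩
  have hpos : 0 < κ.ord := hκ.ord_pos
  have hne : 𝓕.Nonempty := ⟨_, 0, hγ, 0, hpos, rfl⟩
  have hω : Ordinal.omega0 < κ.ord := by
    rwa [← Cardinal.ord_aleph0, Cardinal.ord_lt_ord]
  -- Induction is needed since `σ` is known to be legal only against a legal judge, and only a model
  -- of size `κ` has all its subsets of `κ` listed by `en`.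
  have hlegal : ∀ α < γ, JudgeLegal κ M (F Z) α := by
    intro α
    induction α using WellFoundedLT.induction with
    | _ α ih =>
      intro hα
      have hch := hσ (F Z) α hα fun β hβ => ih β hβ (hβ.trans hα)
      refine ⟨isFilterOn_of_diagonal hκ hne hdiag (hF𝓕 α hα) fun A hA => hsub A (hF𝓕 α hα A hA),
        fun A hA hAK => ?_, fun β hβ A hA => ?_⟩
      · obtain ⟨k, hk, rfl⟩ := hen2 (M α) hch.model.card_eq.le A hA hAK
        by_cases hz : (α, k) ∈ Z
        · exact Or.inl ((hmemF _ _).2 ⟨α, le_rfl, k, hk, (if_pos hz).symm⟩)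
        · exact Or.inr ((hmemF _ _).2 ⟨α, le_rfl, k, hk, (if_neg hz).symm⟩)
      · obtain ⟨η, hη, k, hk, rfl⟩ := (hmemF β A).1 hA
        exact (hmemF α _).2 ⟨η, hη.trans hβ.le, k, hk, rfl⟩
  refine ⟨F Z, hlegal, ⟨isFilterOn_of_diagonal hκ hne hdiag (fun A hA => (h𝓕 A).1 hA) fun A hA =>
    hsub A ((h𝓕 A).1 hA), fun A hA hAK => ?_, fun X hX hXf hXF => ?_⟩, fun _ => ?_⟩
  · obtain ⟨i, hi, hA⟩ := mem_unionSeq.1 hA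
    rcases (hlegal i hi).measures A hA hAK with h1 | h1
    · exact Or.inl (mem_unionSeq.2 ⟨i, hi, h1⟩)
    · exact Or.inr (mem_unionSeq.2 ⟨i, hi, h1⟩)
  · obtain ⟨ξ, hξ, hX⟩ := mem_unionSeq.1 hX
    have hch := hσ (F Z) ξ hξ fun β hβ => hlegal β (hβ.trans hξ)
    have hD : diagInter κ X ∈ M ξ := hch.elem.sep_mem
      (R := fun _ v β => ∀ α ∈ β, ∀ A, ZFSet.pair α A ∈ v 0 → β ∈ A)
      (.ball _ (.all_pair_mem _ _ (.mem _ _))) ![X] (by simpa using hX) hch.model.mem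
    rcases (hlegal ξ hξ).measures _ hD ZFSet.sep_subset with h1 | h1
    · exact mem_unionSeq.2 ⟨ξ, hξ, h1⟩
    · exfalso
      have hval : ∀ i : Ordinal.{u}, ∃ A, (i < κ.ord → ZFSet.pair i.toZFSet A ∈ X) ∧ A ∈ 𝓕 := by
        intro i
        by_cases hi : i < κ.ord
        · obtain ⟨A, hA⟩ := hXf.exists_pair_mem (toZFSet_mem_cardSet.2 hi)
          exact ⟨A, fun _ => hA, (h𝓕 A).1 (hXF _ _ hA)⟩
        · exact ⟨_, fun h => absurd h hi, hne.some_mem⟩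
      choose V hV1 hV2 using hval
      -- The complement of the diagonal intersection is put at index 0 and the members of `X` are
      -- shifted by one. For infinite `β` the shift is harmless, so `β` lies in the diagonal
      -- intersection and in its complement.
      obtain ⟨β, hβ, h2, h3⟩ := hdiag (fun i => if i = 0 then cardSet κ \ diagInter κ X else V (i - 1))
        (fun i => by
          split_ifs
          · exact hF𝓕 ξ hξ _ h1
          · exact hV2 _) _ hω
      have h4 := h3 0 (Ordinal.omega0_pos.trans h2)
      rw [if_pos rfl] at h4
      refine (ZFSet.mem_sdiff.1 h4).2 (ZFSet.mem_sep.2 ⟨toZFSet_mem_cardSet.2 hβ, ?_⟩)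
      intro i hi A hA
      obtain ⟨i, hi', rfl⟩ := Ordinal.mem_toZFSet_iff.1 hi
      have h5 : 1 + i < β := by
        have : 1 + i < 1 + β := (add_lt_add_iff_left 1).2 hi'
        rwa [Ordinal.one_add_of_omega0_le h2.le] at this
      have h6 := h3 (1 + i) h5
      rw [if_neg (by simp), Ordinal.add_sub_cancel] at h6
      rwa [hXf.unique hA (hV1 i (hi'.trans hβ))]
  · refine wfUltrapower_of_forall_seq (fun f hf g hg => ?_) fun S _ hS => ?_
    · obtain ⟨i, hi, hf⟩ := mem_unionSeq.1 hf
      obtain ⟨k, hk, hg⟩ := mem_unionSeq.1 hg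
      have hch := hσ (F Z) _ (max_lt hi hk) fun β hβ => hlegal β (hβ.trans (max_lt hi hk))
      have hsub : ∀ l ≤ max i k, M l ⊆ M (max i k) := fun l hl x hx => by
        rcases hl.eq_or_lt with h | h
        · exact h ▸ hx
        · exact hch.mono l h hx
      exact mem_unionSeq.2 ⟨_, max_lt hi hk, hch.elem.ultSet_mem hch.model.mem
        (hsub i (le_max_left _ _) hf) (hsub k (le_max_right _ _) hg)⟩
    -- Countably many sets at the finite indices: any `β` above `ω` lies in all of them.
    obtain ⟨β, hβ, h2, h3⟩ := hdiag (fun i => if h : ∃ n : ℕ, (n : Ordinal.{u}) = i then S h.choose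
      else S 0) (fun i => by
        split_ifs with h
        · exact (h𝓕 _).1 (hS _)
        · exact (h𝓕 _).1 (hS _)) _ hω
    refine ⟨β.toZFSet, fun n => ?_⟩
    have h4 := h3 (n : Ordinal.{u}) ((Ordinal.natCast_lt_omega0 n).trans h2)
    have h5 : ∃ m : ℕ, (m : Ordinal.{u}) = n := ⟨n, rfl⟩
    rw [dif_pos h5] at h4
    rwa [Nat.cast_injective h5.choose_spec] at h4

/-- The decision property implies the filter property for all `θ`. -/
theorem DecisionProperty.filterProperty {κ : Cardinal.{u}} {γ : Ordinal.{u}}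
    (h : DecisionProperty γ κ.ord) (hγ : 0 < γ) (hκ : κ.IsInaccessible) (U : Set ZFSet.{u})
    (wf : Prop) : FilterPropertyIn U wf γ κ := by
  refine ⟨hκ.aleph0_lt, hκ.isRegular, powerlt_self_of_isInaccessible hκ, ?_⟩
  rintro θ _ _ _ ⟨σ, hσ⟩
  obtain ⟨F, h1, h2⟩ := h.exists_run hγ hκ.isRegular hκ.aleph0_lt σ fun F => (hσ F).1
  exact (hσ F).2 h1 ⟨h2.1, fun _ => h2.2 trivial⟩

/-! ### Elementary substructures of `H(θ)` satisfy `ZFC⁻` -/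

section

variable {θ : Cardinal.{u}} {M : Set ZFSet.{u}}

/-- `M` need not be transitive, but elementarity finds a difference of two members of `M` inside
`M`. -/
theorem ElemSub.ext (h : ElemSub M (HSet θ)) {x y : ZFSet.{u}} (hx : x ∈ M) (hy : y ∈ M)
    (hxy : ∀ z ∈ M, z ∈ x ↔ z ∈ y) : x = y := by
  have h1 := h.subset_of_forall hx hy fun z hz => (hxy z hz).1
  have h2 := h.subset_of_forall hy hx fun z hz => (hxy z hz).2
  ext z
  exact ⟨fun h => h1 h, fun h => h2 h⟩

theorem ElemSub.pairIn_iff (h : ElemSub M (HSet θ)) (hθ : θ.IsRegular) {p x y : M} :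
    PairIn p x y ↔ p.1 = ZFSet.pair x.1 y.1 := by
  have hsx : ({x.1} : ZFSet.{u}) ∈ M := by
    rw [← ZFSet.pair_eq_singleton]
    exact h.upair_mem hθ x.2 x.2
  have hxy := h.upair_mem hθ x.2 y.2
  constructor
  · rintro ⟨s, t, hs, ht, hp⟩
    have h1 : s.1 = {x.1} := h.ext s.2 hsx fun z hz => by
      rw [ZFSet.mem_singleton, hs ⟨z, hz⟩, Subtype.ext_iff]
    have h2 : t.1 = {x.1, y.1} := h.ext t.2 hxy fun z hz => by
      rw [ZFSet.mem_pair, ht ⟨z, hz⟩, Subtype.ext_iff, Subtype.ext_iff]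
    have h3 : p.1 = {s.1, t.1} := h.ext p.2 (h.upair_mem hθ s.2 t.2) fun z hz => by
      rw [ZFSet.mem_pair, hp ⟨z, hz⟩, Subtype.ext_iff, Subtype.ext_iff]
    rw [h3, h1, h2, ZFSet.pair]
  · intro hp
    refine ⟨⟨_, hsx⟩, ⟨_, hxy⟩, fun w => ?_, fun w => ?_, fun w => ?_⟩
    · rw [Subtype.ext_iff]; exact ZFSet.mem_singleton
    · rw [Subtype.ext_iff, Subtype.ext_iff]; exact ZFSet.mem_pair
    · rw [Subtype.ext_iff, Subtype.ext_iff, hp]; exact ZFSet.mem_pair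

theorem ElemSub.relIn_iff (h : ElemSub M (HSet θ)) (hθ : θ.IsRegular) {r x y : M} :
    RelIn r x y ↔ ZFSet.pair x.1 y.1 ∈ r.1 := by
  constructor
  · rintro ⟨p, hp, hxy⟩
    rwa [← (h.pairIn_iff hθ).1 hxy]
  · intro hp
    exact ⟨⟨_, h.pair_mem hθ x.2 y.2⟩, hp, (h.pairIn_iff hθ).2 rfl⟩

/-- Emptiness is written as `∀ z ∈ e, ¬ z = z`, to stay within the combinators of `Dfn`. -/
theorem exists_infinite_mem_hset (hω : Cardinal.aleph0 < θ) : ∃ x ∈ HSet θ,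
    (∃ e ∈ x, ∀ z ∈ e, ¬ z = z) ∧
      ∀ y ∈ x, ∃ s ∈ x, (∀ w ∈ s, w ∈ y ∨ w = y) ∧ y ∈ s ∧ ∀ w ∈ y, w ∈ s := by
  refine ⟨Ordinal.omega0.toZFSet, toZFSet_mem_hset ?_, ⟨Ordinal.toZFSet 0, ?_, ?_⟩, ?_⟩
  · rwa [← Cardinal.ord_aleph0, Cardinal.ord_lt_ord]
  · exact Ordinal.toZFSet_mem_toZFSet_iff.2 Ordinal.omega0_pos
  · simp
  · intro y hy
    obtain ⟨n, hn, rfl⟩ := Ordinal.mem_toZFSet_iff.1 hy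
    refine ⟨(n + 1).toZFSet, Ordinal.toZFSet_mem_toZFSet_iff.2
      (Ordinal.isSuccLimit_omega0.add_one_lt hn), ?_, ?_, ?_⟩ <;> rw [Ordinal.toZFSet_add_one]
    · intro w hw
      exact (ZFSet.mem_insert_iff.1 hw).symm
    · exact ZFSet.mem_insert _ _
    · exact fun w hw => ZFSet.mem_insert_of_mem _ hw

theorem exists_wellOrder_mem_hset (hθ : θ.IsRegular) {a : ZFSet.{u}} (ha : a ∈ HSet θ) :
    ∃ r ∈ HSet θ, (∀ x ∈ a, ¬ ZFSet.pair x x ∈ r) ∧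
      (∀ x ∈ a, ∀ y ∈ a, ∀ z ∈ a, ZFSet.pair x y ∈ r → ZFSet.pair y z ∈ r → ZFSet.pair x z ∈ r) ∧
      (∀ x ∈ a, ∀ y ∈ a, x = y ∨ ZFSet.pair x y ∈ r ∨ ZFSet.pair y x ∈ r) ∧
      ∀ b ∈ HSet θ, (∃ x ∈ b, x ∈ b) → b ⊆ a → ∃ x ∈ b, ∀ y ∈ b, y = x ∨ ZFSet.pair x y ∈ r := by
  let r : ZFSet.{u} := ZFSet.sep (fun p => ∃ x y, WellOrderingRel x y ∧ p = ZFSet.pair x y)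
    (ZFSet.prod a a)
  have hr : ∀ {x y}, x ∈ a → y ∈ a → (ZFSet.pair x y ∈ r ↔ WellOrderingRel x y) := by
    intro x y hx hy
    simp only [r, ZFSet.mem_sep, ZFSet.pair_mem_prod, ZFSet.pair_inj]
    constructor
    · rintro ⟨_, x', y', h, rfl, rfl⟩
      exact h
    · exact fun h => ⟨⟨hx, hy⟩, x, y, h, rfl, rfl⟩
  refine ⟨r, hset_subset (prod_mem_hset hθ ha ha) ZFSet.sep_subset, fun x hx => ?_,
    fun x hx y hy z hz => ?_, fun x hx y hy => ?_, fun b _ hne hb => ?_⟩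
  · rw [hr hx hx]
    exact irrefl x
  · rw [hr hx hy, hr hy hz, hr hx hz]
    exact _root_.trans
  · rw [hr hx hy, hr hy hx]
    rcases trichotomous_of WellOrderingRel x y with h | h | h
    exacts [Or.inr (Or.inl h), Or.inl h, Or.inr (Or.inr h)]
  · have hwf : WellFounded (WellOrderingRel (α := ZFSet.{u})) := IsWellFounded.wf
    obtain ⟨x, hx, _⟩ := hne
    obtain ⟨m, hm, hmin⟩ := hwf.has_min (b : Set ZFSet.{u}) ⟨x, hx⟩
    refine ⟨m, hm, fun y hy => ?_⟩
    rw [hr (hb hm) (hb hy)]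
    rcases trichotomous_of WellOrderingRel m y with h | h | h
    exacts [Or.inr h, Or.inl h.symm, absurd h (hmin y hy)]

theorem Dfn.realize_cons {n : ℕ} (φ : setLang.Formula (Fin (n + 1))) :
    Dfn fun (S : Set ZFSet.{u}) (w : Fin (n + 1) → ZFSet.{u}) =>
      ∃ h : ∀ i, (Fin.cons (w 0) (Fin.tail w) : Fin (n + 1) → ZFSet.{u}) i ∈ S,
        φ.Realize fun i => (⟨_, h i⟩ : S) := by
  simpa using Dfn.realize φ

/-- For each existence axiom, a witness in `H(θ)` is pulled into `M`. In the schemes, a formula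
evaluated in `M` is replaced by its evaluation in `H(θ)`. -/
theorem ElemSub.modelsZFCMinus (h : ElemSub M (HSet θ)) (hθ : θ.IsRegular)
    (hω : Cardinal.aleph0 < θ) : ModelsZFCMinus M where
  extensionality x y hxy := Subtype.ext (h.ext x.2 y.2 fun z hz => hxy ⟨z, hz⟩)
  foundation x := by
    rintro ⟨y, hy⟩
    obtain ⟨m, ⟨hm1, hm2⟩, hmin⟩ := ZFSet.mem_wf.has_min {z | z ∈ M ∧ z ∈ x.1} ⟨y, y.2, hy⟩
    exact ⟨⟨m, hm1⟩, hm2, fun z hz hzm => hmin z ⟨z.2, hz⟩ hzm⟩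
  pairing x y := ⟨⟨_, h.upair_mem hθ x.2 y.2⟩, fun w => by
    rw [Subtype.ext_iff, Subtype.ext_iff]
    exact ZFSet.mem_pair⟩
  union x := by
    have hU : ZFSet.sUnion x.1 ∈ HSet θ := by
      obtain ⟨t, ht, hxt, hc⟩ := h.subset x.2
      refine ⟨t, ht, fun z hz => ?_, hc⟩
      obtain ⟨y, hy, hz⟩ := ZFSet.mem_sUnion.1 hz
      exact ht y (hxt hy) hz
    have hUM : ZFSet.sUnion x.1 ∈ M := h.mem_of_unique
      (R := fun _ v z => (∀ w ∈ z, ∃ y ∈ v 0, w ∈ y) ∧ ∀ y ∈ v 0, ∀ w ∈ y, w ∈ z)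
      (.and (.ball _ (.bex _ (.mem _ _))) (.ball _ (.ball _ (.mem _ _)))) ![x.1] (by simp) hU
      ⟨fun w hw => ZFSet.mem_sUnion.1 hw, fun y hy w hw => ZFSet.mem_sUnion.2 ⟨y, hy, hw⟩⟩ (by
        rintro b _ ⟨h1, h2⟩
        ext w
        rw [ZFSet.mem_sUnion]
        exact ⟨h1 w, fun ⟨y, hy, hw⟩ => h2 y hy w hw⟩)
    refine ⟨⟨_, hUM⟩, fun w => ?_⟩
    rw [ZFSet.mem_sUnion]
    constructor
    · rintro ⟨y, hy, hw⟩
      obtain ⟨y', hy', h1, h2⟩ := h.exists_mem transClass_hset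
        (R := fun _ v y => y ∈ v 0 ∧ v 1 ∈ y) (.and (.mem _ _) (.mem _ _)) ![x.1, w.1]
        (by simp [Fin.forall_fin_succ]) ⟨y, hset_trans (h.subset x.2) hy, hy, hw⟩
      exact ⟨⟨y', hy'⟩, h1, h2⟩
    · rintro ⟨y, hy, hw⟩
      exact ⟨y.1, hy, hw⟩
  infinity := by
    obtain ⟨x, hx, ⟨e, he1, he2⟩, h2⟩ := h.exists_mem transClass_hset (n := 0)
      (R := fun _ _ x => (∃ e ∈ x, ∀ z ∈ e, ¬ z = z) ∧
        ∀ y ∈ x, ∃ s ∈ x, (∀ w ∈ s, w ∈ y ∨ w = y) ∧ y ∈ s ∧ ∀ w ∈ y, w ∈ s)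
      (.and (.bex _ (.ball _ (.not (.eq _ _)))) (.ball _ (.bex _ (.and (.ball _ (.or (.mem _ _)
        (.eq _ _))) (.and (.mem _ _) (.ball _ (.mem _ _))))))) ![] (by simp)
      (exists_infinite_mem_hset hω)
    refine ⟨⟨x, hx⟩, ?_, fun y hy => ?_⟩
    · obtain ⟨e, he, h3, h4⟩ := h.exists_mem transClass_hset
        (R := fun _ v e => e ∈ v 0 ∧ ∀ z ∈ e, ¬ z = z) (.and (.mem _ _) (.ball _ (.not (.eq _ _))))
        ![x] (by simpa using hx) ⟨e, hset_trans (h.subset hx) he1, he1, he2⟩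
      exact ⟨⟨e, he⟩, h3, fun z hz => h4 _ hz rfl⟩
    · obtain ⟨s, hs, hs'⟩ := h2 y.1 hy
      obtain ⟨s, hsM, h3, h4, h5, h6⟩ := h.exists_mem transClass_hset (R := fun _ v s => s ∈ v 0 ∧
          (∀ w ∈ s, w ∈ v 1 ∨ w = v 1) ∧ v 1 ∈ s ∧ ∀ w ∈ v 1, w ∈ s)
        (.and (.mem _ _) (.and (.ball _ (.or (.mem _ _) (.eq _ _))) (.and (.mem _ _)
          (.ball _ (.mem _ _))))) ![x, y.1] (by simpa [Fin.forall_fin_succ] using hx)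
        ⟨s, hset_trans (h.subset hx) hs, hs, hs'⟩
      refine ⟨⟨s, hsM⟩, h3, fun w => ⟨fun hw => ?_, ?_⟩⟩
      · exact (h4 w hw).imp_right Subtype.ext
      · rintro (hw | rfl)
        exacts [h6 _ hw, h5]
  separation n φ p a := by
    have hb := h.sep_mem (R := fun S v x => ∃ h : ∀ i, (Fin.cons x v : Fin (n + 1) → ZFSet.{u}) i ∈ S,
      φ.Realize fun i => (⟨_, h i⟩ : S)) (Dfn.realize_cons φ) (fun i => (p i).1) (fun i => (p i).2) a.2
    refine ⟨⟨_, hb⟩, fun x => ?_⟩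
    rw [ZFSet.mem_sep]
    refine and_congr_right fun _ => ?_
    rw [← h.realize_iff φ]
    have hcons : ∀ i, (Fin.cons x.1 (fun i => (p i).1) : Fin (n + 1) → ZFSet.{u}) i =
        ((Fin.cons x p : Fin (n + 1) → M) i).1 := fun i => by
      refine Fin.cases ?_ (fun i => ?_) i <;> simp
    simp only [hcons]
    exact ⟨fun ⟨_, h⟩ => h, fun h' => ⟨fun i => h.subset (Subtype.prop _), h'⟩⟩
  collection n φ p a hφ := by
    let Q : Set ZFSet.{u} → (Fin (n + 2) → ZFSet.{u}) → Prop := fun S w =>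
      ∃ h : ∀ i, w i ∈ S, φ.Realize fun i => (⟨w i, h i⟩ : S)
    have hQ : Dfn Q := Dfn.realize φ
    have hcons : ∀ {α : Type (u + 1)} {β : Type (u + 1)} (f : α → β) (x y : α) (p : Fin n → α) i,
        (Fin.cons (f x) (Fin.cons (f y) fun i => f (p i) : Fin (n + 1) → β) : Fin (n + 2) → β) i =
        f ((Fin.cons x (Fin.cons y p : Fin (n + 1) → α) : Fin (n + 2) → α) i) := by
      intro α β f x y p i
      refine Fin.cases ?_ (fun i => Fin.cases ?_ (fun i => ?_) i) i <;> simp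
    have hQM : ∀ x y : M, Q (HSet θ) (Fin.cons x.1 (Fin.cons y.1 (fun i => (p i).1) :
        Fin (n + 1) → ZFSet.{u})) ↔
        φ.Realize (Fin.cons x (Fin.cons y p : Fin (n + 1) → M) : Fin (n + 2) → M) := by
      intro x y
      rw [← h.realize_iff φ]
      have := hcons (fun z : M => z.1) x y p
      simp only [Q, this]
      exact ⟨fun ⟨_, h⟩ => h, fun h' => ⟨fun i => h.subset (Subtype.prop _), h'⟩⟩
    have hD : Dfn fun (S : Set ZFSet.{u}) (w : Fin (n + 1 + 1) → ZFSet.{u}) => ∀ x ∈ w 1,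
        ∃ y ∈ w 0, Q S (Fin.cons x (Fin.cons y (Fin.tail (Fin.tail w)) : Fin (n + 1) → ZFSet.{u})) := by
      refine .ball _ (.bex _ ((hQ.comp (Fin.cases 1 (Fin.cases 0 fun i => i.succ.succ.succ.succ))).of_iff
        fun S _ v _ => iff_of_eq (congrArg _ (funext fun i => ?_))))
      refine Fin.cases ?_ (fun i => Fin.cases ?_ (fun i => ?_) i) i <;> rfl
    -- Totality is given only for `x` in `M`; if it failed in `H(θ)`, it would fail at some `x` in
    -- `M`.
    have hE : ∀ x ∈ a.1, ∃ y ∈ HSet θ, Q (HSet θ) (Fin.cons x (Fin.cons y (fun i => (p i).1) :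
        Fin (n + 1) → ZFSet.{u})) := by
      by_contra hcon
      push Not at hcon
      obtain ⟨x, hx, hcon⟩ := hcon
      have hD2 : Dfn fun (S : Set ZFSet.{u}) (w : Fin (n + 1 + 1) → ZFSet.{u}) => w 0 ∈ w 1 ∧
          ∀ y ∈ S, ¬ Q S (Fin.cons (w 0) (Fin.cons y (Fin.tail (Fin.tail w)) :
            Fin (n + 1) → ZFSet.{u})) := by
        refine .and (.mem _ _) (.all (.not ((hQ.comp (Fin.cases 1 (Fin.cases 0
          fun i => i.succ.succ.succ))).of_iff
          fun S _ v _ => iff_of_eq (congrArg _ (funext fun i => ?_)))))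
        refine Fin.cases ?_ (fun i => Fin.cases ?_ (fun i => ?_) i) i <;> rfl
      obtain ⟨x, hxM, hx, hcon⟩ := h.exists_mem transClass_hset (n := n + 1)
        (R := fun S v x => x ∈ v 0 ∧ ∀ y ∈ S, ¬ Q S (Fin.cons x (Fin.cons y (Fin.tail v) :
            Fin (n + 1) → ZFSet.{u}))) hD2
        (Fin.cons a.1 (fun i => (p i).1) : Fin (n + 1) → ZFSet.{u})
        (fun i => by refine Fin.cases ?_ (fun i => ?_) i <;> simp)
        ⟨x, hset_trans (h.subset a.2) hx, hx, by simpa using hcon⟩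
      obtain ⟨y, hy⟩ := hφ ⟨x, hxM⟩ hx
      exact hcon y.1 (h.subset y.2) (by simpa using (hQM ⟨x, hxM⟩ y).2 hy)
    choose! f hf1 hf2 using hE
    -- Collection in `H(θ)`: the range of a choice function on `a` has size below `θ`, which is
    -- regular.
    have hbH : ZFSet.range (fun x : Shrink.{u} a.1 => f ((equivShrink a.1).symm x).1) ∈ HSet θ := by
      refine mem_hset_of_card_lt hθ (fun y hy => ?_) ?_
      · obtain ⟨x, rfl⟩ := ZFSet.mem_range.1 hy
        exact hf1 _ ((equivShrink a.1).symm x).2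
      · have := ZFSet.lift_card_range_le (f := fun x : Shrink.{u} a.1 => f ((equivShrink a.1).symm x).1)
        rw [Cardinal.lift_id, Cardinal.lift_id] at this
        exact this.trans_lt (card_lt_of_mem_hset (h.subset a.2))
    obtain ⟨b, hb, hb'⟩ := h.exists_mem transClass_hset (n := n + 1) (R := fun S v b => ∀ x ∈ v 0,
        ∃ y ∈ b, Q S (Fin.cons x (Fin.cons y (Fin.tail v) : Fin (n + 1) → ZFSet.{u}))) hD
      (Fin.cons a.1 (fun i => (p i).1) : Fin (n + 1) → ZFSet.{u})
      (fun i => by refine Fin.cases ?_ (fun i => ?_) i <;> simp)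
      ⟨_, hbH, fun x hx => ⟨f x, ZFSet.mem_range.2 ⟨equivShrink a.1 ⟨x, hx⟩, by simp⟩, by
        simpa using hf2 x hx⟩⟩
    refine ⟨⟨b, hb⟩, fun x hx => ?_⟩
    have hD3 : Dfn fun (S : Set ZFSet.{u}) (w : Fin (n + 2 + 1) → ZFSet.{u}) => w 0 ∈ w 1 ∧
        Q S (Fin.cons (w 2) (Fin.cons (w 0) (Fin.tail (Fin.tail (Fin.tail w))) :
          Fin (n + 1) → ZFSet.{u})) := by
      refine .and (.mem _ _) ((hQ.comp (Fin.cases 2 (Fin.cases 0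
        fun i => i.succ.succ.succ))).of_iff fun S _ v _ => iff_of_eq (congrArg _ (funext fun i => ?_)))
      refine Fin.cases ?_ (fun i => Fin.cases ?_ (fun i => ?_) i) i <;> rfl
    obtain ⟨y, hy, h1, h2⟩ := h.exists_mem transClass_hset (n := n + 2) (R := fun S v y => y ∈ v 0 ∧
        Q S (Fin.cons (v 1) (Fin.cons y (Fin.tail (Fin.tail v)) : Fin (n + 1) → ZFSet.{u}))) hD3
      (Fin.cons b (Fin.cons x.1 (fun i => (p i).1) : Fin (n + 1) → ZFSet.{u}) :
        Fin (n + 2) → ZFSet.{u})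
      (fun i => by
        refine Fin.cases ?_ (fun i => Fin.cases ?_ (fun i => ?_) i) i <;> simp [hb])
      (by
        obtain ⟨y, hy, h⟩ := hb' x.1 hx
        exact ⟨y, hset_trans (ElemSub.subset ‹_› hb) hy, hy, h⟩)
    exact ⟨⟨y, hy⟩, h1, (hQM x ⟨y, hy⟩).1 h2⟩
  wellOrdering a := by
    obtain ⟨r, hr, h1, h2, h3, h4⟩ := h.exists_mem transClass_hset (R := fun S v r =>
      (∀ x ∈ v 0, ¬ ZFSet.pair x x ∈ r) ∧
      (∀ x ∈ v 0, ∀ y ∈ v 0, ∀ z ∈ v 0, ZFSet.pair x y ∈ r → ZFSet.pair y z ∈ r →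
        ZFSet.pair x z ∈ r) ∧
      (∀ x ∈ v 0, ∀ y ∈ v 0, x = y ∨ ZFSet.pair x y ∈ r ∨ ZFSet.pair y x ∈ r) ∧
      ∀ b ∈ S, (∃ x ∈ b, x ∈ b) → b ⊆ v 0 → ∃ x ∈ b, ∀ y ∈ b, y = x ∨ ZFSet.pair x y ∈ r)
      (.and (.ball _ (.not (.pair_mem _ _ _))) (.and (.ball _ (.ball _ (.ball _ (.imp (.pair_mem _ _ _)
        (.imp (.pair_mem _ _ _) (.pair_mem _ _ _)))))) (.and (.ball _ (.ball _ (.or (.eq _ _)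
        (.or (.pair_mem _ _ _) (.pair_mem _ _ _))))) (.all (.imp (.bex _ (.mem _ _))
        (.imp (.subset _ _) (.bex _ (.ball _ (.or (.eq _ _) (.pair_mem _ _ _))))))))))
      ![a.1] (by simp) (exists_wellOrder_mem_hset hθ (h.subset a.2))
    refine ⟨⟨r, hr⟩, ?_, ?_, ?_, ?_⟩
    · intro x hx
      rw [h.relIn_iff hθ]
      exact h1 x.1 hx
    · intro x y z hx hy hz
      rw [h.relIn_iff hθ, h.relIn_iff hθ, h.relIn_iff hθ]
      exact h2 _ hx _ hy _ hz
    · intro x y hx hy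
      rw [h.relIn_iff hθ, h.relIn_iff hθ, Subtype.ext_iff]
      exact h3 _ hx _ hy
    · rintro b ⟨x, hx⟩ hb
      obtain ⟨m, hm, hm'⟩ := h4 b.1 (h.subset b.2) ⟨x.1, hx, hx⟩
        (h.subset_of_forall b.2 a.2 fun z hz => hb ⟨z, hz⟩)
      obtain ⟨m, hmM, h5, h6⟩ := h.exists_mem transClass_hset (R := fun _ v m => m ∈ v 0 ∧
          ∀ y ∈ v 0, y = m ∨ ZFSet.pair m y ∈ v 1)
        (.and (.mem _ _) (.ball _ (.or (.eq _ _) (.pair_mem _ _ _)))) ![b.1, r]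
        (by simpa [Fin.forall_fin_succ] using hr)
        ⟨m, hset_trans (h.subset b.2) hm, hm, hm'⟩
      refine ⟨⟨m, hmM⟩, h5, fun y hy => ?_⟩
      rw [h.relIn_iff hθ, Subtype.ext_iff]
      exact h6 _ hy

end

/-! ### Elementary chains and the Löwenheim–Skolem theorem -/

theorem elemSub_of_forall_exists {M H : Set ZFSet.{u}} (hMH : M ⊆ H)
    (htv : ∀ (n : ℕ) (φ : setLang.BoundedFormula Empty (n + 1)) (x : Fin n → H) (a : H),
      (∀ i, (x i).1 ∈ M) → φ.Realize default (Fin.snoc x a : Fin (n + 1) → H) →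
        ∃ b : H, b.1 ∈ M ∧ φ.Realize default (Fin.snoc x b : Fin (n + 1) → H)) :
    ElemSub M H := by
  let f : M ↪[setLang] H :=
    { toFun := fun x => ⟨x.1, hMH x.2⟩
      inj' := fun x y h => Subtype.ext (congrArg (fun z : H => z.1) h)
      map_fun' := fun g => Empty.elim g
      map_rel' := fun {n} r v => by cases r; exact Iff.rfl }
  refine ⟨f.toElementaryEmbedding fun n φ x a h => ?_, fun _ => rfl⟩
  obtain ⟨b, hb, h'⟩ := htv n φ (f ∘ x) a (fun i => (x i).2) h
  exact ⟨⟨b.1, hb⟩, h'⟩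

theorem ElemSub.exists_realize {M H : Set ZFSet.{u}} (h : ElemSub M H) {n : ℕ}
    (φ : setLang.BoundedFormula Empty (n + 1)) (x : Fin n → H) (a : H) (hx : ∀ i, (x i).1 ∈ M)
    (ha : φ.Realize default (Fin.snoc x a : Fin (n + 1) → H)) :
    ∃ b : H, b.1 ∈ M ∧ φ.Realize default (Fin.snoc x b : Fin (n + 1) → H) := by
  obtain ⟨e, he⟩ := h
  have h1 : x = e ∘ fun i => (⟨(x i).1, hx i⟩ : M) := funext fun i =>
    Subtype.ext (he ⟨(x i).1, hx i⟩).symm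
  have hd : (default : Empty → H) = e ∘ default := Subsingleton.elim _ _
  have h2 : φ.ex.Realize (default : Empty → H) x := Language.BoundedFormula.realize_ex.2 ⟨a, ha⟩
  rw [h1, hd, e.map_boundedFormula, Language.BoundedFormula.realize_ex] at h2
  obtain ⟨b, hb⟩ := h2
  rw [← e.map_boundedFormula] at hb
  refine ⟨e b, by rw [he]; exact b.2, ?_⟩
  rw [hd]
  convert hb
  rw [Fin.comp_snoc, ← h1]

/-- The union of a chain of elementary substructures. -/
theorem elemSub_unionSeq {H : Set ZFSet.{u}} {γ : Ordinal.{u}} (hγ : 0 < γ)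
    {M : Ordinal.{u} → ZFSet.{u}} (hM : ∀ i < γ, ElemSub (M i : Set ZFSet.{u}) H)
    (hmono : ∀ i < γ, ∀ k < i, M k ⊆ M i) :
    ElemSub (unionSeq γ M : Set ZFSet.{u}) H := by
  refine elemSub_of_forall_exists (fun x hx => ?_) fun n φ x a hx ha => ?_
  · obtain ⟨i, hi, hx⟩ := mem_unionSeq.1 hx
    exact (hM i hi).subset hx
  · have hx' : ∀ i, ∃ k < γ, (x i).1 ∈ M k := fun i => mem_unionSeq.1 (hx i)
    choose k hk hxk using hx'
    have hmax : ∃ m < γ, ∀ i, k i ≤ m := by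
      rcases isEmpty_or_nonempty (Fin n) with h | h
      · exact ⟨0, hγ, fun i => isEmptyElim i⟩
      · obtain ⟨i, hi⟩ := Finite.exists_max k
        exact ⟨k i, hk i, hi⟩
    obtain ⟨m, hm, hkm⟩ := hmax
    obtain ⟨b, hb, h'⟩ := (hM m hm).exists_realize φ x a (fun i => by
      rcases (hkm i).eq_or_lt with h | h
      · exact h ▸ hxk i
      · exact hmono m hm _ h (hxk i)) ha
    exact ⟨b, mem_unionSeq.2 ⟨m, hm, hb⟩, h'⟩

theorem card_setLang : setLang.card = 1 := by
  have h1 : Cardinal.mk (Σ n, setLang.Relations n) = 1 := by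
    rw [Cardinal.eq_one_iff_unique]
    exact ⟨⟨fun ⟨_, .mem⟩ ⟨_, .mem⟩ => rfl⟩, ⟨⟨2, SetRel.mem⟩⟩⟩
  have h2 : Cardinal.mk (Σ n, setLang.Functions n) = 0 := by
    rw [Cardinal.mk_eq_zero_iff]
    exact ⟨fun f => Empty.elim f.2⟩
  rw [Language.card_eq_card_functions_add_card_relations]
  simp only [Cardinal.mk_sigma] at h1 h2
  simp [h1, h2]

theorem le_mk_hset {κ θ : Cardinal.{u}} (hκθ : κ < θ) :
    Cardinal.lift.{u + 1} κ ≤ Cardinal.mk (HSet θ) := by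
  have : Cardinal.mk (Set.Iio κ.ord) ≤ Cardinal.mk (HSet θ) :=
    Cardinal.mk_le_of_injective (f := fun i : Set.Iio κ.ord =>
      (⟨i.1.toZFSet, toZFSet_mem_hset (lt_trans i.2 (Cardinal.ord_lt_ord.2 hκθ))⟩ : HSet θ))
      fun i i' h => Subtype.ext (Ordinal.toZFSet_injective (congrArg (fun z : HSet θ => z.1) h))
  rwa [Cardinal.mk_Iio_ordinal, Cardinal.card_ord] at this

theorem exists_elemSub {κ θ : Cardinal.{u}} (hκ : Cardinal.aleph0 ≤ κ) (hκθ : κ < θ)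
    {s : Set ZFSet.{u}} (hs : s ⊆ HSet θ) (hc : Cardinal.mk s ≤ Cardinal.lift.{u + 1} κ) :
    ∃ M : ZFSet.{u}, s ⊆ M ∧ ElemSub (M : Set ZFSet.{u}) (HSet θ) ∧ M.card ≤ κ := by
  have hc' : Cardinal.mk {x : HSet θ | x.1 ∈ s} ≤ Cardinal.lift.{u + 1} κ := by
    refine le_trans (Cardinal.mk_le_of_injective (f := fun x : {x : HSet θ | x.1 ∈ s} =>
      (⟨x.1.1, x.2⟩ : s)) fun x y h => ?_) hc
    exact Subtype.ext (Subtype.ext (congrArg (fun z : s => z.1) h))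
  obtain ⟨S, hS, hcard⟩ := Language.exists_elementarySubstructure_card_eq setLang
    {x : HSet θ | x.1 ∈ s} (Cardinal.lift.{u + 1} κ) (Cardinal.aleph0_le_lift.2 hκ)
    (Cardinal.lift_le.2 hc') (by
      rw [card_setLang, Cardinal.lift_one, Cardinal.one_le_lift_iff, Cardinal.one_le_lift_iff]
      exact Cardinal.one_le_aleph0.trans hκ) (Cardinal.lift_le.2 (le_mk_hset hκθ))
  rw [Cardinal.lift_id, Cardinal.lift_id] at hcard
  have hne : ((fun x : HSet θ => x.1) '' (S : Set (HSet θ))).Nonempty := by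
    have : (0 : Cardinal) < Cardinal.mk S := by
      rw [hcard, Cardinal.zero_lt_lift_iff]
      exact Cardinal.aleph0_pos.trans_le hκ
    obtain ⟨x⟩ := Cardinal.mk_ne_zero_iff.1 this.ne'
    exact ⟨_, x.1, x.2, rfl⟩
  -- An enumeration of length `κ` turns the elementary substructure, a class, into a set.
  obtain ⟨g, hg1, hg2⟩ := exists_enum (κ := κ) hne (Cardinal.mk_image_le.trans hcard.le)
  have hmem : ∀ x : ZFSet.{u}, x ∈ ZFSet.range (fun i : Set.Iio κ.ord => g i.1) ↔
      ∃ y : HSet θ, y ∈ S ∧ y.1 = x := by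
    intro x
    rw [ZFSet.mem_range]
    constructor
    · rintro ⟨i, rfl⟩
      exact hg1 i.1
    · intro h
      obtain ⟨i, hi, rfl⟩ := hg2 x h
      exact ⟨⟨i, hi⟩, rfl⟩
  refine ⟨ZFSet.range fun i : Set.Iio κ.ord => g i.1, fun x hx =>
    (hmem x).2 ⟨⟨x, hs hx⟩, hS hx, rfl⟩, ?_, ?_⟩
  · refine elemSub_of_forall_exists (fun x hx => ?_) fun n φ x a hx ha => ?_
    · obtain ⟨y, _, rfl⟩ := (hmem x).1 hx
      exact y.2
    · have hx' : ∀ i, x i ∈ S := fun i => by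
        obtain ⟨y, hy, hyx⟩ := (hmem _).1 (hx i)
        rwa [← Subtype.ext hyx]
      have h1 : x = S.subtype ∘ fun i => (⟨x i, hx' i⟩ : S) := rfl
      have hd : (default : Empty → HSet θ) = S.subtype ∘ default := Subsingleton.elim _ _
      have h2 : φ.ex.Realize (default : Empty → HSet θ) x :=
        Language.BoundedFormula.realize_ex.2 ⟨a, ha⟩
      rw [h1, hd, S.subtype.map_boundedFormula, Language.BoundedFormula.realize_ex] at h2
      obtain ⟨b, hb⟩ := h2
      rw [← S.subtype.map_boundedFormula] at hb
      refine ⟨b.1, (hmem _).2 ⟨b.1, b.2, rfl⟩, ?_⟩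
      rw [hd]
      convert hb
      rw [Fin.comp_snoc, ← h1]
      rfl
  · refine (card_range_Iio_le _ _).trans ?_
    rw [Cardinal.card_ord]

/-! ### Closed models and legal play of the challenger -/

theorem seqSet_congr {δ : Ordinal.{u}} {f g : Ordinal.{u} → ZFSet.{u}} (h : ∀ i < δ, f i = g i) :
    seqSet δ f = seqSet δ g := by
  unfold seqSet
  congr 1
  funext i
  rw [h i.1 i.2]

/-- For each of the `κ` many lengths there are at most `κ^{<κ} = κ` sequences. -/
theorem mk_short_sequences {κ : Cardinal.{u}} (hκ : Cardinal.aleph0 ≤ κ)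
    (hp : Cardinal.powerlt κ κ = κ) {Y : ZFSet.{u}} (hY : Y.card ≤ κ) :
    Cardinal.mk {s : ZFSet.{u} | ∃ δ < κ.ord, ∃ f : Ordinal.{u} → ZFSet.{u}, (∀ i < δ, f i ∈ Y) ∧
      s = seqSet δ f} ≤ Cardinal.lift.{u + 1} κ := by
  classical
  have hsub : {s : ZFSet.{u} | ∃ δ < κ.ord, ∃ f : Ordinal.{u} → ZFSet.{u}, (∀ i < δ, f i ∈ Y) ∧
      s = seqSet δ f} ⊆ ⋃ δ ∈ Set.Iio κ.ord, Set.range fun f : Set.Iio δ → Y =>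
        seqSet δ fun i => if h : i < δ then (f ⟨i, h⟩).1 else ∅ := by
    rintro s ⟨δ, hδ, f, hf, rfl⟩
    rw [Set.mem_iUnion₂]
    exact ⟨δ, hδ, fun i => ⟨f i.1, hf i.1 i.2⟩, seqSet_congr fun i hi => dif_pos hi⟩
  refine (Cardinal.mk_le_mk_of_subset hsub).trans ((Cardinal.mk_biUnion_le _ _).trans ?_)
  rw [Cardinal.mk_Iio_ordinal, Cardinal.card_ord]
  refine (mul_le_mul_right (ciSup_le' fun δ => ?_) _).trans
    (Cardinal.mul_eq_self (Cardinal.aleph0_le_lift.2 hκ)).le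
  refine Cardinal.mk_range_le.trans ?_
  rw [← Cardinal.power_def, Cardinal.mk_Iio_ordinal, ZFSet.cardinalMk_coe_sort,
    ← Cardinal.lift_power, Cardinal.lift_le]
  calc Y.card ^ δ.1.card ≤ κ ^ δ.1.card := Cardinal.power_le_power_right hY
    _ ≤ Cardinal.powerlt κ κ := Cardinal.le_powerlt κ (Cardinal.lt_ord.1 δ.2)
    _ = κ := hp

theorem card_unionSeq_le {κ : Cardinal.{u}} (hκ : Cardinal.aleph0 ≤ κ) {γ : Ordinal.{u}}
    (hγ : γ.card ≤ κ) {M : Ordinal.{u} → ZFSet.{u}} (h : ∀ i < γ, (M i).card ≤ κ) :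
    (unionSeq γ M).card ≤ κ := by
  rw [card_le_iff]
  have : (unionSeq γ M : Set ZFSet.{u}) ⊆ ⋃ i ∈ Set.Iio γ, (M i : Set ZFSet.{u}) := fun x hx => by
    obtain ⟨i, hi, hx⟩ := mem_unionSeq.1 hx
    exact Set.mem_biUnion hi hx
  refine (Cardinal.mk_le_mk_of_subset this).trans ((Cardinal.mk_biUnion_le _ _).trans ?_)
  rw [Cardinal.mk_Iio_ordinal]
  refine (mul_le_mul' (Cardinal.lift_le.2 hγ) (ciSup_le' fun i => ?_)).trans
    (Cardinal.mul_eq_self (Cardinal.aleph0_le_lift.2 hκ)).le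
  exact card_le_iff.1 (h i.1 i.2)

theorem exists_bound_of_isRegular {α : Cardinal.{u}} (hα : α.IsRegular) {δ : Ordinal.{u}}
    (hδ : δ < α.ord) (k : Ordinal.{u} → Ordinal.{u}) (hk : ∀ i < δ, k i < α.ord) :
    ∃ m < α.ord, ∀ i < δ, k i < m := by
  refine ⟨⨆ i : Set.Iio δ, Order.succ (k i.1), ?_, fun i hi => ?_⟩
  · refine Ordinal.lift_iSup_lt_of_lt_cof ?_ fun i =>
      (Cardinal.isSuccLimit_ord hα.aleph0_le).succ_lt (hk i.1 i.2)
    rw [Cardinal.mk_Iio_ordinal, Cardinal.lift_lift, ← Ordinal.lift_cof, hα.cof_ord,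
      Cardinal.lift_lt]
    exact Cardinal.lt_ord.1 hδ
  · rw [← Order.succ_le_iff]
    exact Ordinal.le_iSup (fun i : Set.Iio δ => Order.succ (k i.1)) ⟨i, hi⟩

/-- The union of an increasing sequence whose length is regular is closed under short sequences. -/
theorem closedUnderLT_unionSeq {α : Cardinal.{u}} (hα : α.IsRegular) {M : Ordinal.{u} → ZFSet.{u}}
    (h : ∀ m < α.ord, ∀ δ < α.ord, ∀ f : Ordinal.{u} → ZFSet.{u},
      (∀ i < δ, f i ∈ unionSeq m M) → ∃ i < α.ord, seqSet δ f ∈ M i) :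
    ClosedUnderLT α (unionSeq α.ord M) := by
  intro δ hδ f hf
  have hf' : ∀ i, ∃ k, i < δ → k < α.ord ∧ f i ∈ M k := fun i => by
    by_cases hi : i < δ
    · obtain ⟨k, hk⟩ := mem_unionSeq.1 (hf i hi)
      exact ⟨k, fun _ => hk⟩
    · exact ⟨0, fun h => absurd h hi⟩
  choose k hk using hf'
  obtain ⟨m, hm, hkm⟩ := exists_bound_of_isRegular hα hδ k fun i hi => (hk i hi).1
  obtain ⟨i, hi, hs⟩ := h m hm δ hδ f fun i hi => mem_unionSeq.2 ⟨k i, hkm i hi, (hk i hi).2⟩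
  exact mem_unionSeq.2 ⟨i, hi, hs⟩

theorem isWeakModel_of_elemSub {κ θ : Cardinal.{u}} (hκ : Cardinal.aleph0 ≤ κ) (hκθ : κ < θ)
    (hθ : θ.IsRegular) {M : ZFSet.{u}} (h : ElemSub (M : Set ZFSet.{u}) (HSet θ)) (hc : M.card ≤ κ)
    (hs : cardSet κ ⊆ M) (hm : cardSet κ ∈ M) : IsWeakModel κ M where
  card_eq := le_antisymm hc ((card_cardSet κ).ge.trans (ZFSet.card_mono hs))
  subset := hs
  mem := hm
  models := h.modelsZFCMinus hθ (hκ.trans_lt hκθ)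

theorem cardSet_mem_hset {κ θ : Cardinal.{u}} (hκθ : κ < θ) : cardSet κ ∈ HSet θ :=
  toZFSet_mem_hset (Cardinal.ord_lt_ord.2 hκθ)

/-- A chain of length `κ` of elementary substructures of size at most `κ`, each containing all short
sequences from the union of its predecessors. By regularity, a short sequence from the union of the
chain already comes from an initial part. -/
theorem exists_kModel {κ θ : Cardinal.{u}} (hκ : κ.IsRegular) (hp : Cardinal.powerlt κ κ = κ)
    (hθ : θ.IsRegular) (hκθ : κ < θ) {Y : ZFSet.{u}} (hY : ∀ y ∈ Y, y ∈ HSet θ)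
    (hYc : Y.card ≤ κ) :
    ∃ M : ZFSet.{u}, IsKModel κ M ∧ ElemSub (M : Set ZFSet.{u}) (HSet θ) ∧ Y ⊆ M := by
  have hinf := hκ.aleph0_le
  have hstep : ∀ X : ZFSet.{u}, ∃ C : ZFSet.{u}, (∀ x ∈ X, x ∈ HSet θ) → X.card ≤ κ →
      X ⊆ C ∧ ElemSub (C : Set ZFSet.{u}) (HSet θ) ∧ C.card ≤ κ ∧
        ∀ δ < κ.ord, ∀ f : Ordinal.{u} → ZFSet.{u}, (∀ i < δ, f i ∈ X) → seqSet δ f ∈ C := by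
    intro X
    by_cases hX : (∀ x ∈ X, x ∈ HSet θ) ∧ X.card ≤ κ
    · obtain ⟨C, h1, h2, h3⟩ := exists_elemSub hinf hκθ
        (s := (X : Set ZFSet.{u}) ∪ {s : ZFSet.{u} | ∃ δ < κ.ord, ∃ f : Ordinal.{u} → ZFSet.{u},
          (∀ i < δ, f i ∈ X) ∧ s = seqSet δ f}) (by
          rintro x (hx | ⟨δ, hδ, f, hf, rfl⟩)
          · exact hX.1 x hx
          · exact seqSet_mem_hset hθ (hδ.trans (Cardinal.ord_lt_ord.2 hκθ))
              fun i hi => hX.1 _ (hf i hi))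
        ((Cardinal.mk_union_le _ _).trans ((add_le_add (card_le_iff.1 hX.2)
          (mk_short_sequences hinf hp hX.2)).trans
            (Cardinal.add_eq_self (Cardinal.aleph0_le_lift.2 hinf)).le))
      exact ⟨C, fun _ _ => ⟨fun x hx => h1 (Or.inl hx), h2, h3,
        fun δ hδ f hf => h1 (Or.inr ⟨δ, hδ, f, hf, rfl⟩)⟩⟩
    · exact ⟨∅, fun h h' => absurd ⟨h, h'⟩ hX⟩
  choose G hG using hstep
  let B : ZFSet.{u} := insert (cardSet κ) (Y ∪ cardSet κ)
  have hB : ∀ y ∈ B, y ∈ HSet θ := by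
    intro y hy
    rcases ZFSet.mem_insert_iff.1 hy with rfl | hy
    · exact cardSet_mem_hset hκθ
    · rcases ZFSet.mem_union.1 hy with hy | hy
      · exact hY y hy
      · exact hset_trans (cardSet_mem_hset hκθ) hy
  have hBc : B.card ≤ κ := by
    refine ZFSet.card_insert_le.trans ?_
    refine (add_le_add_left ZFSet.card_union_le 1).trans ?_
    rw [card_cardSet]
    exact (add_le_add_left (add_le_add_left hYc κ) 1).trans (by
      rw [Cardinal.add_eq_self hinf, Cardinal.add_one_of_aleph0_le hinf])
  obtain ⟨M, hM⟩ := exists_recursive fun i M => G (B ∪ unionSeq i M)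
  replace hM : ∀ i, M i = G (B ∪ unionSeq i M) := by
    intro i
    rw [hM i]
    congr 2
    ext x
    simp only [mem_unionSeq]
    exact exists_congr fun k => and_congr_right fun hk => by rw [if_pos hk]
  have hprop : ∀ i < κ.ord, (∀ x ∈ B ∪ unionSeq i M, x ∈ HSet θ) ∧ (B ∪ unionSeq i M).card ≤ κ := by
    intro i
    induction i using WellFoundedLT.induction with
    | _ i ih =>
      intro hi
      have ih' : ∀ k < i, ElemSub (M k : Set ZFSet.{u}) (HSet θ) ∧ (M k).card ≤ κ := by
        intro k hk
        have h := ih k hk (hk.trans hi)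
        have := hG _ h.1 h.2
        rw [← hM k] at this
        exact ⟨this.2.1, this.2.2.1⟩
      constructor
      · intro x hx
        rcases ZFSet.mem_union.1 hx with hx | hx
        · exact hB x hx
        · obtain ⟨k, hk, hx⟩ := mem_unionSeq.1 hx
          exact (ih' k hk).1.subset hx
      · refine ZFSet.card_union_le.trans ((add_le_add hBc (card_unionSeq_le hinf
          (Cardinal.lt_ord.1 hi).le fun k hk => (ih' k hk).2)).trans (Cardinal.add_eq_self hinf).le)
  have hall : ∀ i < κ.ord, B ∪ unionSeq i M ⊆ M i ∧ ElemSub (M i : Set ZFSet.{u}) (HSet θ) ∧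
      (M i).card ≤ κ ∧ ∀ δ < κ.ord, ∀ f : Ordinal.{u} → ZFSet.{u},
        (∀ k < δ, f k ∈ B ∪ unionSeq i M) → seqSet δ f ∈ M i := by
    intro i hi
    have := hG _ (hprop i hi).1 (hprop i hi).2
    rwa [← hM i] at this
  have hpos := hκ.ord_pos
  have hsub : ∀ y ∈ B, y ∈ unionSeq κ.ord M := fun y hy =>
    mem_unionSeq.2 ⟨0, hpos, (hall 0 hpos).1 (ZFSet.mem_union.2 (Or.inl hy))⟩
  have helem : ElemSub (unionSeq κ.ord M : Set ZFSet.{u}) (HSet θ) :=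
    elemSub_unionSeq hpos (fun i hi => (hall i hi).2.1) fun i hi k hk x hx =>
      (hall i hi).1 (ZFSet.mem_union.2 (Or.inr (mem_unionSeq.2 ⟨k, hk, hx⟩)))
  refine ⟨unionSeq κ.ord M, ⟨isWeakModel_of_elemSub hinf hκθ hθ helem
    (card_unionSeq_le hinf (by rw [Cardinal.card_ord]) fun i hi => (hall i hi).2.2.1)
    (fun x hx => hsub x ?_) (hsub _ (ZFSet.mem_insert _ _)), ?_⟩, helem, fun x hx => hsub x ?_⟩
  · exact ZFSet.mem_insert_of_mem _ (ZFSet.mem_union.2 (Or.inr hx))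
  · exact closedUnderLT_unionSeq hκ fun m hm δ hδ f hf => ⟨m, hm, (hall m hm).2.2.2 δ hδ f
      fun i hi => ZFSet.mem_union.2 (Or.inr (hf i hi))⟩
  · exact ZFSet.mem_insert_of_mem _ (ZFSet.mem_union.2 (Or.inl hx))

/-- A strategy of the challenger that always yields legal moves, which contain a given set. -/
theorem exists_legal_strategy {κ θ : Cardinal.{u}} (hκ : κ.IsRegular)
    (hp : Cardinal.powerlt κ κ = κ) (hθ : θ.IsRegular) (hκθ : κ < θ) {A : ZFSet.{u}}
    (hA : A ∈ HSet θ) :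
    ∃ σ : Strategy.{u}, ∀ F : Ordinal.{u} → ZFSet.{u}, ∀ α < κ.ord,
      ChallengerLegal κ θ (σ.play F) F α ∧ A ∈ σ.play F α := by
  classical
  have hinf := hκ.aleph0_le
  have hstep : ∀ X : ZFSet.{u}, ∃ C : ZFSet.{u}, (∀ x ∈ X, x ∈ HSet θ) → X.card ≤ κ →
      IsKModel κ C ∧ ElemSub (C : Set ZFSet.{u}) (HSet θ) ∧ X ⊆ C := by
    intro X
    by_cases hX : (∀ x ∈ X, x ∈ HSet θ) ∧ X.card ≤ κ
    · obtain ⟨C, h⟩ := exists_kModel hκ hp hθ hκθ hX.1 hX.2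
      exact ⟨C, fun _ _ => h⟩
    · exact ⟨∅, fun h h' => absurd ⟨h, h'⟩ hX⟩
  choose G hG using hstep
  -- All that the rules require the move at `α` to contain or include, together with `A`.
  let Y : Ordinal.{u} → (Ordinal.{u} → ZFSet.{u}) → (Ordinal.{u} → ZFSet.{u}) → ZFSet.{u} :=
    fun α M F => insert A (insert (seqSet α M) (insert (seqSet α fun β => F β ∩ M β)
      (unionSeq α M)))
  have hY : ∀ α M M' F F', (∀ β < α, M β = M' β) → (∀ β < α, F β = F' β) →
      Y α M F = Y α M' F' := by
    intro α M M' F F' hM hF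
    have h1 : seqSet α M = seqSet α M' := seqSet_congr hM
    have h2 : (seqSet α fun β => F β ∩ M β) = seqSet α fun β => F' β ∩ M' β :=
      seqSet_congr fun β hβ => by rw [hM β hβ, hF β hβ]
    have h3 : unionSeq α M = unionSeq α M' := by
      ext x
      simp only [mem_unionSeq]
      exact exists_congr fun k => and_congr_right fun hk => by rw [hM k hk]
    simp only [Y, h1, h2, h3]
  have hrec : ∀ F : Ordinal.{u} → ZFSet.{u}, ∃ M : Ordinal.{u} → ZFSet.{u},
      ∀ α, M α = G (Y α M F) := by
    intro F
    obtain ⟨M, hM⟩ := exists_recursive fun α M => G (Y α M F)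
    refine ⟨M, fun α => ?_⟩
    rw [hM α]
    exact congrArg G (hY _ _ _ _ _ (fun β hβ => if_pos hβ) fun _ _ => rfl)
  choose M hM using hrec
  have hlocal : ∀ F F' α, (∀ β < α, F β = F' β) → M F α = M F' α := by
    intro F F' α
    induction α using WellFoundedLT.induction with
    | _ α ih =>
      intro h
      rw [hM F, hM F']
      exact congrArg G (hY _ _ _ _ _ (fun β hβ => ih β hβ fun η hη => h η (hη.trans hβ)) h)
  -- A strategy sees the earlier moves of the judge only; they are padded with `∅`, which `hlocal`
  -- shows to be irrelevant.
  refine ⟨fun α f => M (fun β => if h : β < α then f ⟨β, h⟩ else ∅) α, fun F => ?_⟩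
  have hplay : Strategy.play (fun α f => M (fun β => if h : β < α then f ⟨β, h⟩ else ∅) α) F =
      M F := by
    funext α
    exact hlocal _ _ _ fun β hβ => dif_pos hβ
  rw [hplay]
  have key : ∀ α < κ.ord, IsKModel κ (M F α) ∧ ElemSub (M F α : Set ZFSet.{u}) (HSet θ) ∧
      Y α (M F) F ⊆ M F α := by
    intro α
    induction α using WellFoundedLT.induction with
    | _ α ih =>
      intro hα
      have hmem : ∀ β < α, M F β ∈ HSet θ := fun β hβ => by
        have h := ih β hβ (hβ.trans hα)
        exact mem_hset_of_card_lt hθ (fun y hy => h.2.1.subset hy) (h.1.card_eq.trans_lt hκθ)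
      rw [hM F α]
      have hαθ := hα.trans (Cardinal.ord_lt_ord.2 hκθ)
      refine hG _ (fun y hy => ?_) ?_
      · simp only [Y, ZFSet.mem_insert_iff, mem_unionSeq] at hy
        rcases hy with rfl | rfl | rfl | ⟨β, hβ, hy⟩
        · exact hA
        · exact seqSet_mem_hset hθ hαθ hmem
        · exact seqSet_mem_hset hθ hαθ fun β hβ => hset_subset (hmem β hβ) fun x hx =>
            (ZFSet.mem_inter.1 hx).2
        · exact hset_trans (hmem β hβ) hy
      · have hins : ∀ {x X : ZFSet.{u}}, X.card ≤ κ → (insert x X).card ≤ κ := fun h =>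
          ZFSet.card_insert_le.trans ((add_le_add_left h 1).trans
            (Cardinal.add_one_of_aleph0_le hinf).le)
        exact hins (hins (hins (card_unionSeq_le hinf (Cardinal.lt_ord.1 hα).le fun β hβ =>
          (ih β hβ (hβ.trans hα)).1.card_eq.le)))
  intro α hα
  obtain ⟨h1, h2, h3⟩ := key α hα
  have h4 : ∀ x, x ∈ Y α (M F) F ↔ x = A ∨ x = seqSet α (M F) ∨
      x = (seqSet α fun β => F β ∩ M F β) ∨ ∃ β < α, x ∈ M F β := fun x => by
    simp only [Y, ZFSet.mem_insert_iff, mem_unionSeq]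
  exact ⟨⟨h1, h2, fun β hβ x hx => h3 ((h4 _).2 (Or.inr (Or.inr (Or.inr ⟨β, hβ, hx⟩)))),
    h3 ((h4 _).2 (Or.inr (Or.inl rfl))), h3 ((h4 _).2 (Or.inr (Or.inr (Or.inl rfl))))⟩,
    h3 ((h4 _).2 (Or.inl rfl))⟩

/-! ### Ultrapowers by normal filters -/

open Classical in
/-- The value of the function `f` at `x`. -/
noncomputable def val (f x : ZFSet.{u}) : ZFSet.{u} :=
  if h : ∃ y, ZFSet.pair x y ∈ f then h.choose else ∅

theorem IsFunOn.val_eq {d f x y : ZFSet.{u}} (hf : IsFunOn d f) (h : ZFSet.pair x y ∈ f) :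
    val f x = y := by
  have h' : ∃ y, ZFSet.pair x y ∈ f := ⟨y, h⟩
  rw [val, dif_pos h']
  exact hf.unique h'.choose_spec h

theorem IsFunOn.pair_val_mem {d f x : ZFSet.{u}} (hf : IsFunOn d f) (h : x ∈ d) :
    ZFSet.pair x (val f x) ∈ f := by
  obtain ⟨y, hy⟩ := hf.exists_pair_mem h
  rwa [hf.val_eq hy]

/-- Definability of the substitution of values of functions. -/
theorem Dfn.exists_values {n : ℕ} {P : Set ZFSet.{u} → (Fin (n + 1) → ZFSet.{u}) → Prop}
    (hP : Dfn P) : Dfn fun (S : Set ZFSet.{u}) (v : Fin (n + 2) → ZFSet.{u}) =>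
      ∃ y : Fin n → ZFSet.{u}, (∀ i, ZFSet.pair (v 0) (y i) ∈ v i.succ.succ) ∧
        P S (Fin.snoc y (v 1) : Fin (n + 1) → ZFSet.{u}) := by
  obtain ⟨φ, hφ⟩ := hP
  obtain ⟨χ, hχ⟩ := Dfn.pair_mem (n := 3) 0 1 2
  let ψ : setLang.Formula (Fin (n + 2) ⊕ Fin n) :=
    φ.relabel (Fin.snoc (fun i => Sum.inr i) (Sum.inl 1) : Fin (n + 1) → Fin (n + 2) ⊕ Fin n) ⊓
      Language.Formula.iInf fun i : Fin n =>
        χ.relabel (![Sum.inl 0, Sum.inr i, Sum.inl i.succ.succ] : Fin 3 → Fin (n + 2) ⊕ Fin n)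
  refine ⟨ψ.iExs (Fin n), fun S hS v => ?_⟩
  rw [Language.Formula.realize_iExs]
  have key : ∀ y : Fin n → S, ψ.Realize (Sum.elim v y) ↔
      (∀ i, ZFSet.pair (v 0).1 (y i).1 ∈ (v i.succ.succ).1) ∧
        P S (Fin.snoc (fun i => (y i).1) (v 1).1 : Fin (n + 1) → ZFSet.{u}) := by
    intro y
    rw [Language.Formula.realize_inf, Language.Formula.realize_relabel, hφ S hS,
      Language.Formula.realize_iInf, and_comm]
    refine and_congr (forall_congr' fun i => ?_) (iff_of_eq (congrArg _ (funext fun i => ?_)))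
    · rw [Language.Formula.realize_relabel, hχ S hS]
      rfl
    · refine Fin.lastCases ?_ (fun i => ?_) i <;> simp
  constructor
  · rintro ⟨y, hy⟩
    exact ⟨fun i => (y i).1, (key y).1 hy⟩
  · rintro ⟨y, h1, h2⟩
    exact ⟨fun i => ⟨y i, (hS.of_pair_mem (v i.succ.succ).2 (h1 i)).2⟩, (key _).2 ⟨h1, h2⟩⟩

theorem Dfn.realize_bounded {n : ℕ} (φ : setLang.BoundedFormula Empty n) :
    Dfn fun (S : Set ZFSet.{u}) (v : Fin n → ZFSet.{u}) =>
      ∃ h : ∀ i, v i ∈ S, φ.Realize default fun i => (⟨v i, h i⟩ : S) := by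
  refine (Dfn.realize (φ.toFormula.relabel (Sum.elim Empty.elim id))).of_iff fun S _ v _ => ?_
  refine exists_congr fun h => ?_
  rw [Language.Formula.realize_relabel, Language.BoundedFormula.realize_toFormula]
  refine iff_of_eq ?_
  congr 1
  exact Subsingleton.elim _ _

/-- The assumptions on a model and a filter that yield a `κ`-powerset preserving ultrapower. -/
structure MeasuredModel (κ θ : Cardinal.{u}) (M F : ZFSet.{u}) : Prop where
  regular : κ.IsRegular
  lt : κ < θ
  regular' : θ.IsRegular
  elem : ElemSub (M : Set ZFSet.{u}) (HSet θ)
  subset : cardSet κ ⊆ M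
  mem : cardSet κ ∈ M
  normal : IsNormalFor κ M F
  wf : WfUltrapower κ M F
  amenable : ∀ X ∈ M, IsFunOn (cardSet κ) X →
    ZFSet.sep (fun i => ∃ A ∈ F, ZFSet.pair i A ∈ X) (cardSet κ) ∈ M

/-- The functions on `κ` in `M`. -/
abbrev Fn (κ : Cardinal.{u}) (M : ZFSet.{u}) : Type (u + 1) :=
  {f : ZFSet.{u} // f ∈ M ∧ IsFunOn (cardSet κ) f}

instance (κ : Cardinal.{u}) (M : ZFSet.{u}) : Small.{u} (Fn κ M) :=
  small_of_injective (β := M) (f := fun f => ⟨f.1, f.2.1⟩) fun _ _ h =>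
    Subtype.ext (congrArg (fun z : M => z.1) h)

/-- The set of all ordinals below `κ` with the property `P`. -/
noncomputable def ext (κ : Cardinal.{u}) (P : ZFSet.{u} → Prop) : ZFSet.{u} :=
  ZFSet.sep P (cardSet κ)

theorem mem_ext {κ : Cardinal.{u}} {P : ZFSet.{u} → Prop} {x : ZFSet.{u}} :
    x ∈ ext κ P ↔ x ∈ cardSet κ ∧ P x := ZFSet.mem_sep

theorem ext_congr {κ : Cardinal.{u}} {P Q : ZFSet.{u} → Prop}
    (h : ∀ x ∈ cardSet κ, P x ↔ Q x) : ext κ P = ext κ Q := by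
  ext x
  simp only [ext, ZFSet.mem_sep]
  exact and_congr_right (h x)

theorem ultMem_iff {κ : Cardinal.{u}} {M F : ZFSet.{u}} (f g : Fn κ M) :
    UltMem κ F f.1 g.1 ↔ ext κ (fun x => val f.1 x ∈ val g.1 x) ∈ F := by
  rw [← ext_congr (P := fun α => ∃ x y, ZFSet.pair α x ∈ f.1 ∧ ZFSet.pair α y ∈ g.1 ∧ x ∈ y)]
  · rfl
  · intro x hx
    constructor
    · rintro ⟨y, z, hy, hz, h⟩
      rwa [f.2.2.val_eq hy, g.2.2.val_eq hz]
    · intro h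
      exact ⟨_, _, f.2.2.pair_val_mem hx, g.2.2.pair_val_mem hx, h⟩

theorem IsFilterOn.not_disjoint {κ : Cardinal.{u}} {F : ZFSet.{u}} (hF : IsFilterOn κ F)
    (hκ : 0 < κ) {n : ℕ} (A : Fin n → ZFSet.{u}) (hA : ∀ i, A i ∈ F) :
    ∃ x ∈ cardSet κ, ∀ i, x ∈ A i := by
  have h := hF.card_inter n A hA
  by_contra! h'
  have h0 : ZFSet.sep (fun z => ∀ i, z ∈ A i) (cardSet κ) = ∅ := by
    rw [ZFSet.eq_empty]
    intro x hx
    obtain ⟨i, hi⟩ := h' x (ZFSet.mem_sep.1 hx).1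
    exact hi ((ZFSet.mem_sep.1 hx).2 i)
  rw [h0, ZFSet.card_empty] at h
  exact hκ.ne h

namespace MeasuredModel

variable {κ θ : Cardinal.{u}} {M F : ZFSet.{u}}

theorem not_disjoint (E : MeasuredModel κ θ M F) {n : ℕ} (A : Fin n → ZFSet.{u})
    (hA : ∀ i, A i ∈ F) : ∃ x ∈ cardSet κ, ∀ i, x ∈ A i :=
  E.normal.filter.not_disjoint E.regular.pos A hA

/-- Closure under supersets is not part of `IsFilterOn`. But `F` measures `M`, and the complement of
a superset cannot be in `F`, because it would be disjoint from the intersection of the other two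
sets. -/
theorem large_mp₂ (E : MeasuredModel κ θ M F) {P Q R : ZFSet.{u} → Prop} (hP : ext κ P ∈ F)
    (hQ : ext κ Q ∈ F) (hR : ext κ R ∈ M) (h : ∀ x ∈ cardSet κ, P x → Q x → R x) :
    ext κ R ∈ F := by
  rcases E.normal.measures _ hR ZFSet.sep_subset with h' | h'
  · exact h'
  · obtain ⟨x, hx, hx'⟩ := E.not_disjoint ![ext κ P, ext κ Q, cardSet κ \ ext κ R]
      (by simp [Fin.forall_fin_succ, hP, hQ, h'])
    have h0 : x ∈ ext κ P := hx' 0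
    have h1 : x ∈ ext κ Q := hx' 1
    have h2 : x ∈ cardSet κ \ ext κ R := hx' 2
    exact absurd (mem_ext.2 ⟨hx, h x hx (mem_ext.1 h0).2 (mem_ext.1 h1).2⟩)
      (ZFSet.mem_sdiff.1 h2).2

theorem large_mp (E : MeasuredModel κ θ M F) {P R : ZFSet.{u} → Prop} (hP : ext κ P ∈ F)
    (hR : ext κ R ∈ M) (h : ∀ x ∈ cardSet κ, P x → R x) : ext κ R ∈ F :=
  E.large_mp₂ hP hP hR fun x hx h' _ => h x hx h'

theorem large_not (E : MeasuredModel κ θ M F) {P : ZFSet.{u} → Prop} (hP : ext κ P ∈ M) :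
    ext κ (fun x => ¬ P x) ∈ F ↔ ext κ P ∉ F := by
  constructor
  · intro h h'
    obtain ⟨x, hx, hx'⟩ := E.not_disjoint ![ext κ P, ext κ fun x => ¬ P x]
      (by simp [Fin.forall_fin_succ, h', h])
    have h0 : x ∈ ext κ P := hx' 0
    have h1 : x ∈ ext κ fun x => ¬ P x := hx' 1
    exact (mem_ext.1 h1).2 (mem_ext.1 h0).2
  · intro h
    refine Eq.subst (motive := (· ∈ F)) ?_
      ((E.normal.measures _ hP ZFSet.sep_subset).resolve_left h)
    ext x
    simp only [ext, ZFSet.mem_sdiff, ZFSet.mem_sep]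
    tauto

theorem exists_of_large (E : MeasuredModel κ θ M F) {P : ZFSet.{u} → Prop} (hP : ext κ P ∈ F) :
    ∃ x ∈ cardSet κ, P x := by
  obtain ⟨x, hx, hx'⟩ := E.not_disjoint ![ext κ P] (by simpa using hP)
  have h0 : x ∈ ext κ P := hx' 0
  exact ⟨x, hx, (mem_ext.1 h0).2⟩

theorem ext_true_mem (E : MeasuredModel κ θ M F) {P : ZFSet.{u} → Prop}
    (h : ∀ x ∈ cardSet κ, P x) : ext κ P ∈ M := by
  refine Eq.subst (motive := (· ∈ M)) ?_ E.mem
  ext x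
  rw [ext, ZFSet.mem_sep]
  exact ⟨fun hx => ⟨hx, h x hx⟩, fun hx => hx.1⟩

theorem large_of_forall (E : MeasuredModel κ θ M F) {P : ZFSet.{u} → Prop}
    (h : ∀ x ∈ cardSet κ, P x) : ext κ P ∈ F := by
  by_contra h'
  obtain ⟨x, hx, hx'⟩ := E.exists_of_large ((E.large_not (E.ext_true_mem h)).2 h')
  exact hx' (h x hx)

theorem val_mem_hset (E : MeasuredModel κ θ M F) (f : Fn κ M) (x : ZFSet.{u}) :
    val f.1 x ∈ HSet θ := by
  unfold val
  split_ifs with h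
  · exact (transClass_hset.of_pair_mem (E.elem.subset f.2.1) h.choose_spec).2
  · exact hset_subset (cardSet_mem_hset E.lt) (ZFSet.empty_subset _)

/-- The truth sets of Łoś's theorem belong to `M`, so that `F` measures them. -/
theorem ext_mem (E : MeasuredModel κ θ M F) {n : ℕ}
    {P : Set ZFSet.{u} → (Fin n → ZFSet.{u}) → Prop} (hP : Dfn P) (f : Fin n → Fn κ M) :
    ext κ (fun x => P (HSet θ) fun i => val (f i).1 x) ∈ M := by
  have hQ := Dfn.exists_values (P := fun S v => P S fun i => v i.castSucc)
    (hP.comp fun i => i.castSucc)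
  have h := E.elem.sep_mem (R := fun S v x => ∃ y : Fin n → ZFSet.{u},
      (∀ i, ZFSet.pair x (y i) ∈ v i) ∧ P S fun i => (Fin.snoc y x : Fin (n + 1) → ZFSet.{u}) i.castSucc)
    (hQ.comp (Fin.cons 0 (Fin.cons 0 fun i => i.succ) : Fin (n + 2) → Fin (n + 1)))
    (fun i => (f i).1) (fun i => (f i).2.1) E.mem
  refine Eq.subst (motive := (· ∈ M)) (ext_congr fun x hx => ?_) h
  simp only [Fin.snoc_castSucc]
  constructor
  · rintro ⟨y, h1, h2⟩
    have : y = fun i => val (f i).1 x := funext fun i => ((f i).2.2.val_eq (h1 i)).symm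
    rwa [this] at h2
  · exact fun h => ⟨_, fun i => (f i).2.2.pair_val_mem hx, h⟩

/-- Skolem functions for Łoś's theorem: a choice of values along `κ` is a member of `H(θ)`, and
elementarity provides one in `M`. -/
theorem exists_choice (E : MeasuredModel κ θ M F) {n : ℕ}
    {P : Set ZFSet.{u} → (Fin (n + 1) → ZFSet.{u}) → Prop} (hP : Dfn P) (f : Fin n → Fn κ M) :
    ∃ g : Fn κ M, ∀ x ∈ cardSet κ, ∀ y ∈ HSet θ,
      P (HSet θ) (Fin.snoc (fun i => val (f i).1 x) y : Fin (n + 1) → ZFSet.{u}) →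
      P (HSet θ) (Fin.snoc (fun i => val (f i).1 x) (val g.1 x) : Fin (n + 1) → ZFSet.{u}) := by
  classical
  let Q : Set ZFSet.{u} → ZFSet.{u} → ZFSet.{u} → (Fin n → ZFSet.{u}) → Prop := fun S x y v =>
    ∃ z : Fin n → ZFSet.{u}, (∀ i, ZFSet.pair x (z i) ∈ v i) ∧
      P S (Fin.snoc z y : Fin (n + 1) → ZFSet.{u})
  have hQ := Dfn.exists_values hP
  have hQiff : ∀ x ∈ cardSet κ, ∀ y, Q (HSet θ) x y (fun i => (f i).1) ↔
      P (HSet θ) (Fin.snoc (fun i => val (f i).1 x) y : Fin (n + 1) → ZFSet.{u}) := by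
    intro x hx y
    constructor
    · rintro ⟨z, h1, h2⟩
      have : z = fun i => val (f i).1 x := funext fun i => ((f i).2.2.val_eq (h1 i)).symm
      rwa [this] at h2
    · exact fun h => ⟨_, fun i => (f i).2.2.pair_val_mem hx, h⟩
  have hch : ∀ i : Ordinal.{u}, ∃ y ∈ HSet θ, ∀ z ∈ HSet θ,
      Q (HSet θ) i.toZFSet z (fun i => (f i).1) → Q (HSet θ) i.toZFSet y fun i => (f i).1 := by
    intro i
    by_cases h : ∃ z ∈ HSet θ, Q (HSet θ) i.toZFSet z fun i => (f i).1
    · obtain ⟨z, hz, h⟩ := h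
      exact ⟨z, hz, fun _ _ _ => h⟩
    · exact ⟨cardSet κ, cardSet_mem_hset E.lt, fun z hz hzQ => absurd ⟨z, hz, hzQ⟩ h⟩
  choose c hc hcQ using hch
  obtain ⟨g, hg, hg1, hg2⟩ := E.elem.exists_mem transClass_hset (n := n + 1)
    (R := fun S v g => IsFunOn (v 0) g ∧ ∀ x ∈ v 0, ∀ y ∈ S, Q S x y (Fin.tail v) →
      ∃ z, ZFSet.pair x z ∈ g ∧ Q S x z (Fin.tail v))
    (.and (.isFunOn _ _) (.ball _ (.all (.imp
      (hQ.comp (Fin.cons 1 (Fin.cons 0 fun i => i.succ.succ.succ.succ) :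
        Fin (n + 2) → Fin (n + 4)))
      (.ex_pair_mem _ _ (hQ.comp (Fin.cons 2 (Fin.cons 0 fun i => i.succ.succ.succ.succ.succ) :
        Fin (n + 2) → Fin (n + 5))))))))
    (Fin.cons (cardSet κ) fun i => (f i).1)
    (fun i => by refine Fin.cases ?_ (fun i => ?_) i <;> simp [E.mem, (f _).2.1])
    ⟨seqSet κ.ord c, seqSet_mem_hset E.regular' (Cardinal.ord_lt_ord.2 E.lt) fun i _ => hc i,
      seqSet_isFunOn c, fun x hx y hy hxy => by
        simp only [Fin.cons_zero, Fin.tail_cons] at hx hxy ⊢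
        obtain ⟨i, hi, rfl⟩ := mem_cardSet.1 hx
        exact ⟨c i, pair_mem_seqSet.2 ⟨i, hi, rfl, rfl⟩, hcQ i y hy hxy⟩⟩
  simp only [Fin.cons_zero, Fin.tail_cons] at hg1 hg2
  refine ⟨⟨g, hg, hg1⟩, fun x hx y hy h => ?_⟩
  obtain ⟨z, hz, h'⟩ := hg2 x hx y hy ((hQiff x hx y).2 h)
  rw [hg1.val_eq hz]
  exact (hQiff x hx z).1 h'

/-- Brings definable sequences of subsets of `κ` into the form in which normality and amenability
apply. -/
theorem exists_family (E : MeasuredModel κ θ M F) {n : ℕ}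
    {R : Set ZFSet.{u} → (Fin n → ZFSet.{u}) → ZFSet.{u} → ZFSet.{u} → Prop}
    (hR : Dfn fun (S : Set ZFSet.{u}) (w : Fin (n + 2) → ZFSet.{u}) =>
      R S (Fin.tail (Fin.tail w)) (w 1) (w 0))
    (v : Fin n → ZFSet.{u}) (hv : ∀ i, v i ∈ M) :
    ∃ X : Fn κ M, ∀ i ∈ cardSet κ, val X.1 i = ext κ (R (HSet θ) v i) := by
  obtain ⟨X, hX, h1, h2⟩ := E.elem.exists_mem transClass_hset (n := n + 1)
    (R := fun S w X => IsFunOn (w 0) X ∧ ∀ i ∈ w 0, ∀ A, ZFSet.pair i A ∈ X → A ⊆ w 0 ∧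
      ∀ x ∈ w 0, (x ∈ A ↔ R S (Fin.tail w) i x))
    (.and (.isFunOn _ _) (.ball _ (.all_pair_mem _ _ (.and (.subset _ _) (.ball _
      (.iff (.mem _ _) (hR.comp (Fin.cons 0 (Fin.cons 2 fun i => i.succ.succ.succ.succ.succ) :
        Fin (n + 2) → Fin (n + 5)))))))))
    (Fin.cons (cardSet κ) v)
    (fun i => by refine Fin.cases ?_ (fun i => ?_) i <;> simp [E.mem, hv])
    ⟨seqSet κ.ord fun i => ext κ (R (HSet θ) v i.toZFSet),
      seqSet_mem_hset E.regular' (Cardinal.ord_lt_ord.2 E.lt) fun i _ =>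
        hset_subset (cardSet_mem_hset E.lt) ZFSet.sep_subset,
      seqSet_isFunOn _, fun i hi A hA => by
        simp only [Fin.cons_zero, Fin.tail_cons] at hi ⊢
        obtain ⟨i, hi', rfl, rfl⟩ := pair_mem_seqSet.1 hA
        exact ⟨ZFSet.sep_subset, fun x hx => by simp [ext, hx]⟩⟩
  simp only [Fin.cons_zero, Fin.tail_cons] at h1 h2
  refine ⟨⟨X, hX, h1⟩, fun i hi => ?_⟩
  obtain ⟨h3, h4⟩ := h2 i hi _ (h1.pair_val_mem hi)
  ext x
  rw [ext, ZFSet.mem_sep]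
  exact ⟨fun hx => ⟨h3 hx, (h4 x (h3 hx)).1 hx⟩, fun hx => (h4 x hx.1).2 hx.2⟩

/-! #### The Mostowski collapse -/

theorem wellFounded (E : MeasuredModel κ θ M F) :
    WellFounded fun f g : Fn κ M => UltMem κ F f.1 g.1 := E.wf

/-- The Mostowski collapse of the ultrapower. -/
noncomputable def collapse (E : MeasuredModel κ θ M F) : Fn κ M → ZFSet.{u} :=
  E.wellFounded.fix fun f π => ZFSet.range fun g : {g : Fn κ M // UltMem κ F g.1 f.1} => π g.1 g.2

theorem mem_collapse (E : MeasuredModel κ θ M F) {f : Fn κ M} {x : ZFSet.{u}} :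
    x ∈ E.collapse f ↔ ∃ g : Fn κ M, UltMem κ F g.1 f.1 ∧ E.collapse g = x := by
  rw [collapse, WellFounded.fix_eq, ZFSet.mem_range]
  constructor
  · rintro ⟨g, rfl⟩
    exact ⟨g.1, g.2, rfl⟩
  · rintro ⟨g, hg, rfl⟩
    exact ⟨⟨g, hg⟩, rfl⟩

theorem ext_val_mem_val (E : MeasuredModel κ θ M F) (f g : Fn κ M) :
    ext κ (fun x => val f.1 x ∈ val g.1 x) ∈ M :=
  E.ext_mem (P := fun _ v => v 0 ∈ v 1) (.mem _ _) ![f, g]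

theorem ext_val_eq_val (E : MeasuredModel κ θ M F) (f g : Fn κ M) :
    ext κ (fun x => val f.1 x = val g.1 x) ∈ M :=
  E.ext_mem (P := fun _ v => v 0 = v 1) (.eq _ _) ![f, g]

theorem collapse_eq_of_large (E : MeasuredModel κ θ M F) {f g : Fn κ M}
    (h : ext κ (fun x => val f.1 x = val g.1 x) ∈ F) : E.collapse f = E.collapse g := by
  ext x
  rw [E.mem_collapse, E.mem_collapse]
  refine exists_congr fun k => and_congr_left fun _ => ?_
  rw [ultMem_iff, ultMem_iff]
  exact ⟨fun h' => E.large_mp₂ h h' (E.ext_val_mem_val _ _) fun x _ h1 h2 => h1 ▸ h2,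
    fun h' => E.large_mp₂ h h' (E.ext_val_mem_val _ _) fun x _ h1 h2 => h1 ▸ h2⟩

/-- If `f` had a value not included in that of `g` on a large set, a function in `M` choosing
elements of the difference would represent a member of `f` but not of `g`. -/
theorem not_large_sdiff (E : MeasuredModel κ θ M F) {f g : Fn κ M}
    (h : ∀ k : Fn κ M, UltMem κ F k.1 f.1 → UltMem κ F k.1 g.1) :
    ext κ (fun x => ¬ ∃ y ∈ val f.1 x, y ∉ val g.1 x) ∈ F := by
  have hM : ext κ (fun x => ∃ y ∈ val f.1 x, y ∉ val g.1 x) ∈ M :=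
    E.ext_mem (P := fun _ v => ∃ y ∈ v 0, y ∉ v 1) (.bex _ (.not (.mem _ _))) ![f, g]
  rw [E.large_not hM]
  intro hl
  obtain ⟨k, hk⟩ := E.exists_choice (P := fun _ v => v 2 ∈ v 0 ∧ v 2 ∉ v 1)
    (.and (.mem _ _) (.not (.mem _ _))) ![f, g]
  have hk' : ∀ x ∈ cardSet κ, (∃ y ∈ val f.1 x, y ∉ val g.1 x) →
      val k.1 x ∈ val f.1 x ∧ val k.1 x ∉ val g.1 x := by
    rintro x hx ⟨y, hy⟩
    exact hk x hx y (hset_trans (E.val_mem_hset f x) hy.1) hy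
  have h1 := h k ((ultMem_iff k f).2 (E.large_mp hl (E.ext_val_mem_val _ _)
    fun x hx h' => (hk' x hx h').1))
  rw [ultMem_iff] at h1
  exact (E.large_not (E.ext_val_mem_val k g)).1 (E.large_mp hl
    (E.ext_mem (P := fun _ v => v 0 ∉ v 1) (.not (.mem _ _)) ![k, g])
    fun x hx h' => (hk' x hx h').2) h1

/-- Induction along the ultrapower: predecessors with the same collapse agree on a large set, so `f`
and `g` have the same predecessors and include each other on large sets. -/
theorem large_of_collapse_eq (E : MeasuredModel κ θ M F) {f g : Fn κ M}
    (h : E.collapse f = E.collapse g) : ext κ (fun x => val f.1 x = val g.1 x) ∈ F := by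
  induction f using E.wellFounded.induction generalizing g with
  | _ f ih =>
    have h1 := E.not_large_sdiff (f := f) (g := g) fun k hk => by
      have h1 : E.collapse k ∈ E.collapse g := h ▸ E.mem_collapse.2 ⟨k, hk, rfl⟩
      obtain ⟨k', hk', h2⟩ := E.mem_collapse.1 h1
      have h3 := ih k hk h2.symm
      rw [ultMem_iff] at hk' ⊢
      exact E.large_mp₂ hk' h3 (E.ext_val_mem_val _ _) fun x _ h4 h5 => h5 ▸ h4
    have h2 := E.not_large_sdiff (f := g) (g := f) fun k hk => by
      have h1 : E.collapse k ∈ E.collapse f := h ▸ E.mem_collapse.2 ⟨k, hk, rfl⟩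
      obtain ⟨k', hk', h2⟩ := E.mem_collapse.1 h1
      have h3 := ih k' hk' h2
      rw [ultMem_iff] at hk' ⊢
      exact E.large_mp₂ hk' h3 (E.ext_val_mem_val _ _) fun x _ h4 h5 => h5 ▸ h4
    refine E.large_mp₂ h1 h2 (E.ext_val_eq_val f g) fun x _ h3 h4 => ?_
    push Not at h3 h4
    ext y
    exact ⟨h3 y, h4 y⟩

theorem collapse_eq_iff (E : MeasuredModel κ θ M F) {f g : Fn κ M} :
    E.collapse f = E.collapse g ↔ ext κ (fun x => val f.1 x = val g.1 x) ∈ F :=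
  ⟨E.large_of_collapse_eq, E.collapse_eq_of_large⟩

theorem collapse_mem_iff (E : MeasuredModel κ θ M F) {f g : Fn κ M} :
    E.collapse f ∈ E.collapse g ↔ ext κ (fun x => val f.1 x ∈ val g.1 x) ∈ F := by
  rw [E.mem_collapse]
  constructor
  · rintro ⟨k, hk, h⟩
    rw [ultMem_iff] at hk
    exact E.large_mp₂ hk (E.large_of_collapse_eq h) (E.ext_val_mem_val _ _)
      fun x _ h1 h2 => h2 ▸ h1
  · exact fun h => ⟨f, (ultMem_iff f g).2 h, rfl⟩

/-- The transitive collapse of the ultrapower, as a set. -/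
noncomputable def target (E : MeasuredModel κ θ M F) : ZFSet.{u} := ZFSet.range E.collapse

theorem mem_target (E : MeasuredModel κ θ M F) {x : ZFSet.{u}} :
    x ∈ E.target ↔ ∃ f, E.collapse f = x := by
  rw [target, ZFSet.mem_range]

theorem isTransitive_target (E : MeasuredModel κ θ M F) : E.target.IsTransitive := by
  intro x hx y hy
  obtain ⟨f, rfl⟩ := E.mem_target.1 hx
  obtain ⟨g, _, rfl⟩ := E.mem_collapse.1 hy
  exact E.mem_target.2 ⟨g, rfl⟩

theorem card_target_le (E : MeasuredModel κ θ M F) : E.target.card ≤ M.card := by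
  rw [card_le_iff, ← ZFSet.cardinalMk_coe_sort]
  have h1 : Cardinal.mk E.target ≤ Cardinal.mk (Fn κ M) :=
    Cardinal.mk_le_of_surjective (f := fun f : Fn κ M =>
      (⟨E.collapse f, E.mem_target.2 ⟨f, rfl⟩⟩ : E.target)) fun x => by
        obtain ⟨f, hf⟩ := E.mem_target.1 x.2
        exact ⟨f, Subtype.ext hf⟩
  exact h1.trans (Cardinal.mk_le_of_injective (f := fun f : Fn κ M => (⟨f.1, f.2.1⟩ : M))
    fun f g h => Subtype.ext (congrArg (fun z : M => z.1) h))

/-- The elements of the ultrapower. -/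
noncomputable def toTarget (E : MeasuredModel κ θ M F) (f : Fn κ M) : (E.target : Set ZFSet.{u}) :=
  ⟨E.collapse f, E.mem_target.2 ⟨f, rfl⟩⟩

/-- The value of a function in `M`, as an element of `H(θ)`. -/
noncomputable def valHSet (E : MeasuredModel κ θ M F) (x : ZFSet.{u}) (f : Fn κ M) : HSet θ :=
  ⟨val f.1 x, E.val_mem_hset f x⟩

theorem ext_realize_mem (E : MeasuredModel κ θ M F) {n : ℕ} (φ : setLang.BoundedFormula Empty n)
    (f : Fin n → Fn κ M) :
    ext κ (fun x => φ.Realize default fun i => E.valHSet x (f i)) ∈ M := by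
  have h := E.ext_mem (Dfn.realize_bounded φ) f
  refine Eq.subst (motive := (· ∈ M)) (ext_congr fun x _ => ?_) h
  exact ⟨fun h => h.2, fun h => ⟨fun i => E.val_mem_hset (f i) x, h⟩⟩

theorem exists_var {n : ℕ} (t : setLang.Term (Empty ⊕ Fin n)) :
    ∃ i, t = Language.Term.var (Sum.inr i) := by
  match t with
  | .var (.inl e) => exact e.elim
  | .var (.inr i) => exact ⟨i, rfl⟩
  | .func f _ => exact Empty.elim f

/-- Łoś's theorem. -/
theorem realize_iff_large (E : MeasuredModel κ θ M F) {n : ℕ}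
    (φ : setLang.BoundedFormula Empty n) (f : Fin n → Fn κ M) :
    φ.Realize default (fun i => E.toTarget (f i)) ↔
      ext κ (fun x => φ.Realize default fun i => E.valHSet x (f i)) ∈ F := by
  induction φ with
  | falsum =>
    refine iff_of_false id fun h => ?_
    obtain ⟨x, _, hx⟩ := E.exists_of_large h
    exact hx
  | equal t₁ t₂ =>
    obtain ⟨i, rfl⟩ := exists_var t₁
    obtain ⟨k, rfl⟩ := exists_var t₂
    simp only [Language.BoundedFormula.Realize, Language.Term.realize_var, Sum.elim_inr]
    rw [Subtype.ext_iff, toTarget, toTarget, E.collapse_eq_iff]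
    simp only [valHSet, Subtype.mk.injEq]
  | rel R ts =>
    cases R
    obtain ⟨i, hi⟩ := exists_var (ts 0)
    obtain ⟨k, hk⟩ := exists_var (ts 1)
    have key : ∀ {S : Set ZFSet.{u}} (v : Fin _ → S),
        (Language.BoundedFormula.rel SetRel.mem ts : setLang.BoundedFormula Empty _).Realize
          default v ↔ (v i).1 ∈ (v k).1 := by
      intro S v
      change ((ts 0).realize (Sum.elim default v)).1 ∈ ((ts 1).realize (Sum.elim default v)).1 ↔ _
      rw [hi, hk]
      rfl
    rw [key]
    simp only [key]
    exact E.collapse_mem_iff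
  | imp φ ψ ih₁ ih₂ =>
    rw [Language.BoundedFormula.realize_imp, ih₁, ih₂]
    simp only [Language.BoundedFormula.realize_imp]
    constructor
    · intro h
      by_cases h1 : ext κ (fun x => φ.Realize default fun i => E.valHSet x (f i)) ∈ F
      · exact E.large_mp (h h1) (E.ext_realize_mem (φ.imp ψ) f) fun x _ h _ => h
      · exact E.large_mp ((E.large_not (E.ext_realize_mem φ f)).2 h1)
          (E.ext_realize_mem (φ.imp ψ) f) fun x _ h h' => absurd h' h
    · intro h h'
      exact E.large_mp₂ h h' (E.ext_realize_mem ψ f) fun x _ h h' => h h'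
  | @all m φ ih =>
    have hsnoc : ∀ g : Fn κ M, (fun i => E.toTarget ((Fin.snoc f g : Fin (m + 1) → Fn κ M) i)) =
        (Fin.snoc (fun i => E.toTarget (f i)) (E.toTarget g) :
          Fin (m + 1) → (E.target : Set ZFSet.{u})) := fun g => by
      funext i
      refine Fin.lastCases ?_ (fun i => ?_) i <;> simp
    have hsnoc' : ∀ (x : ZFSet.{u}) (g : Fn κ M),
        (fun i => E.valHSet x ((Fin.snoc f g : Fin (m + 1) → Fn κ M) i)) =
        (Fin.snoc (fun i => E.valHSet x (f i)) (E.valHSet x g) : Fin (m + 1) → HSet θ) :=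
      fun x g => by
        funext i
        refine Fin.lastCases ?_ (fun i => ?_) i <;> simp
    simp only [Language.BoundedFormula.realize_all]
    constructor
    · intro h
      by_contra hn
      have h1 := (E.large_not (E.ext_realize_mem φ.all f)).2 hn
      -- `g` picks a counterexample to `φ` wherever there is one.
      obtain ⟨g, hg⟩ := E.exists_choice (Dfn.realize_bounded φ.not) f
      have h2 := h (E.toTarget g)
      rw [← hsnoc g, ih] at h2
      have h3 := E.ext_realize_mem φ (Fin.snoc f g)
      refine (E.large_not h3).1 (E.large_mp h1 (E.ext_realize_mem φ.not _) fun x hx h4 => ?_) h2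
      rw [Language.BoundedFormula.realize_all] at h4
      push Not at h4
      obtain ⟨y, hy⟩ := h4
      have h5 : ∀ z : HSet θ, (∃ h : ∀ i, (Fin.snoc (fun i => val (f i).1 x) z.1 :
          Fin (m + 1) → ZFSet.{u}) i ∈ HSet θ, φ.not.Realize default fun i => (⟨_, h i⟩ : HSet θ)) ↔
          ¬ φ.Realize default (Fin.snoc (fun i => E.valHSet x (f i)) z : Fin (m + 1) → HSet θ) := by
        intro z
        have h6 : ∀ i, (Fin.snoc (fun i => val (f i).1 x) z.1 : Fin (m + 1) → ZFSet.{u}) i =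
            ((Fin.snoc (fun i => E.valHSet x (f i)) z : Fin (m + 1) → HSet θ) i).1 := fun i => by
          refine Fin.lastCases ?_ (fun i => ?_) i <;> simp [valHSet]
        constructor
        · rintro ⟨h, h7⟩
          rw [Language.BoundedFormula.realize_not] at h7
          convert h7 using 3 with i
          exact Subtype.ext (h6 i).symm
        · intro h7
          refine ⟨fun i => by rw [h6 i]; exact Subtype.prop _, ?_⟩
          rw [Language.BoundedFormula.realize_not]
          convert h7 using 3 with i
          exact Subtype.ext (h6 i)
      have h8 := (h5 (E.valHSet x g)).1 (hg x hx y.1 y.2 ((h5 y).2 hy))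
      rwa [← hsnoc'] at h8
    · rintro h ⟨y, hy⟩
      obtain ⟨g, rfl⟩ := E.mem_target.1 hy
      change φ.Realize default (Fin.snoc (fun i => E.toTarget (f i)) (E.toTarget g) :
          Fin (m + 1) → (E.target : Set ZFSet.{u}))
      rw [← hsnoc g, ih]
      refine E.large_mp h (E.ext_realize_mem φ _) fun x _ h' => ?_
      rw [hsnoc']
      exact h' _

end MeasuredModel

/-! ### The embedding into the ultrapower is powerset preserving -/

namespace MeasuredModel

variable {κ θ : Cardinal.{u}} {M F : ZFSet.{u}}

/-- Constant functions. -/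
noncomputable def constFn (E : MeasuredModel κ θ M F) (x : (M : Set ZFSet.{u})) : Fn κ M :=
  ⟨ZFSet.prod (cardSet κ) {x.1}, E.elem.prod_mem E.regular' E.mem (by
    have h := E.elem.upair_mem E.regular' x.2 x.2
    rwa [ZFSet.pair_eq_singleton] at h), {x.1}, fun _ h => h, fun y hy =>
      ⟨x.1, ZFSet.pair_mem_prod.2 ⟨hy, ZFSet.mem_singleton.2 rfl⟩, fun z hz =>
        ZFSet.mem_singleton.1 (ZFSet.pair_mem_prod.1 hz).2⟩⟩

theorem val_constFn (E : MeasuredModel κ θ M F) (x : (M : Set ZFSet.{u})) {i : ZFSet.{u}}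
    (hi : i ∈ cardSet κ) : val (E.constFn x).1 i = x.1 :=
  (E.constFn x).2.2.val_eq (ZFSet.pair_mem_prod.2 ⟨hi, ZFSet.mem_singleton.2 rfl⟩)

theorem exists_idFn (E : MeasuredModel κ θ M F) :
    ∃ f : Fn κ M, ∀ i ∈ cardSet κ, val f.1 i = i := by
  obtain ⟨f, hf, h1, h2⟩ := E.elem.exists_mem transClass_hset
    (R := fun _ v f => IsFunOn (v 0) f ∧ ∀ i ∈ v 0, ZFSet.pair i i ∈ f)
    (.and (.isFunOn _ _) (.ball _ (.pair_mem _ _ _))) ![cardSet κ] (by simp [E.mem])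
    ⟨seqSet κ.ord Ordinal.toZFSet, seqSet_mem_hset E.regular' (Cardinal.ord_lt_ord.2 E.lt)
      fun i hi => toZFSet_mem_hset (hi.trans (Cardinal.ord_lt_ord.2 E.lt)), seqSet_isFunOn _,
      fun x hx => by
        obtain ⟨i, hi, rfl⟩ := mem_cardSet.1 hx
        exact pair_mem_seqSet.2 ⟨i, hi, rfl, rfl⟩⟩
  exact ⟨⟨f, hf, h1⟩, fun i hi => h1.val_eq (h2 i hi)⟩

theorem ext_val_mem_id (E : MeasuredModel κ θ M F) (g : Fn κ M) :
    ext κ (fun x => val g.1 x ∈ x) ∈ M := by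
  obtain ⟨f, hf⟩ := E.exists_idFn
  exact Eq.subst (motive := (· ∈ M)) (ext_congr fun x hx => by rw [hf x hx])
    (E.ext_val_mem_val g f)

theorem ext_val_eq_const (E : MeasuredModel κ θ M F) (g : Fn κ M) (i : (M : Set ZFSet.{u})) :
    ext κ (fun x => val g.1 x = i.1) ∈ M :=
  Eq.subst (motive := (· ∈ M)) (ext_congr fun x hx => by rw [E.val_constFn i hx])
    (E.ext_val_eq_val g (E.constFn i))

theorem collapse_eq_const_iff (E : MeasuredModel κ θ M F) (g : Fn κ M)
    (i : (M : Set ZFSet.{u})) :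
    E.collapse g = E.collapse (E.constFn i) ↔ ext κ (fun x => val g.1 x = i.1) ∈ F :=
  E.collapse_eq_iff.trans (iff_of_eq (congrArg (· ∈ F)
    (ext_congr fun x hx => by rw [E.val_constFn i hx])))

theorem const_mem_collapse_iff (E : MeasuredModel κ θ M F) (g : Fn κ M)
    (i : (M : Set ZFSet.{u})) :
    E.collapse (E.constFn i) ∈ E.collapse g ↔ ext κ (fun x => i.1 ∈ val g.1 x) ∈ F :=
  E.collapse_mem_iff.trans (iff_of_eq (congrArg (· ∈ F)
    (ext_congr fun x hx => by rw [E.val_constFn i hx])))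

/-- The complement is bounded in `κ`, hence too small to be a member of `F`. -/
theorem large_gt (E : MeasuredModel κ θ M F) {x : ZFSet.{u}} (hx : x ∈ cardSet κ) :
    ext κ (fun y => x ∈ y) ∈ F := by
  have hM : ext κ (fun y => x ∈ y) ∈ M := E.elem.sep_mem (R := fun _ v y => v 0 ∈ y) (.mem _ _) ![x]
    (by simpa using E.subset hx) E.mem
  by_contra hn
  have h1 := (E.large_not hM).2 hn
  have h2 := E.normal.filter.card_inter 1 (fun _ => ext κ fun y => ¬ x ∈ y) fun _ => h1
  obtain ⟨i, hi, rfl⟩ := mem_cardSet.1 hx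
  have h3 : ZFSet.sep (fun z => ∀ _ : Fin 1, z ∈ ext κ fun y => ¬ i.toZFSet ∈ y) (cardSet κ) ⊆
      (Order.succ i).toZFSet := by
    intro y hy
    obtain ⟨h4, h5⟩ := mem_ext.1 ((ZFSet.mem_sep.1 hy).2 0)
    obtain ⟨k, hk, rfl⟩ := mem_cardSet.1 h4
    rw [Ordinal.toZFSet_mem_toZFSet_iff] at h5 ⊢
    exact Order.lt_succ_iff.2 (not_lt.1 h5)
  have h4 := ZFSet.card_mono h3
  rw [h2, Ordinal.card_toZFSet] at h4
  exact h4.not_gt (Cardinal.lt_ord.1 ((Cardinal.isSuccLimit_ord E.regular.aleph0_le).succ_lt hi))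

/-- Regressive functions are constant on a large set. -/
theorem exists_eq_of_regressive (E : MeasuredModel κ θ M F) {g : Fn κ M}
    (hg : ext κ (fun x => val g.1 x ∈ x) ∈ F) :
    ∃ i ∈ cardSet κ, ext κ (fun x => val g.1 x = i) ∈ F := by
  by_contra! h
  -- If no fibre of `g` is large, then all complements of fibres are in `F`. A point `x` of their
  -- diagonal intersection with `g(x) < x` lies outside the fibre of its own value.
  obtain ⟨X, hX⟩ := E.exists_family (R := fun _ v i x => ¬ ZFSet.pair x i ∈ v 0)
    (.not (.pair_mem _ _ _)) ![g.1] (by simpa using g.2.1)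
  have hXF : ∀ i A, ZFSet.pair i A ∈ X.1 → A ∈ F := by
    intro i A hA
    obtain ⟨Y, hY, _⟩ := X.2.2
    have hi := (ZFSet.pair_mem_prod.1 (hY hA)).1
    have h2 := (E.large_not (E.ext_val_eq_const g ⟨i, E.subset hi⟩)).2 (h i hi)
    rw [← X.2.2.val_eq hA, hX i hi]
    refine Eq.subst (motive := (· ∈ F)) (ext_congr fun x hx => not_congr ?_) h2
    exact ⟨fun h => (show val g.1 x = i from h) ▸ g.2.2.pair_val_mem hx, fun h => g.2.2.val_eq h⟩
  have hD := E.normal.normal X.1 X.2.1 X.2.2 hXF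
  obtain ⟨x, hx, hx'⟩ := E.not_disjoint ![ext κ fun x => val g.1 x ∈ x, diagInter κ X.1]
    (by simp [Fin.forall_fin_succ, hg, hD])
  have h0 : x ∈ ext κ fun x => val g.1 x ∈ x := hx' 0
  have h1 : x ∈ diagInter κ X.1 := hx' 1
  have hlt := (mem_ext.1 h0).2
  have hi : val g.1 x ∈ cardSet κ := (ZFSet.isOrdinal_toZFSet κ.ord).isTransitive x hx hlt
  have h2 := (ZFSet.mem_sep.1 h1).2 _ hlt _ (X.2.2.pair_val_mem hi)
  rw [hX _ hi] at h2
  exact (mem_ext.1 h2).2 (g.2.2.pair_val_mem hx)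

theorem trans_of_mem {x y z : ZFSet.{u}} (hx : x ∈ cardSet κ) (hyx : y ∈ x) (hzy : z ∈ y) :
    z ∈ x := by
  obtain ⟨i, _, rfl⟩ := mem_cardSet.1 hx
  exact (ZFSet.isOrdinal_toZFSet i).isTransitive y hyx hzy

/-- A function with values below `i` is regressive on a large set, so it is constant on a large set
by normality; the induction hypothesis identifies that constant. -/
theorem collapse_constFn (E : MeasuredModel κ θ M F) (i : Ordinal.{u}) (hi : i < κ.ord) :
    E.collapse (E.constFn ⟨i.toZFSet, E.subset (toZFSet_mem_cardSet.2 hi)⟩) = i.toZFSet := by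
  induction i using WellFoundedLT.induction with
  | _ i ih =>
    have hi' : i.toZFSet ∈ cardSet κ := toZFSet_mem_cardSet.2 hi
    ext y
    rw [E.mem_collapse]
    constructor
    · rintro ⟨g, hg, rfl⟩
      rw [ultMem_iff] at hg
      have hg' : ext κ (fun x => val g.1 x ∈ x) ∈ F :=
        E.large_mp₂ hg (E.large_gt hi') (E.ext_val_mem_id g) fun x hx h1 h2 => by
            rw [E.val_constFn _ hx] at h1
            exact trans_of_mem hx h2 h1
      obtain ⟨k, hk, hgk⟩ := E.exists_eq_of_regressive hg'
      obtain ⟨x, hx, hx'⟩ := E.not_disjoint ![ext κ fun x => val g.1 x = k,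
        ext κ fun x => val g.1 x ∈ val (E.constFn ⟨i.toZFSet, E.subset hi'⟩).1 x]
        (by simp [Fin.forall_fin_succ, hgk, hg])
      have h0 : x ∈ ext κ fun x => val g.1 x = k := hx' 0
      have h1 : x ∈ ext κ fun x => val g.1 x ∈
        val (E.constFn ⟨i.toZFSet, E.subset hi'⟩).1 x := hx' 1
      have h2 := (mem_ext.1 h1).2
      rw [(mem_ext.1 h0).2, E.val_constFn _ hx] at h2
      obtain ⟨k, hk', rfl⟩ := mem_cardSet.1 hk
      have h3 := ih k (Ordinal.toZFSet_mem_toZFSet_iff.1 h2) hk'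
      have h4 := (E.collapse_eq_const_iff g ⟨k.toZFSet, E.subset hk⟩).2 hgk
      rwa [h4, h3]
    · intro hy
      obtain ⟨k, hk, rfl⟩ := Ordinal.mem_toZFSet_iff.1 hy
      refine ⟨_, ?_, ih k hk (hk.trans hi)⟩
      rw [ultMem_iff]
      exact E.large_of_forall fun x hx => by rwa [E.val_constFn _ hx, E.val_constFn _ hx]

theorem collapse_constFn' (E : MeasuredModel κ θ M F) {x : ZFSet.{u}} (hx : x ∈ cardSet κ) :
    E.collapse (E.constFn ⟨x, E.subset hx⟩) = x := by
  obtain ⟨i, hi, rfl⟩ := mem_cardSet.1 hx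
  exact E.collapse_constFn i hi

theorem large_eq_collapse (E : MeasuredModel κ θ M F) {g : Fn κ M}
    (hg : ext κ (fun x => val g.1 x ∈ x) ∈ F) :
    E.collapse g ∈ cardSet κ ∧ ext κ (fun x => val g.1 x = E.collapse g) ∈ F := by
  obtain ⟨i, hi, h⟩ := E.exists_eq_of_regressive hg
  have h4 : E.collapse g = i := by
    rw [← E.collapse_constFn' hi, E.collapse_eq_const_iff]
    exact h
  rw [h4]
  exact ⟨hi, h⟩

/-- The elementary embedding into the ultrapower. -/
noncomputable def embedding (E : MeasuredModel κ θ M F) :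
    (M : Set ZFSet.{u}) ↪ₑ[setLang] (E.target : Set ZFSet.{u}) where
  toFun x := E.toTarget (E.constFn x)
  map_formula' n φ x := by
    rw [← Language.Formula.realize_relabel_sumInr]
    refine (E.realize_iff_large _ fun i => E.constFn (x i)).trans ?_
    rw [ext_congr (Q := fun _ => φ.Realize fun i => (⟨(x i).1, E.elem.subset (x i).2⟩ : HSet θ))]
    · rw [← E.elem.realize_iff]
      constructor
      · intro h
        obtain ⟨_, _, h⟩ := E.exists_of_large h
        exact h
      · exact fun h => E.large_of_forall fun _ _ => h
    · intro y hy
      rw [← Language.Formula.realize_relabel_sumInr]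
      have : (fun i => E.valHSet y (E.constFn (x i))) =
          fun i => (⟨(x i).1, E.elem.subset (x i).2⟩ : HSet θ) :=
        funext fun i => Subtype.ext (E.val_constFn (x i) hy)
      rw [this]

/-- By normality the identity represents `κ`: everything below it is regressive and collapses to an
ordinal below `κ`. -/
theorem collapse_eq_cardSet (E : MeasuredModel κ θ M F) {f : Fn κ M}
    (hf : ∀ i ∈ cardSet κ, val f.1 i = i) : E.collapse f = cardSet κ := by
  ext y
  rw [E.mem_collapse]
  constructor
  · rintro ⟨g, hg, rfl⟩
    rw [ultMem_iff] at hg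
    exact (E.large_eq_collapse (E.large_mp hg (E.ext_val_mem_id g) fun x hx h => by
      rwa [hf x hx] at h)).1
  · intro hy
    rw [← E.mem_collapse, ← E.collapse_constFn' hy, E.const_mem_collapse_iff]
    exact Eq.subst (motive := (· ∈ F)) (ext_congr fun x hx => by rw [hf x hx]) (E.large_gt hy)

/-- The function `i ↦ x ∩ i` represents `x`. -/
theorem mem_target_of_subset (E : MeasuredModel κ θ M F) {x : ZFSet.{u}} (hx : x ⊆ cardSet κ)
    (hxM : x ∈ M) : x ∈ E.target := by
  obtain ⟨X, hX⟩ := E.exists_family (R := fun _ v i z => z ∈ v 0 ∧ z ∈ i)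
    (.and (.mem _ _) (.mem _ _)) ![x] (by simpa using hxM)
  refine E.mem_target.2 ⟨X, ?_⟩
  ext y
  rw [E.mem_collapse]
  constructor
  · rintro ⟨g, hg, rfl⟩
    rw [ultMem_iff] at hg
    have hg' : ext κ (fun z => val g.1 z ∈ z) ∈ F :=
      E.large_mp hg (E.ext_val_mem_id g) fun z hz h => by
        rw [hX z hz] at h
        exact (mem_ext.1 h).2.2
    obtain ⟨z, hz, hz'⟩ := E.not_disjoint ![ext κ fun z => val g.1 z = E.collapse g,
      ext κ fun z => val g.1 z ∈ val X.1 z]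
      (by simp [Fin.forall_fin_succ, (E.large_eq_collapse hg').2, hg])
    have h0 : z ∈ ext κ fun z => val g.1 z = E.collapse g := hz' 0
    have h1 : z ∈ ext κ fun z => val g.1 z ∈ val X.1 z := hz' 1
    have h2 := (mem_ext.1 h1).2
    rw [(mem_ext.1 h0).2, hX z hz] at h2
    exact (mem_ext.1 h2).2.1
  · intro hy
    refine ⟨_, ?_, E.collapse_constFn' (hx hy)⟩
    rw [ultMem_iff]
    refine E.large_mp (E.large_gt (hx hy)) (E.ext_val_mem_val _ _) fun z hz h => ?_
    rw [E.val_constFn _ hz, hX z hz]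
    exact mem_ext.2 ⟨hx hy, hy, h⟩

/-- If `f` represents `x ⊆ κ`, then `i ∈ x` means that the set of all `z` with `i ∈ f(z)` is in `F`.
The sequence of these sets is in `M`, so amenability applies. -/
theorem mem_of_mem_target (E : MeasuredModel κ θ M F) {x : ZFSet.{u}} (hx : x ⊆ cardSet κ)
    (hxN : x ∈ E.target) : x ∈ M := by
  obtain ⟨f, rfl⟩ := E.mem_target.1 hxN
  obtain ⟨X, hX⟩ := E.exists_family (R := fun _ v i z => ∃ y, ZFSet.pair z y ∈ v 0 ∧ i ∈ y)
    (.ex_pair_mem _ _ (.mem _ _)) ![f.1] (by simpa using f.2.1)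
  refine Eq.subst (motive := (· ∈ M)) ?_ (E.amenable X.1 X.2.1 X.2.2)
  have hXi : ∀ i ∈ cardSet κ, val X.1 i = ext κ fun z => i ∈ val f.1 z := by
    intro i hi
    rw [hX i hi]
    refine ext_congr fun z hz => ⟨?_, fun h => ⟨_, f.2.2.pair_val_mem hz, h⟩⟩
    rintro ⟨y, hy, h⟩
    rwa [f.2.2.val_eq hy]
  have hiff : ∀ i ∈ cardSet κ, i ∈ E.collapse f ↔ ext κ (fun z => i ∈ val f.1 z) ∈ F := by
    intro i hi
    conv_lhs => rw [← E.collapse_constFn' hi]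
    rw [E.const_mem_collapse_iff]
  ext i
  rw [ZFSet.mem_sep]
  constructor
  · rintro ⟨hi, A, hA, hiA⟩
    rw [hiff i hi, ← hXi i hi, X.2.2.val_eq hiA]
    exact hA
  · intro hi
    refine ⟨hx hi, _, (hiff i (hx hi)).1 hi, ?_⟩
    rw [← hXi i (hx hi)]
    exact X.2.2.pair_val_mem (hx hi)

theorem powersetPreserving (E : MeasuredModel κ θ M F) :
    PowersetPreserving κ (M : Set ZFSet.{u}) (E.target : Set ZFSet.{u}) E.embedding where
  fix x hx := E.collapse_constFn' hx
  moves := by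
    rintro ⟨x, hxM⟩ hx h
    change x = cardSet κ at hx
    subst hx
    change E.collapse (E.constFn ⟨_, hxM⟩) = cardSet κ at h
    obtain ⟨f, hf⟩ := E.exists_idFn
    -- `κ` is represented by the identity, which is below the constant function with value `κ`.
    have h1 : E.collapse f ∈ E.collapse (E.constFn ⟨_, hxM⟩) := by
      rw [E.collapse_mem_iff]
      exact E.large_of_forall fun x hx => by rwa [hf x hx, E.val_constFn _ hx]
    rw [h, E.collapse_eq_cardSet hf] at h1
    exact ZFSet.mem_irrefl _ h1
  subsets x hx := ⟨E.mem_target_of_subset hx, E.mem_of_mem_target hx⟩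

end MeasuredModel

/-! ### Ramsey cardinals from runs of the game -/

/-- Amenability comes from the rule that the next model contains `F i ∩ M i`. For `X ∈ M i` the set
in question is computed in the model of stage `i + 1`, which exists as the length is a limit; on `M
i`, the final filter agrees with `F i`. -/
theorem measuredModel_of_run {κ θ : Cardinal.{u}} (hκ : κ.IsRegular) (hκθ : κ < θ)
    (hθ : θ.IsRegular) {γ : Ordinal.{u}} (hγ : Order.IsSuccLimit γ) (hγκ : γ ≤ κ.ord)
    {M F : Ordinal.{u} → ZFSet.{u}} (hM : ∀ i < γ, ChallengerLegal κ θ M F i)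
    (hF : ∀ i < γ, JudgeLegal κ M F i) (hn : IsNormalFor κ (unionSeq γ M) (unionSeq γ F))
    (hwf : WfUltrapower κ (unionSeq γ M) (unionSeq γ F)) :
    MeasuredModel κ θ (unionSeq γ M) (unionSeq γ F) := by
  have hpos : 0 < γ := hγ.bot_lt
  refine ⟨hκ, hκθ, hθ, elemSub_unionSeq hpos (fun i hi => (hM i hi).elem) fun i hi => (hM i hi).mono,
    fun x hx => mem_unionSeq.2 ⟨0, hpos, (hM 0 hpos).model.subset hx⟩,
    mem_unionSeq.2 ⟨0, hpos, (hM 0 hpos).model.mem⟩, hn, hwf, fun X hX hXf => ?_⟩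
  obtain ⟨i, hi, hX⟩ := mem_unionSeq.1 hX
  have hi' : Order.succ i < γ := hγ.succ_lt hi
  have hC := hM _ hi'
  have hFM : F i ∩ M i ∈ M (Order.succ i) := hC.elem.seqSet_apply_mem (f := fun β => F β ∩ M β)
    hC.filters_mem (Order.lt_succ i) (hC.model.subset (toZFSet_mem_cardSet.2 (hi.trans_le hγκ)))
  have h1 := hC.elem.sep_mem (R := fun _ v k => ∃ A ∈ v 0, ZFSet.pair k A ∈ v 1)
    (.bex _ (.pair_mem _ _ _)) ![F i ∩ M i, X]
    (by
      simp [Fin.forall_fin_succ]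
      exact ⟨hFM, hC.mono _ (Order.lt_succ i) hX⟩) hC.model.mem
  refine mem_unionSeq.2 ⟨_, hi', Eq.subst (motive := (· ∈ M (Order.succ i))) ?_ h1⟩
  refine ext_congr fun k hk => ⟨?_, ?_⟩
  · rintro ⟨A, hA, hkA⟩
    exact ⟨A, mem_unionSeq.2 ⟨i, hi, (ZFSet.mem_inter.1 hA).1⟩, hkA⟩
  · rintro ⟨A, hA, hkA⟩
    have hAM : A ∈ M i := (hM i hi).elem.apply_mem hX ((hM i hi).model.subset hk) hkA
      fun z hz => hXf.unique hz hkA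
    refine ⟨A, ZFSet.mem_inter.2 ⟨?_, hAM⟩, hkA⟩
    refine ((hF i hi).measures A hAM (hn.filter.subset A hA)).resolve_right fun h => ?_
    obtain ⟨x, hx, hx'⟩ := hn.filter.not_disjoint hκ.pos ![A, cardSet κ \ A]
      (by simp [Fin.forall_fin_succ, hA]; exact mem_unionSeq.2 ⟨i, hi, h⟩)
    have h0 : x ∈ A := hx' 0
    have h2 : x ∈ cardSet κ \ A := hx' 1
    exact (ZFSet.mem_sdiff.1 h2).2 h0

/-- A transitive set has members of every rank below its own, so its rank has at most its size. This
is what places `H(θ)` inside `V_θ`. -/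
theorem exists_rank_eq {t : ZFSet.{u}} (ht : t.IsTransitive) (x : ZFSet.{u}) (hx : x ⊆ t)
    (i : Ordinal.{u}) (hi : i < x.rank) : ∃ y ∈ t, y.rank = i := by
  induction x using ZFSet.inductionOn with
  | _ x ih =>
    obtain ⟨y, hy, hiy⟩ := ZFSet.lt_rank_iff.1 hi
    rcases hiy.eq_or_lt with h | h
    · exact ⟨y, hx hy, h.symm⟩
    · exact ih y hy (ht y (hx hy)) h

theorem card_rank_le {t : ZFSet.{u}} (ht : t.IsTransitive) : t.rank.card ≤ t.card := by
  have h1 : Set.Iio t.rank ⊆ ZFSet.rank '' (t : Set ZFSet.{u}) := fun i hi => by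
    obtain ⟨y, hy, rfl⟩ := exists_rank_eq ht t (fun _ h => h) i hi
    exact ⟨y, hy, rfl⟩
  have h2 := (Cardinal.mk_le_mk_of_subset h1).trans Cardinal.mk_image_le
  rw [Cardinal.mk_Iio_ordinal] at h2
  exact Cardinal.lift_le.1 (h2.trans (card_le_iff.1 le_rfl))

theorem rank_lt_of_mem_hset {θ : Cardinal.{u}} {x : ZFSet.{u}} (hx : x ∈ HSet θ) :
    x.rank < θ.ord := by
  obtain ⟨t, ht, hxt, hc⟩ := hx
  exact (ZFSet.rank_mono hxt).trans_lt (Cardinal.lt_ord.2 ((card_rank_le ht).trans_lt hc))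

/-! ### Witnesses in the universe and in `V_κ` -/

/-- The closure conditions on `U` that are needed to find witnesses for Ramseyness of `κ` in `U`. -/
structure WitnessClosed (U : Set ZFSet.{u}) (κ : Cardinal.{u}) : Prop where
  exists_regular : ∀ β : Ordinal.{u}, β.toZFSet ∈ U →
    ∃ θ : Cardinal.{u}, θ.IsRegular ∧ κ < θ ∧ β < θ.ord ∧ cardSet θ ∈ U
  mem_of_rank_le : ∀ (θ : Cardinal.{u}) (x : ZFSet.{u}), cardSet θ ∈ U → x.rank ≤ θ.ord → x ∈ U

theorem witnessClosed_univ {κ : Cardinal.{u}} (hκ : Cardinal.aleph0 ≤ κ) :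
    WitnessClosed Set.univ κ :=
  ⟨fun β _ => ⟨Order.succ (max κ β.card), Cardinal.isRegular_succ (hκ.trans (le_max_left _ _)),
    Order.lt_succ_iff.2 (le_max_left _ _),
    Cardinal.lt_ord.2 (Order.lt_succ_iff.2 (le_max_right _ _)), trivial⟩, fun _ _ _ _ => trivial⟩

theorem witnessClosed_vonNeumann {κ l : Cardinal.{u}} (hκ : Cardinal.aleph0 ≤ κ) (hκl : κ < l)
    (hl : l.IsInaccessible) : WitnessClosed (ZFSet.vonNeumann l.ord : Set ZFSet.{u}) κ := by
  have hmem : ∀ x : ZFSet.{u}, x ∈ (ZFSet.vonNeumann l.ord : Set ZFSet.{u}) ↔ x.rank < l.ord :=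
    fun x => ZFSet.mem_vonNeumann
  refine ⟨fun β hβ => ⟨Order.succ (max κ β.card),
    Cardinal.isRegular_succ (hκ.trans (le_max_left _ _)), Order.lt_succ_iff.2 (le_max_left _ _),
    Cardinal.lt_ord.2 (Order.lt_succ_iff.2 (le_max_right _ _)), ?_⟩, fun θ x hθ hx => ?_⟩
  · rw [hmem, Ordinal.rank_toZFSet] at hβ
    rw [hmem, cardSet, Ordinal.rank_toZFSet, Cardinal.ord_lt_ord]
    refine (Order.succ_le_of_lt (Cardinal.cantor _)).trans_lt
      (hl.isStrongPrelimit (max_lt hκl (Cardinal.lt_ord.1 hβ)))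
  · rw [hmem, cardSet, Ordinal.rank_toZFSet] at hθ
    rw [hmem]
    exact hx.trans_lt hθ

/-- Apply the assumption to the legal strategy whose models contain `A`: the union of the models and
its collapsed ultrapower are the witnesses. Both have rank at most `θ`, so they belong to `U`. -/
theorem isRegRamseyIn_of_forall_run {U : Set ZFSet.{u}} {α κ : Cardinal.{u}}
    (hU : WitnessClosed U κ) (hα : α.IsRegular) (hκ : κ.IsRegular) (hακ : α ≤ κ)
    (hp : Cardinal.powerlt κ κ = κ)
    (hrun : ∀ θ : Cardinal.{u}, θ.IsRegular → κ < θ → cardSet θ ∈ U → ∀ σ : Strategy.{u},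
      (∀ F : Ordinal.{u} → ZFSet.{u}, ∀ i < κ.ord, ChallengerLegal κ θ (σ.play F) F i) →
      ∃ F : Ordinal.{u} → ZFSet.{u}, (∀ i < α.ord, JudgeLegal κ (σ.play F) F i) ∧
        JudgeWins True κ α.ord (σ.play F) F) : IsRegRamseyIn U α κ := by
  refine ⟨hα, hκ, hακ, fun β hβ => ?_⟩
  obtain ⟨θ, hθ, hκθ, hβθ, hθU⟩ := hU.exists_regular β hβ
  refine ⟨θ, hθ, hβθ, hθU, fun A _ hA => ?_⟩
  obtain ⟨σ, hσ⟩ := exists_legal_strategy hκ hp hθ hκθ (hset_subset (cardSet_mem_hset hκθ) hA)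
  obtain ⟨F, hF, hn, hwf⟩ := hrun θ hθ hκθ hθU σ fun F i hi => (hσ F i hi).1
  have hακ' : α.ord ≤ κ.ord := Cardinal.ord_le_ord.2 hακ
  have hpos : 0 < α.ord := hα.ord_pos
  have hM : ∀ i < α.ord, ChallengerLegal κ θ (σ.play F) F i := fun i hi =>
    (hσ F i (hi.trans_le hακ')).1
  have E := measuredModel_of_run hκ hκθ hθ (Cardinal.isSuccLimit_ord hα.aleph0_le) hακ' hM hF hn
    (hwf trivial)
  have hc : (unionSeq α.ord (σ.play F)).card ≤ κ := card_unionSeq_le hκ.aleph0_le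
    (by rwa [Cardinal.card_ord]) fun i hi => (hM i hi).model.card_eq.le
  refine ⟨_, hU.mem_of_rank_le θ _ hθU ?_, isWeakModel_of_elemSub hκ.aleph0_le hκθ hθ E.elem hc
    E.subset E.mem, mem_unionSeq.2 ⟨0, hpos, (hσ F 0 (hpos.trans_le hακ')).2⟩, E.elem,
    closedUnderLT_unionSeq hα fun m hm δ hδ f hf => ⟨m, hm, (hM m hm).model.closed δ
      (hδ.trans_le hακ') f fun i hi => ?_⟩, E.target, hU.mem_of_rank_le θ _ hθU ?_,
    E.isTransitive_target, E.embedding, E.powersetPreserving⟩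
  · refine (ZFSet.rank_le_iff.2 fun {y} hy => ?_)
    exact rank_lt_of_mem_hset (E.elem.subset hy)
  · obtain ⟨k, hk, h⟩ := mem_unionSeq.1 (hf i hi)
    exact (hM m hm).mono k hk h
  · refine (rank_lt_of_mem_hset (mem_hset_of_isTransitive E.isTransitive_target ?_)).le
    exact (E.card_target_le.trans hc).trans_lt hκθ

theorem DecisionProperty.isRegRamseyIn {U : Set ZFSet.{u}} {α κ : Cardinal.{u}}
    (h : DecisionProperty α.ord κ.ord) (hU : WitnessClosed U κ) (hα : α.IsRegular)
    (hκ : κ.IsInaccessible) (hακ : α ≤ κ) : IsRegRamseyIn U α κ :=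
  isRegRamseyIn_of_forall_run hU hα hκ.isRegular hακ (powerlt_self_of_isInaccessible hκ)
    fun _ _ _ _ σ hσ => h.exists_run hα.ord_pos hκ.isRegular hκ.aleph0_lt σ
      fun F i hi _ => hσ F i (hi.trans_le (Cardinal.ord_le_ord.2 hακ))

/-! ### The hierarchy of Ramsey cardinals -/

theorem IsFilterOn.mono {κ : Cardinal.{u}} {F G : ZFSet.{u}} (hF : IsFilterOn κ F) (h : G ⊆ F) :
    IsFilterOn κ G :=
  ⟨fun A hA => hF.subset A (h hA), fun n A hA => hF.card_inter n A fun i => h (hA i)⟩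

theorem IsFilterOn.not_mem_sdiff {κ : Cardinal.{u}} {F A : ZFSet.{u}} (hF : IsFilterOn κ F)
    (hκ : 0 < κ) (h : A ∈ F) : cardSet κ \ A ∉ F := by
  intro h'
  obtain ⟨x, _, hx⟩ := hF.not_disjoint hκ ![A, cardSet κ \ A] (by simp [Fin.forall_fin_succ, h, h'])
  have h0 : x ∈ A := hx 0
  have h1 : x ∈ cardSet κ \ A := hx 1
  exact (ZFSet.mem_sdiff.1 h1).2 h0

/-- Normal filters are countably complete for sequences in the model. -/
theorem IsNormalFor.exists_mem_forall {κ θ : Cardinal.{u}} (hκ : Cardinal.aleph0 < κ) (hκθ : κ < θ)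
    (hθ : θ.IsRegular) {M F : ZFSet.{u}} (hM : ElemSub (M : Set ZFSet.{u}) (HSet θ))
    (hm : cardSet κ ∈ M) (hn : IsNormalFor κ M F) {S : Ordinal.{u} → ZFSet.{u}}
    (hS : seqSet Ordinal.omega0 S ∈ M) (hSF : ∀ i < Ordinal.omega0, S i ∈ F) :
    ∃ x, ∀ i < Ordinal.omega0, x ∈ S i := by
  classical
  have hω : Ordinal.omega0 < κ.ord := by rwa [← Cardinal.ord_aleph0, Cardinal.ord_lt_ord]
  have hpos : 0 < κ := Cardinal.aleph0_pos.trans hκ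
  have hκF : cardSet κ ∈ F := by
    refine (hn.measures _ hm fun _ h => h).resolve_right fun h => ?_
    obtain ⟨x, _, hx⟩ := hn.filter.not_disjoint hpos ![cardSet κ \ cardSet κ] (by simpa using h)
    have h0 : x ∈ cardSet κ \ cardSet κ := hx 0
    exact (ZFSet.mem_sdiff.1 h0).2 (ZFSet.mem_sdiff.1 h0).1
  have hSH : ∀ i < Ordinal.omega0, S i ∈ HSet θ := fun i hi =>
    hset_subset (cardSet_mem_hset hκθ) (hn.filter.subset _ (hSF i hi))
  -- The sequence is prolonged to length `κ` with the constant value `κ`; every member of the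
  -- diagonal intersection from `ω` on lies in all `S i`.
  obtain ⟨X, hX, h1, h2, h3⟩ := hM.exists_mem transClass_hset
    (R := fun _ v X => IsFunOn (v 0) X ∧ (∀ i ∈ v 0, ∀ A, ZFSet.pair i A ∈ X →
      ZFSet.pair i A ∈ v 1 ∨ A = v 0) ∧ ∀ i ∈ v 0, ∀ A, ZFSet.pair i A ∈ v 1 → ZFSet.pair i A ∈ X)
    (.and (.isFunOn _ _) (.and (.ball _ (.all_pair_mem _ _ (.or (.pair_mem _ _ _) (.eq _ _))))
      (.ball _ (.all_pair_mem _ _ (.pair_mem _ _ _))))) ![cardSet κ, seqSet Ordinal.omega0 S]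
    (by simp [Fin.forall_fin_succ, hm]; exact hS)
    ⟨seqSet κ.ord fun i => if i < Ordinal.omega0 then S i else cardSet κ,
      seqSet_mem_hset hθ (Cardinal.ord_lt_ord.2 hκθ) fun i _ => by
        split_ifs with h
        exacts [hSH i h, cardSet_mem_hset hκθ], seqSet_isFunOn _, fun x _ A hA => by
        obtain ⟨i, hi, rfl, rfl⟩ := pair_mem_seqSet.1 hA
        split_ifs with h
        exacts [Or.inl (pair_mem_seqSet.2 ⟨i, h, rfl, rfl⟩), Or.inr rfl], fun x _ A hA => by
        obtain ⟨i, hi, rfl, rfl⟩ := pair_mem_seqSet.1 hA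
        exact pair_mem_seqSet.2 ⟨i, hi.trans hω, rfl, (if_pos hi).symm⟩⟩
  change IsFunOn (cardSet κ) X at h1
  change ∀ i ∈ cardSet κ, ∀ A, ZFSet.pair i A ∈ X →
    ZFSet.pair i A ∈ seqSet Ordinal.omega0 S ∨ A = cardSet κ at h2
  change ∀ i ∈ cardSet κ, ∀ A, ZFSet.pair i A ∈ seqSet Ordinal.omega0 S → ZFSet.pair i A ∈ X at h3
  have hD := hn.normal X hX h1 fun i A hA => by
    obtain ⟨Y, hY, _⟩ := id h1
    rcases h2 i (ZFSet.pair_mem_prod.1 (hY hA)).1 A hA with h | rfl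
    · obtain ⟨k, hk, _, rfl⟩ := pair_mem_seqSet.1 h
      exact hSF k hk
    · exact hκF
  have hc := hn.filter.card_inter 1 (fun _ => diagInter κ X) fun _ => hD
  have hex : ∃ x ∈ diagInter κ X, x ∉ Ordinal.omega0.toZFSet := by
    by_contra! h
    have h4 := ZFSet.card_mono (x := ZFSet.sep (fun z => ∀ _ : Fin 1, z ∈ diagInter κ X) (cardSet κ))
      (y := Ordinal.omega0.toZFSet) fun x hx => h x ((ZFSet.mem_sep.1 hx).2 0)
    rw [hc, Ordinal.card_toZFSet, Ordinal.card_omega0] at h4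
    exact h4.not_gt hκ
  obtain ⟨x, hx, hxω⟩ := hex
  obtain ⟨hxκ, hx⟩ := ZFSet.mem_sep.1 hx
  obtain ⟨k, hk, rfl⟩ := mem_cardSet.1 hxκ
  rw [Ordinal.toZFSet_mem_toZFSet_iff, not_lt] at hxω
  refine ⟨_, fun i hi => hx i.toZFSet (Ordinal.toZFSet_mem_toZFSet_iff.2 (hi.trans_le hxω)) _
    (h3 _ (toZFSet_mem_cardSet.2 (hi.trans hω)) _ (pair_mem_seqSet.2 ⟨i, hi, rfl, rfl⟩))⟩

/-- Winning runs for the judge can be truncated to regular uncountable length. -/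
theorem judgeWins_of_lt {κ θ α : Cardinal.{u}} (hκ : Cardinal.aleph0 < κ) (hκθ : κ < θ)
    (hθ : θ.IsRegular) (hα : α.IsRegular) (hα' : Cardinal.aleph0 < α) {γ : Ordinal.{u}}
    (hαγ : α.ord ≤ γ) (hακ : α ≤ κ) {M F : Ordinal.{u} → ZFSet.{u}}
    (hM : ∀ i < α.ord, ChallengerLegal κ θ M F i) (hF : ∀ i < α.ord, JudgeLegal κ M F i)
    (hn : IsNormalFor κ (unionSeq γ M) (unionSeq γ F)) : JudgeWins True κ α.ord M F := by
  have hpos : 0 < α.ord := hα.ord_pos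
  have hpos' : 0 < κ := Cardinal.aleph0_pos.trans hκ
  have hMsub : unionSeq α.ord M ⊆ unionSeq γ M := fun x hx => by
    obtain ⟨i, hi, hx⟩ := mem_unionSeq.1 hx
    exact mem_unionSeq.2 ⟨i, hi.trans_le hαγ, hx⟩
  have hFsub : unionSeq α.ord F ⊆ unionSeq γ F := fun x hx => by
    obtain ⟨i, hi, hx⟩ := mem_unionSeq.1 hx
    exact mem_unionSeq.2 ⟨i, hi.trans_le hαγ, hx⟩
  have helem : ElemSub (unionSeq α.ord M : Set ZFSet.{u}) (HSet θ) :=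
    elemSub_unionSeq hpos (fun i hi => (hM i hi).elem) fun i hi => (hM i hi).mono
  have hmem : cardSet κ ∈ unionSeq α.ord M := mem_unionSeq.2 ⟨0, hpos, (hM 0 hpos).model.mem⟩
  have hmeas : Measures κ (unionSeq α.ord F) (unionSeq α.ord M) := fun A hA hAκ => by
    obtain ⟨i, hi, hA⟩ := mem_unionSeq.1 hA
    exact ((hF i hi).measures A hA hAκ).imp (fun h => mem_unionSeq.2 ⟨i, hi, h⟩)
      fun h => mem_unionSeq.2 ⟨i, hi, h⟩
  have hnorm : IsNormalFor κ (unionSeq α.ord M) (unionSeq α.ord F) := by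
    refine ⟨hn.filter.mono hFsub, hmeas, fun X hX hXf hXF => ?_⟩
    have hD : diagInter κ X ∈ unionSeq α.ord M := helem.sep_mem
      (R := fun _ v β => ∀ i ∈ β, ∀ A, ZFSet.pair i A ∈ v 0 → β ∈ A)
      (.ball _ (.all_pair_mem _ _ (.mem _ _))) ![X] (by simpa using hX) hmem
    -- The short filter measures the diagonal intersection and cannot contain the complement, as the
    -- long filter contains the set itself.
    exact (hmeas _ hD ZFSet.sep_subset).resolve_right fun h => hn.filter.not_mem_sdiff hpos'
      (hn.normal X (hMsub hX) hXf fun i A hA => hFsub (hXF i A hA)) (hFsub h)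
  have hclosed : ClosedUnderLT α (unionSeq α.ord M) :=
    closedUnderLT_unionSeq hα fun m hm δ hδ f hf => ⟨m, hm, (hM m hm).model.closed δ
      (hδ.trans_le (Cardinal.ord_le_ord.2 hακ)) f fun i hi => by
        obtain ⟨k, hk, h⟩ := mem_unionSeq.1 (hf i hi)
        exact (hM m hm).mono k hk h⟩
  refine ⟨hnorm, fun _ => wfUltrapower_of_forall_seq
    (fun f hf g hg => helem.ultSet_mem hmem hf hg) fun S hSM hSF => ?_⟩
  -- Uncountable regular length closes the union of the models under `ω`-sequences, so countable
  -- completeness of normal filters gives well-foundedness.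
  have hSM' : seqSet Ordinal.omega0 (fun i => S (Function.invFun (fun n : ℕ => (n : Ordinal.{u})) i)) ∈
      unionSeq α.ord M := hclosed _ (by rwa [← Cardinal.ord_aleph0, Cardinal.ord_lt_ord]) _
        fun i _ => hSM _
  obtain ⟨x, hx⟩ := hnorm.exists_mem_forall hκ hκθ hθ helem hmem hSM' fun i _ => hSF _
  refine ⟨x, fun n => ?_⟩
  have h := hx n (Ordinal.natCast_lt_omega0 n)
  rwa [Function.leftInverse_invFun (f := fun n : ℕ => (n : Ordinal.{u})) Nat.cast_injective n] at h

/-- If the judge could not win the well-founded game of length `α` against `σ`, then by truncation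
`σ` would win the game of length `β`, even when well-foundedness is not demanded there. -/
theorem FilterPropertyIn.isRegRamseyIn {wf : Prop} {α β κ : Cardinal.{u}}
    (h : FilterPropertyIn Set.univ wf β.ord κ) (hα : α.IsRegular) (hα' : Cardinal.aleph0 < α)
    (hαβ : α ≤ β) (hβκ : β ≤ κ) : IsRegRamseyIn Set.univ α κ := by
  obtain ⟨hω, hκ, hp, hgame⟩ := h
  refine isRegRamseyIn_of_forall_run (witnessClosed_univ hω.le) hα hκ (hαβ.trans hβκ) hp
    fun θ hθ hκθ _ σ hσ => ?_
  have hord := Cardinal.ord_le_ord.2 hαβ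
  by_contra hcon
  refine hgame θ hθ hκθ trivial ⟨σ, fun F => ⟨fun i hi _ =>
    hσ F i (hi.trans_le (Cardinal.ord_le_ord.2 hβκ)), fun hF hwin => hcon ⟨F, fun i hi =>
      hF i (hi.trans_le hord), judgeWins_of_lt hω hκθ hθ hα hα' hord (hαβ.trans hβκ)
        (fun i hi => hσ F i (hi.trans_le (Cardinal.ord_le_ord.2 (hαβ.trans hβκ))))
        (fun i hi => hF i (hi.trans_le hord)) hwin.1⟩⟩⟩

/-- For singular `α₁` the successor of `α₀` serves: it is at most `α₁`, and it is regular and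
uncountable, as truncation requires. -/
theorem IsRamsey.exists_isRegRamseyIn {wf : Prop} {α₀ α₁ κ : Cardinal.{u}}
    (h : IsRamsey wf α₁ κ) (h₀ : Cardinal.aleph0 ≤ α₀) (h₀₁ : α₀ < α₁) :
    ∃ α : Cardinal.{u}, α₀ < α ∧ IsRegRamseyIn Set.univ α κ := by
  obtain ⟨_, h₁, h2, h3⟩ := h
  by_cases hreg : α₁.IsRegular
  · exact ⟨α₁, h₀₁, h2 hreg⟩
  · exact ⟨Order.succ α₀, Order.lt_succ α₀, (h3 hreg).isRegRamseyIn (Cardinal.isRegular_succ h₀)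
      (Order.lt_succ_iff.2 h₀) (Order.succ_le_of_lt h₀₁) h₁⟩

theorem IsRegRamseyIn.decisionProperty {α κ : Cardinal.{u}} (h : IsRegRamseyIn Set.univ α κ)
    {γ : Ordinal.{u}} (hγ : γ < α.ord) : DecisionProperty γ κ.ord ∧
      ∀ δ < κ.ord, ∃ μ < κ.ord, δ < μ ∧ DecisionProperty γ μ := by
  obtain ⟨_, hκ, hακ, h⟩ := h
  have hγκ : γ < κ.ord := hγ.trans_le (Cardinal.ord_le_ord.2 hακ)
  -- With `θ` above the size of `V_{κ+ω}`, `H(θ)` is correct about the decision property for all `μ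
  -- ≤ κ` in question. Any `A` will do, so `∅` is taken.
  obtain ⟨θ, hθ, hβθ, _, h⟩ :=
    h (ZFSet.vonNeumann (κ.ord + Ordinal.omega0)).card.ord trivial
  obtain ⟨M, _, hM, _, hel, hcl, N, _, hN, j, hj⟩ := h ∅ trivial (ZFSet.empty_subset _)
  have E : RamseyEmbedding α κ θ M N j :=
    ⟨hθ, hκ.aleph0_le, hel, hM.subset, hM.mem, hcl, hN, hj⟩
  have hl := Cardinal.isSuccLimit_ord hκ.aleph0_le
  have hV := Cardinal.ord_lt_ord.1 hβθ
  refine ⟨decisionProperty_of_internal hθ hl hγκ.le le_rfl hV (E.internalDecision_hset hγ hγκ),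
    fun δ hδ => ?_⟩
  obtain ⟨μ, hμ, hδμ, h⟩ := E.exists_internalDecision_lt hγ hγκ hδ
  exact ⟨μ, hμ, hδμ, decisionProperty_of_internal hθ hl hγκ.le hμ.le hV h⟩

theorem DecisionProperty.isRamseyIn {U : Set ZFSet.{u}} {α κ : Cardinal.{u}}
    (h : DecisionProperty α.ord κ.ord) (hU : WitnessClosed U κ) (hα : Cardinal.aleph0 ≤ α)
    (hκ : κ.IsInaccessible) (hακ : α ≤ κ) (wf : Prop) : IsRamseyIn U wf α κ :=
  ⟨hα, hακ, fun hreg => h.isRegRamseyIn hU hreg hκ hακ, fun _ =>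
    h.filterProperty (Cardinal.ord_pos.2 (Cardinal.aleph0_pos.trans_le hα)) hκ U _⟩

theorem IsRamsey.decisionProperty {wf : Prop} {α₀ α₁ κ : Cardinal.{u}}
    (h : IsRamsey wf α₁ κ) (h₀ : Cardinal.aleph0 ≤ α₀) (h₀₁ : α₀ < α₁) :
    κ.IsInaccessible ∧ DecisionProperty α₀.ord κ.ord ∧ ∀ β < κ.ord, ∃ μ : Cardinal.{u},
      β < μ.ord ∧ α₀ < μ ∧ μ < κ ∧ μ.IsInaccessible ∧ DecisionProperty α₀.ord μ.ord := by
  obtain ⟨α, hα, hreg⟩ := h.exists_isRegRamseyIn h₀ h₀₁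
  obtain ⟨h1, h2⟩ := hreg.decisionProperty (Cardinal.ord_lt_ord.2 hα)
  have hpos : 0 < α₀.ord := Cardinal.ord_pos.2 (Cardinal.aleph0_pos.trans_le h₀)
  have hακ : α₀ < κ := h₀₁.trans_le h.2.1
  have hω : Ordinal.omega0 ≤ α₀.ord := by rwa [← Cardinal.ord_aleph0, Cardinal.ord_le_ord]
  refine ⟨h1.isInaccessible hpos (h₀.trans_lt hακ), h1, fun β hβ => ?_⟩
  -- Going above `α₀` makes `μ` uncountable and ensures `α₀ < μ`.
  obtain ⟨μ, hμ, hβμ, h⟩ := h2 (max β α₀.ord) (max_lt hβ (Cardinal.ord_lt_ord.2 hακ))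
  obtain ⟨c, rfl, hc⟩ := h.exists_cardinal hpos (hω.trans_lt ((le_max_right _ _).trans_lt hβμ))
  exact ⟨c, (le_max_left _ _).trans_lt hβμ,
    Cardinal.ord_lt_ord.1 ((le_max_right _ _).trans_lt hβμ), Cardinal.ord_lt_ord.1 hμ, hc, h⟩

theorem IsRamsey.exists_isRamseyIn_lt {wf : Prop} {α₀ α₁ κ : Cardinal.{u}}
    (h : IsRamsey wf α₁ κ) (h₀ : Cardinal.aleph0 ≤ α₀) (h₀₁ : α₀ < α₁) {U : Set ZFSet.{u}}
    (hU : ∀ μ < κ, Cardinal.aleph0 ≤ μ → WitnessClosed U μ) {β : Ordinal.{u}} (hβ : β < κ.ord) :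
    ∃ μ : Cardinal.{u}, β < μ.ord ∧ μ < κ ∧ IsRamseyIn U wf α₀ μ := by
  obtain ⟨μ, h1, h2, h3, h4, h5⟩ := (h.decisionProperty h₀ h₀₁).2.2 β hβ
  exact ⟨μ, h1, h3, h5.isRamseyIn (hU μ h3 (h₀.trans h2.le)) h₀ h4 h2.le wf⟩

theorem IsRamsey.exists_isRamsey_lt {wf : Prop} {α₀ α₁ κ : Cardinal.{u}}
    (h : IsRamsey wf α₁ κ) (h₀ : Cardinal.aleph0 ≤ α₀) (h₀₁ : α₀ < α₁) {β : Ordinal.{u}}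
    (hβ : β < κ.ord) : ∃ μ : Cardinal.{u}, β < μ.ord ∧ μ < κ ∧ IsRamsey wf α₀ μ :=
  h.exists_isRamseyIn_lt h₀ h₀₁ (fun _ _ h => witnessClosed_univ h) hβ

end RamseyHierarchy

/-! ### The theorem -/

theorem theorem5p9 (wf : Prop) (α₀ α₁ κ : Cardinal.{u})
    (h₀ : Cardinal.aleph0 ≤ α₀) (h₀₁ : α₀ < α₁) (h₁ : α₁ ≤ κ)
    (hκ : RamseyHierarchy.IsRamsey wf α₁ κ) :
    (∀ β : Ordinal.{u}, β < κ.ord → ∃ μ : Cardinal.{u}, β < μ.ord ∧ μ < κ ∧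
      RamseyHierarchy.IsRamseyIn (ZFSet.vonNeumann κ.ord : Set ZFSet.{u}) wf α₀ μ) ∧
    (α₀.IsRegular → ∀ β : Ordinal.{u}, β < κ.ord → ∃ μ : Cardinal.{u}, β < μ.ord ∧ μ < κ ∧
      RamseyHierarchy.IsRamsey wf α₀ μ) ∧
    RamseyHierarchy.IsRamsey wf α₀ κ ∧
    (α₀.IsRegular → α₁ < κ → ∃ μ : Cardinal.{u}, α₁ < μ ∧ μ < κ ∧
      RamseyHierarchy.IsRamsey wf α₀ μ ∧ ¬ RamseyHierarchy.IsRamsey wf α₁ μ) := by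
  obtain ⟨hin, hdec, -⟩ := hκ.decisionProperty h₀ h₀₁
  refine ⟨fun β hβ => hκ.exists_isRamseyIn_lt h₀ h₀₁
      (fun μ hμ h => RamseyHierarchy.witnessClosed_vonNeumann h hμ hin) hβ,
    fun _ β hβ => hκ.exists_isRamsey_lt h₀ h₀₁ hβ,
    hdec.isRamseyIn (RamseyHierarchy.witnessClosed_univ hin.aleph0_lt.le) h₀ hin
      (h₀₁.le.trans h₁) wf, fun _ h₁' => ?_⟩
  -- The least element of `s` is not `α₁`-Ramsey, since otherwise there would be an `α₀`-Ramsey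
  -- cardinal strictly between `α₁` and it.
  let s : Set Cardinal.{u} := {μ | α₁ < μ ∧ μ < κ ∧ RamseyHierarchy.IsRamsey wf α₀ μ}
  have hs : s.Nonempty := by
    obtain ⟨μ, h1, h2⟩ := hκ.exists_isRamsey_lt h₀ h₀₁ (Cardinal.ord_lt_ord.2 h₁')
    exact ⟨μ, Cardinal.ord_lt_ord.1 h1, h2⟩
  obtain ⟨μ, ⟨h1, h2, h3⟩, hmin⟩ := Cardinal.lt_wf.has_min s hs
  refine ⟨μ, h1, h2, h3, fun h => ?_⟩
  obtain ⟨ν, h4, h5, h6⟩ := h.exists_isRamsey_lt h₀ h₀₁ (Cardinal.ord_lt_ord.2 h1)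
  exact hmin ν ⟨Cardinal.ord_lt_ord.1 h4, h5.trans h2, h6⟩ h5
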